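/- Let $n\ge 1$. A smooth function $\sigma(x,\xi_1,\xi_2)\in C^\infty((\mathbb R^n)^3)$ belongs to $BS^m_{0,0}$ ($m\in\mathbb R$) if for all multi-indices $\alpha,\beta_1,\beta_2$ there is a constant $C_{\alpha,\beta_1,\beta_2}$ with $$|\partial_x^\alpha\partial_{\xi_1}^{\beta_1}\partial_{\xi_2}^{\beta_2}\sigma(x,\xi_1,\xi_2)|\le C_{\alpha,\beta_1,\beta_2}(1+|\xi_1|+|\xi_2|)^m ,$$ and to $BS^{(m_1,m_2)}_{0,0}$ ($m_1,m_2\in\mathbb R$) if the same holds with $(1+|\xi_1|)^{m_1}(1+|\xi_2|)^{m_2}$ in place of $(1+|\xi_1|+|\xi_2|)^m$. For $f_1,f_2$ in the Schwartz space $\mathcal S(\mathbb R^n)$ put $$T_\sigma(f_1,f_2)(x)=\frac1{(2\pi)^{2n}}\int_{(\mathbb R^n)^2}e^{ix\cdot(\xi_1+\xi_2)}\sigma(x,\xi_1,\xi_2)\widehat{f_1}(\xi_1)\widehat{f_2}(\xi_2)\,d\xi_1d\xi_2,\qquad \widehat f(\xi)=\int_{\mathbb R^n}e^{-ix\cdot\xi}f(x)\,dx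 .$$ Fix $\psi_0\in\mathcal S(\mathbb R^n)$ with $\operatorname{supp}\psi_0\subset\{|\xi|\le2\}$ and $\psi_0=1$ on $\{|\xi|\le1\}$, let $\psi(\xi)=\psi_0(\xi)-\psi_0(2\xi)$, $\psi_\ell(\xi)=\psi(2^{-\ell}\xi)$ for $\ell\ge1$, let $\psi_\ell(D)f$ be given by $\widehat{\psi_\ell(D)f}=\psi_\ell\widehat f$, and for $f\in\mathcal S'(\mathbb R^n)$ let $$\|f\|_{B^s_{p,q}}=\Big(\sum_{\ell\ge0}2^{\ell sq}\|\psi_\ell(D)f\|_{L^p}^q\Big)^{1/q}\in[0,\infty]$$ (a supremum over $\ell$ if $q=\infty$). **Theorem 1.1.** Let $1\le p\le2\le p_1,p_2,\widetilde p_1,\widetilde p_2\le\infty$, $0<q,q_1,q_2,\widetilde q_1,\widetilde q_2\le\infty$ and $s,s_1,s_2,\widetilde s_1,\widetilde s_2\in\mathbb R$ be such that $$\frac1p\le\frac1{p_1}+\frac1{p_2},\quad \frac1p\le\frac1{\widetilde p_1}+\frac1{\widetilde p_2},\quad \frac1q=\frac1{q_1}+\frac1{q_2}=\frac1{\widetilde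 q_1}+\frac1{\widetilde q_2},\quad s=s_1+s_2=\widetilde s_1+\widetilde s_2 .$$ 1. Suppose $\sigma\in BS^{-n/2}_{0,0}$. If $\widetilde s_1<n/2$, $s_2<n/2$ and $s>-n/2$, then there is a constant $C$ such that $$\|T_\sigma(f_1,f_2)\|_{B^s_{p,q}}\le C\Big(\|f_1\|_{B^{s_1}_{p_1,q_1}}\|f_2\|_{B^{s_2}_{p_2,q_2}}+\|f_1\|_{B^{\widetilde s_1}_{\widetilde p_1,\widetilde q_1}}\|f_2\|_{B^{\widetilde s_2}_{\widetilde p_2,\widetilde q_2}}\Big)\qquad(*)$$ for all $f_1,f_2\in\mathcal S(\mathbb R^n)$. 2. Suppose $m_1,m_2\in\mathbb R$, $m_1+m_2=-n/2$ and $\sigma\in BS^{(m_1,m_2)}_{0,0}$. If $\widetilde s_1<m_1+n/2$, $s_2<m_2+n/2$ and $s>-n/2$, then there is a constant $C$ such that $(*)$ holds for all $f_1,f_2\in\mathcal S(\mathbb R^n)$. -/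

import Mathlib

open MeasureTheory
open scoped SchwartzMap ENNReal NNReal ContDiff FourierTransform

noncomputable section

namespace KatoPonce

/-- The Euclidean space `ℝⁿ`. -/
abbrev Rn (n : ℕ) : Type := EuclideanSpace ℝ (Fin n)

/-! ### Bilinear symbol classes of `S_{0,0}`-type -/

/-- The derivative `∂_v f` of a function `f` in the direction `v`. -/
def dirDeriv {V : Type*} [NormedAddCommGroup V] [NormedSpace ℝ V] (v : V) (f : V → ℂ) : V → ℂ :=
  fun z => fderiv ℝ f z v

/-- For directions `e 0, …, e (n-1)` and a multi-index `α`, the iterated derivative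
`∂_{e 0}^{α 0} ⋯ ∂_{e (n-1)}^{α (n-1)} f`. -/
def multiDeriv {V : Type*} [NormedAddCommGroup V] [NormedSpace ℝ V] {n : ℕ}
    (e : Fin n → V) (α : Fin n → ℕ) (f : V → ℂ) : V → ℂ :=
  (List.finRange n).foldr (fun i g => (dirDeriv (e i))^[α i] g) f

/-- `∂_x^α ∂_{ξ₁}^{β₁} ∂_{ξ₂}^{β₂} σ` for a function `σ` of `(x, ξ₁, ξ₂) ∈ (ℝⁿ)³`. -/
def symbolDeriv {n : ℕ} (α β₁ β₂ : Fin n → ℕ) (σ : Rn n × Rn n × Rn n → ℂ) :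
    Rn n × Rn n × Rn n → ℂ :=
  multiDeriv (fun i => (EuclideanSpace.single i (1 : ℝ), 0, 0)) α
    (multiDeriv (fun i => (0, EuclideanSpace.single i (1 : ℝ), 0)) β₁
      (multiDeriv (fun i => (0, 0, EuclideanSpace.single i (1 : ℝ))) β₂ σ))

/-- The bilinear Hörmander class `BS^m_{0,0}`. -/
def IsBS {n : ℕ} (m : ℝ) (σ : Rn n × Rn n × Rn n → ℂ) : Prop :=
  ContDiff ℝ ∞ σ ∧ ∀ α β₁ β₂ : Fin n → ℕ, ∃ C : ℝ, ∀ x ξ₁ ξ₂ : Rn n,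
    ‖symbolDeriv α β₁ β₂ σ (x, ξ₁, ξ₂)‖ ≤ C * (1 + ‖ξ₁‖ + ‖ξ₂‖) ^ m

/-- The class `BS^{(m₁,m₂)}_{0,0}`. -/
def IsBS₂ {n : ℕ} (m₁ m₂ : ℝ) (σ : Rn n × Rn n × Rn n → ℂ) : Prop :=
  ContDiff ℝ ∞ σ ∧ ∀ α β₁ β₂ : Fin n → ℕ, ∃ C : ℝ, ∀ x ξ₁ ξ₂ : Rn n,
    ‖symbolDeriv α β₁ β₂ σ (x, ξ₁, ξ₂)‖ ≤ C * ((1 + ‖ξ₁‖) ^ m₁ * (1 + ‖ξ₂‖) ^ m₂)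

/-! ### Bilinear pseudo-differential operators -/

/-- The Fourier transform with the normalization `f̂(ξ) = ∫ e^{-i x·ξ} f(x) dx`. -/
def hat {n : ℕ} (f : Rn n → ℂ) (ξ : Rn n) : ℂ :=
  ∫ x, Complex.exp (-(Complex.I * (inner ℝ x ξ : ℝ))) * f x

/-- The bilinear pseudo-differential operator
`T_σ(f₁, f₂)(x) = (2π)^{-2n} ∫_{(ℝⁿ)²} e^{i x·(ξ₁+ξ₂)} σ(x, ξ₁, ξ₂) f̂₁(ξ₁) f̂₂(ξ₂) dξ₁ dξ₂`. -/
def bilinearOp {n : ℕ} (σ : Rn n × Rn n × Rn n → ℂ) (f₁ f₂ : 𝓢(Rn n, ℂ)) (x : Rn n) : ℂ :=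
  1 / (2 * (Real.pi : ℂ)) ^ (2 * n) *
    ∫ ξ : Rn n × Rn n, Complex.exp (Complex.I * (inner ℝ x (ξ.1 + ξ.2) : ℝ)) *
      σ (x, ξ.1, ξ.2) * hat f₁ ξ.1 * hat f₂ ξ.2

/-! ### Besov norms -/

/-- `ψ₀` generates a Littlewood–Paley decomposition: `supp ψ₀ ⊆ {|ξ| ≤ 2}` and `ψ₀ = 1` on
`{|ξ| ≤ 1}`. -/
def IsLPGenerator {n : ℕ} (ψ₀ : 𝓢(Rn n, ℂ)) : Prop :=
  tsupport ψ₀ ⊆ Metric.closedBall 0 2 ∧ ∀ ξ : Rn n, ‖ξ‖ ≤ 1 → ψ₀ ξ = 1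

/-- The functions `ψ_ℓ`: `ψ_0 = ψ₀`, and `ψ_ℓ(ξ) = ψ(2^{-ℓ} ξ)` with `ψ(ξ) = ψ₀(ξ) - ψ₀(2ξ)` for
`ℓ ≥ 1`. -/
def lpPiece {n : ℕ} (ψ₀ : 𝓢(Rn n, ℂ)) (ℓ : ℕ) (ξ : Rn n) : ℂ :=
  if ℓ = 0 then ψ₀ ξ
  else ψ₀ (((2 : ℝ) ^ ℓ)⁻¹ • ξ) - ψ₀ ((2 : ℝ) • ((2 : ℝ) ^ ℓ)⁻¹ • ξ)

/-- The Fourier multiplier `m(D)u`, i.e. `(m(D)u)^ = m û`, on tempered distributions, for the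
normalization `f̂(ξ) = ∫ e^{-i x·ξ} f(x) dx`. Mathlib's Fourier transform has the kernel
`e^{-2πi x·η}`, so that its frequency variable is `η = ξ / (2π)`. -/
def multiplier {n : ℕ} (m : Rn n → ℂ) (u : 𝓢'(Rn n, ℂ)) : 𝓢'(Rn n, ℂ) :=
  TemperedDistribution.fourierMultiplierCLM ℂ (fun η => m ((2 * Real.pi) • η)) u

/-- The tempered distribution `u` is given by integration against the function `g`. -/
def IsRepresentedBy {n : ℕ} (u : 𝓢'(Rn n, ℂ)) (g : Rn n → ℂ) : Prop :=
  ∀ φ : 𝓢(Rn n, ℂ), Integrable (fun x => φ x * g x) ∧ u φ = ∫ x, φ x * g x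

/-- The `L^p` (quasi-)norm of a tempered distribution: the `L^p` norm of the function (unique up to
a null set) that represents it, and `∞` if it is not given by a function. -/
def distLpNorm {n : ℕ} (p : ℝ≥0∞) (u : 𝓢'(Rn n, ℂ)) : ℝ≥0∞ :=
  ⨅ (g : Rn n → ℂ) (_ : IsRepresentedBy u g), eLpNorm g p volume

/-- The Besov (quasi-)norm `‖u‖_{B^s_{p,q}} = (∑_ℓ 2^{ℓsq} ‖ψ_ℓ(D)u‖_{L^p}^q)^{1/q}`, a supremum if
`q = ∞`; the space `B^s_{p,q}` consists of the `u` at which it is finite. -/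
def besovNorm {n : ℕ} (ψ₀ : 𝓢(Rn n, ℂ)) (s : ℝ) (p q : ℝ≥0∞) (u : 𝓢'(Rn n, ℂ)) : ℝ≥0∞ :=
  if q = ⊤ then
    ⨆ ℓ : ℕ, (2 : ℝ≥0∞) ^ ((ℓ : ℝ) * s) * distLpNorm p (multiplier (lpPiece ψ₀ ℓ) u)
  else
    (∑' ℓ : ℕ, (2 : ℝ≥0∞) ^ ((ℓ : ℝ) * s * q.toReal) *
      distLpNorm p (multiplier (lpPiece ψ₀ ℓ) u) ^ q.toReal) ^ (1 / q.toReal)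

/-- The estimate
`‖T_σ(f₁,f₂)‖_{B^s_{p,q}} ≤ C (‖f₁‖_{B^{s₁}_{p₁,q₁}} ‖f₂‖_{B^{s₂}_{p₂,q₂}} +
  ‖f₁‖_{B^{t₁}_{r₁,u₁}} ‖f₂‖_{B^{t₂}_{r₂,u₂}})`
for all Schwartz functions `f₁, f₂`, with a constant `C` that does not depend on `f₁, f₂`. It
includes that the function `T_σ(f₁,f₂)` is a tempered distribution. -/
def KatoPonceEstimate {n : ℕ} (ψ₀ : 𝓢(Rn n, ℂ)) (σ : Rn n × Rn n × Rn n → ℂ)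
    (s : ℝ) (p q : ℝ≥0∞) (s₁ : ℝ) (p₁ q₁ : ℝ≥0∞) (s₂ : ℝ) (p₂ q₂ : ℝ≥0∞)
    (t₁ : ℝ) (r₁ u₁ : ℝ≥0∞) (t₂ : ℝ) (r₂ u₂ : ℝ≥0∞) : Prop :=
  ∃ C : ℝ≥0, ∀ f₁ f₂ : 𝓢(Rn n, ℂ), ∃ T : 𝓢'(Rn n, ℂ),
    IsRepresentedBy T (bilinearOp σ f₁ f₂) ∧
    besovNorm ψ₀ s p q T ≤ C *
      (besovNorm ψ₀ s₁ p₁ q₁ (f₁ : 𝓢'(Rn n, ℂ)) * besovNorm ψ₀ s₂ p₂ q₂ (f₂ : 𝓢'(Rn n, ℂ)) +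
       besovNorm ψ₀ t₁ r₁ u₁ (f₁ : 𝓢'(Rn n, ℂ)) * besovNorm ψ₀ t₂ r₂ u₂ (f₂ : 𝓢'(Rn n, ℂ)))

end KatoPonce

end

/-! The proof is a count in phase space at unit scale. Localize the output near position x and
frequency τ, and the inputs near positions y₁, y₂ and frequencies η₁, η₂. Differentiating a symbol
of S_{0,0} type does not worsen its bound, so integration by parts (`norm_oscillatory_integral_le`,
`norm_packetKernel_le`) bounds the kernel between wave packets by the weight of the symbol at (η₁,
η₂) times any prescribed negative power of 1 + |τ-η₁-η₂| + |x-y₁| + |x-y₂|.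

Positions are thus essentially diagonal, and for each x a convolution-like form in the frequencies
remains. When τ, η₁, η₂ lie in dyadic bands, Cauchy–Schwarz bounds its L² norm in τ by the square
root of the measure of the smallest band times the L² norms of the inputs
(`lintegral_sq_trilinear_le`). By Plancherel these L² norms in frequency are local L² averages about
x (`lintegral_enorm_windowed_sq`, `lintegral_decayWeight_packet`). Since p ≤ 2 ≤ p₁, p₂, the local
averages control the L^p norm of the output and are controlled by the L^{p_i} norms of the inputs.
Unit-scale averages are also bounded, so 1/p ≤ 1/p₁ + 1/p₂ suffices in place of equality
(`exists_lintegral_averages_le`, `exists_lintegral_le_local`).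

It remains to sum over the bands ℓ of the output and j, k of the inputs. For k ≤ j the factor is
2^{j m₁ + k m₂ + min(j,k,ℓ) n/2}, with rapid decay in the gap between the two largest indices. As m₁
+ m₂ = -n/2, the regime k ≤ j ≈ ℓ leaves 2^{-(m₂+n/2-s₂)(j-k)} and the regime ℓ ≤ k ≈ j leaves
2^{-(s+n/2)(j-ℓ)}, both summable under the hypotheses (`bandExp_le`). The case j < k is symmetric
and yields the second product. The sums become discrete convolutions with exponential kernels,
bounded on ℓ^q for every q > 0, followed by Hölder (`exists_lqNorm_bands_le`). A symbol in BS^{-n/2}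
lies in BS^{(-n/2,0)} and in BS^{(0,-n/2)}; the first class serves k ≤ j, the second j < k. -/

noncomputable section

namespace KatoPonce

/-! ### From the partial derivatives of a symbol to its total derivatives -/

section Derivatives

variable {V : Type*} [NormedAddCommGroup V] [NormedSpace ℝ V]

lemma contDiff_dirDeriv {f : V → ℂ} (hf : ContDiff ℝ ∞ f) (v : V) :
    ContDiff ℝ ∞ (dirDeriv v f) :=
  (hf.fderiv_right (m := ∞) (by simp)).clm_apply contDiff_const

lemma contDiff_dirDeriv_iterate {f : V → ℂ} (hf : ContDiff ℝ ∞ f) (v : V) (k : ℕ) :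
    ContDiff ℝ ∞ ((dirDeriv v)^[k] f) := by
  induction k with
  | zero => exact hf
  | succ k ih => rw [Function.iterate_succ_apply']; exact contDiff_dirDeriv ih v

lemma dirDeriv_comm {f : V → ℂ} (hf : ContDiff ℝ ∞ f) (v w : V) :
    dirDeriv v (dirDeriv w f) = dirDeriv w (dirDeriv v f) := by
  have hd : Differentiable ℝ (fderiv ℝ f) :=
    (hf.fderiv_right (m := ∞) (by simp)).differentiable (by simp)
  have key : ∀ (a b z : V), dirDeriv a (dirDeriv b f) z = fderiv ℝ (fderiv ℝ f) z a b := by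
    intro a b z
    have h : dirDeriv b f = fun z => fderiv ℝ f z b := rfl
    rw [h]
    simp only [dirDeriv]
    rw [fderiv_clm_apply (hd z) (differentiableAt_const b)]
    simp
  funext z
  rw [key, key]
  exact (hf.contDiffAt.isSymmSndFDerivAt
    (by simpa using (WithTop.coe_le_coe.2 le_top : (2 : ℕ∞ω) ≤ ((⊤ : ℕ∞) : ℕ∞ω)))).eq v w

lemma dirDeriv_iterate_comm {f : V → ℂ} (hf : ContDiff ℝ ∞ f) (v w : V) (k : ℕ) :
    dirDeriv v ((dirDeriv w)^[k] f) = (dirDeriv w)^[k] (dirDeriv v f) := by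
  induction k with
  | zero => rfl
  | succ k ih =>
    rw [Function.iterate_succ_apply', Function.iterate_succ_apply', ← ih,
      dirDeriv_comm (contDiff_dirDeriv_iterate hf w k)]

variable {n : ℕ} (e : Fin n → V)

lemma contDiff_foldr {f : V → ℂ} (hf : ContDiff ℝ ∞ f) (α : Fin n → ℕ) (l : List (Fin n)) :
    ContDiff ℝ ∞ (l.foldr (fun i g => (dirDeriv (e i))^[α i] g) f) := by
  induction l with
  | nil => exact hf
  | cons a l ih => exact contDiff_dirDeriv_iterate ih _ _

lemma contDiff_multiDeriv {f : V → ℂ} (hf : ContDiff ℝ ∞ f) (α : Fin n → ℕ) :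
    ContDiff ℝ ∞ (multiDeriv e α f) := contDiff_foldr e hf α _

lemma dirDeriv_foldr_comm {f : V → ℂ} (hf : ContDiff ℝ ∞ f) (α : Fin n → ℕ) (v : V)
    (l : List (Fin n)) :
    dirDeriv v (l.foldr (fun i g => (dirDeriv (e i))^[α i] g) f) =
      l.foldr (fun i g => (dirDeriv (e i))^[α i] g) (dirDeriv v f) := by
  induction l with
  | nil => rfl
  | cons a l ih =>
    simp only [List.foldr_cons]
    rw [dirDeriv_iterate_comm (contDiff_foldr e hf α l), ih]

lemma dirDeriv_multiDeriv_comm {f : V → ℂ} (hf : ContDiff ℝ ∞ f) (α : Fin n → ℕ) (v : V) :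
    dirDeriv v (multiDeriv e α f) = multiDeriv e α (dirDeriv v f) :=
  dirDeriv_foldr_comm e hf α v _

/-- Partial derivatives of a smooth function commute, so the extra derivative can be moved outwards
until it meets the block with its own index. -/
lemma multiDeriv_dirDeriv {f : V → ℂ} (hf : ContDiff ℝ ∞ f) (α : Fin n → ℕ) (i : Fin n) :
    multiDeriv e α (dirDeriv (e i) f) = multiDeriv e (Function.update α i (α i + 1)) f := by
  -- The induction needs both alternatives: the derivative is absorbed if `i` occurs in the list,
  -- and raising the exponent is invisible if it does not. Without duplicates the absorption happens
  -- once.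
  have key : ∀ l : List (Fin n), l.Nodup →
      (i ∈ l → l.foldr (fun i g => (dirDeriv (e i))^[α i] g) (dirDeriv (e i) f) =
        l.foldr (fun j g => (dirDeriv (e j))^[Function.update α i (α i + 1) j] g) f) ∧
      (i ∉ l → l.foldr (fun i g => (dirDeriv (e i))^[α i] g) f =
        l.foldr (fun j g => (dirDeriv (e j))^[Function.update α i (α i + 1) j] g) f) := by
    intro l
    induction l with
    | nil => simp
    | cons a l ih =>
      intro hl
      obtain ⟨ha, hl⟩ := List.nodup_cons.1 hl
      obtain ⟨ih1, ih2⟩ := ih hl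
      simp only [List.foldr_cons]
      constructor
      · intro hi
        by_cases hai : a = i
        · subst hai
          rw [← ih2 ha, Function.update_self, Function.iterate_succ_apply,
            dirDeriv_foldr_comm e hf]
        · rw [Function.update_of_ne hai, ih1]
          rcases List.mem_cons.1 hi with h | h
          · exact absurd h.symm hai
          · exact h
      · intro hi
        have hai : a ≠ i := fun h => hi (by simp [h])
        rw [Function.update_of_ne hai, ih2 (fun h => hi (List.mem_cons_of_mem _ h))]
  exact (key _ (List.nodup_finRange n)).1 (List.mem_finRange i)

/-- The differential is the sum of the dual basis functionals times the directional derivatives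
along the basis, so one total derivative is traded for basis derivatives at a cost independent of
`f`. -/
lemma norm_iteratedFDeriv_succ_le [FiniteDimensional ℝ V] {ι : Type*} [Fintype ι]
    (b : Module.Basis ι ℝ V) (k : ℕ) :
    ∃ c : ι → ℝ, (∀ i, 0 ≤ c i) ∧ ∀ f : V → ℂ, ContDiff ℝ ∞ f → ∀ z,
      ‖iteratedFDeriv ℝ (k + 1) f z‖ ≤ ∑ i, c i * ‖iteratedFDeriv ℝ k (dirDeriv (b i) f) z‖ := by
  let L : ι → (ℂ →L[ℝ] (V →L[ℝ] ℂ)) := fun i =>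
    ContinuousLinearMap.smulRightL ℝ V ℂ (LinearMap.toContinuousLinearMap (b.coord i))
  refine ⟨fun i => ‖L i‖, fun i => norm_nonneg (L i), fun f hf z => ?_⟩
  have h1 : fderiv ℝ f = fun z => ∑ i, (L i ∘ dirDeriv (b i) f) z := by
    funext z
    ext v
    conv_lhs => rw [← b.sum_repr v, map_sum]
    simp [L, dirDeriv]
  have hs : ∀ i, ContDiff ℝ ∞ (L i ∘ dirDeriv (b i) f) := fun i =>
    (L i).contDiff.comp (contDiff_dirDeriv hf _)
  rw [← norm_iteratedFDeriv_fderiv, h1, iteratedFDeriv_fun_sum_apply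
    (fun i _ => ((hs i).contDiffAt.of_le (by exact_mod_cast le_top)))]
  refine (norm_sum_le _ _).trans (Finset.sum_le_sum fun i _ => ?_)
  rw [ContinuousLinearMap.iteratedFDeriv_comp_left (L i)
    (contDiff_dirDeriv hf _).contDiffAt (i := k) (by exact_mod_cast le_top)]
  exact ContinuousLinearMap.norm_compContinuousMultilinearMap_le _ _

end Derivatives

/-- The smooth functions whose derivatives `∂_x^α ∂_{ξ₁}^{β₁} ∂_{ξ₂}^{β₂}` are all bounded by
multiples of the weight `w`. -/
def HasSymbolBounds {n : ℕ} (w : Rn n × Rn n × Rn n → ℝ) (f : Rn n × Rn n × Rn n → ℂ) : Prop :=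
  ContDiff ℝ ∞ f ∧ ∀ α β₁ β₂ : Fin n → ℕ, ∃ C : ℝ, ∀ z, ‖symbolDeriv α β₁ β₂ f z‖ ≤ C * w z

/-- The standard basis of `(ℝⁿ)³`. -/
def tripleBasis (n : ℕ) : Module.Basis (Fin n ⊕ Fin n ⊕ Fin n) ℝ (Rn n × Rn n × Rn n) :=
  (EuclideanSpace.basisFun (Fin n) ℝ).toBasis.prod
    ((EuclideanSpace.basisFun (Fin n) ℝ).toBasis.prod (EuclideanSpace.basisFun (Fin n) ℝ).toBasis)

/-- The bounds run over all multi-indices, and one more derivative only raises one entry. The three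
blocks of variables differ in how many blocks the derivative must be commuted past. -/
lemma HasSymbolBounds.dirDeriv {n : ℕ} {w : Rn n × Rn n × Rn n → ℝ} {f : Rn n × Rn n × Rn n → ℂ}
    (hf : HasSymbolBounds w f) (i : Fin n ⊕ Fin n ⊕ Fin n) :
    HasSymbolBounds w (dirDeriv (tripleBasis n i) f) := by
  obtain ⟨hs, hb⟩ := hf
  refine ⟨contDiff_dirDeriv hs _, fun α β₁ β₂ => ?_⟩
  rcases i with i | i | i
  · obtain ⟨C, hC⟩ := hb (Function.update α i (α i + 1)) β₁ β₂
    refine ⟨C, fun z => ?_⟩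
    suffices h : symbolDeriv α β₁ β₂ (KatoPonce.dirDeriv (tripleBasis n (Sum.inl i)) f) =
        symbolDeriv (Function.update α i (α i + 1)) β₁ β₂ f by rw [h]; exact hC z
    have hi : tripleBasis n (Sum.inl i) = (EuclideanSpace.single i (1 : ℝ), 0, 0) := by
      simp [tripleBasis, Module.Basis.prod_apply, Prod.zero_eq_mk]
    rw [hi]
    unfold symbolDeriv
    rw [← dirDeriv_multiDeriv_comm _ hs, ← dirDeriv_multiDeriv_comm _ (contDiff_multiDeriv _ hs _)]
    exact multiDeriv_dirDeriv (fun i => (EuclideanSpace.single i (1 : ℝ), 0, 0))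
      (contDiff_multiDeriv _ (contDiff_multiDeriv _ hs _) _) α i
  · obtain ⟨C, hC⟩ := hb α (Function.update β₁ i (β₁ i + 1)) β₂
    refine ⟨C, fun z => ?_⟩
    suffices h : symbolDeriv α β₁ β₂ (KatoPonce.dirDeriv (tripleBasis n (Sum.inr (Sum.inl i))) f) =
        symbolDeriv α (Function.update β₁ i (β₁ i + 1)) β₂ f by rw [h]; exact hC z
    have hi : tripleBasis n (Sum.inr (Sum.inl i)) = (0, EuclideanSpace.single i (1 : ℝ), 0) := by
      simp [tripleBasis, Module.Basis.prod_apply, Prod.zero_eq_mk]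
    rw [hi]
    unfold symbolDeriv
    rw [← dirDeriv_multiDeriv_comm _ hs]
    exact congrArg _ (multiDeriv_dirDeriv (fun i => (0, EuclideanSpace.single i (1 : ℝ), 0))
      (contDiff_multiDeriv _ hs _) β₁ i)
  · obtain ⟨C, hC⟩ := hb α β₁ (Function.update β₂ i (β₂ i + 1))
    refine ⟨C, fun z => ?_⟩
    suffices h : symbolDeriv α β₁ β₂ (KatoPonce.dirDeriv (tripleBasis n (Sum.inr (Sum.inr i))) f) =
        symbolDeriv α β₁ (Function.update β₂ i (β₂ i + 1)) f by rw [h]; exact hC z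
    have hi : tripleBasis n (Sum.inr (Sum.inr i)) = (0, 0, EuclideanSpace.single i (1 : ℝ)) := by
      simp [tripleBasis, Module.Basis.prod_apply, Prod.zero_eq_mk]
    rw [hi]
    unfold symbolDeriv
    exact congrArg _ (congrArg _ (multiDeriv_dirDeriv
      (fun i => (0, 0, EuclideanSpace.single i (1 : ℝ))) hs β₂ i))

/-- Total derivatives keep the same weight and, unlike coordinate derivatives, behave well under the
Leibniz rule and affine substitutions. -/
lemma HasSymbolBounds.norm_iteratedFDeriv_le {n : ℕ} {w : Rn n × Rn n × Rn n → ℝ} (k : ℕ) :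
    ∀ {f : Rn n × Rn n × Rn n → ℂ}, HasSymbolBounds w f →
      ∃ C : ℝ, ∀ z, ‖iteratedFDeriv ℝ k f z‖ ≤ C * w z := by
  induction k with
  | zero =>
    intro f hf
    obtain ⟨C, hC⟩ := hf.2 0 0 0
    refine ⟨C, fun z => ?_⟩
    have hid : ∀ (e : Fin n → Rn n × Rn n × Rn n) (g : Rn n × Rn n × Rn n → ℂ),
        multiDeriv e 0 g = g := by
      intro e g
      unfold multiDeriv
      induction List.finRange n with
      | nil => rfl
      | cons a l ih => simp
    have := hC z
    simp only [symbolDeriv, hid] at this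
    simpa using this
  | succ k ih =>
    intro f hf
    obtain ⟨c, hc0, hc⟩ := norm_iteratedFDeriv_succ_le (tripleBasis n) k
    choose C hC using fun i => ih (hf.dirDeriv i)
    refine ⟨∑ i, c i * C i, fun z => (hc f hf.1 z).trans ?_⟩
    rw [Finset.sum_mul]
    refine Finset.sum_le_sum fun i _ => ?_
    rw [mul_assoc]
    exact mul_le_mul_of_nonneg_left (hC i z) (hc0 i)

@[simp] lemma norm_fourierChar (s : ℝ) : ‖(Real.fourierChar s : ℂ)‖ = 1 := Circle.norm_coe _

/-! ### Families of smooth functions with uniform bounds -/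

section Families

variable {ι V V' : Type*} [NormedAddCommGroup V] [NormedSpace ℝ V]
  [NormedAddCommGroup V'] [NormedSpace ℝ V']

/-- The functions `F i` are smooth and each derivative of `F i` is bounded by a multiple of `w i`,
uniformly in `i`. -/
def UnifSmooth (w : ι → V → ℝ) (F : ι → V → ℂ) : Prop :=
  (∀ i, ContDiff ℝ ∞ (F i)) ∧
    ∀ m : ℕ, ∃ C : ℝ, 0 ≤ C ∧ ∀ i v, ‖iteratedFDeriv ℝ m (F i) v‖ ≤ C * w i v

/-- The functions `F i` form a bounded family of Schwartz functions. -/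
def UnifSchwartz (F : ι → V → ℂ) : Prop :=
  ∀ M : ℕ, UnifSmooth (fun (_ : ι) v => ((1 + ‖v‖) ^ M)⁻¹) F

lemma UnifSmooth.mono {w w' : ι → V → ℝ} {F : ι → V → ℂ} (h : UnifSmooth w F) (A : ℝ)
    (hA : 0 ≤ A) (hw : ∀ i v, w i v ≤ A * w' i v) : UnifSmooth w' F := by
  refine ⟨h.1, fun m => ?_⟩
  obtain ⟨C, hC0, hC⟩ := h.2 m
  refine ⟨C * A, by positivity, fun i v => (hC i v).trans ?_⟩
  rw [mul_assoc]
  exact mul_le_mul_of_nonneg_left (hw i v) hC0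

lemma UnifSmooth.mul {w w' : ι → V → ℝ} {F G : ι → V → ℂ} (hF : UnifSmooth w F)
    (hG : UnifSmooth w' G) :
    UnifSmooth (fun i v => w i v * w' i v) (fun i v => F i v * G i v) := by
  refine ⟨fun i => (hF.1 i).mul (hG.1 i), fun m => ?_⟩
  choose C hC0 hC using hF.2
  choose D hD0 hD using hG.2
  refine ⟨∑ k ∈ Finset.range (m + 1), (m.choose k : ℝ) * C k * D (m - k),
    Finset.sum_nonneg fun k _ => mul_nonneg (mul_nonneg (by positivity) (hC0 k)) (hD0 _),
    fun i v => ?_⟩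
  refine (norm_iteratedFDeriv_mul_le (hF.1 i) (hG.1 i) v (n := m)
    (by exact_mod_cast le_top)).trans ?_
  rw [Finset.sum_mul]
  refine Finset.sum_le_sum fun k _ => ?_
  calc (m.choose k : ℝ) * ‖iteratedFDeriv ℝ k (F i) v‖ * ‖iteratedFDeriv ℝ (m - k) (G i) v‖
      ≤ (m.choose k : ℝ) * (C k * w i v) * (D (m - k) * w' i v) := by
        gcongr
        · exact mul_nonneg (by positivity) ((norm_nonneg _).trans (hC k i v))
        · exact hC k i v
        · exact hD _ i v
    _ = _ := by ring

/-- Only the linear part of the substitution enters the derivatives, so the translations are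
arbitrary. This makes the later bounds uniform in the base points x, η₁, η₂. -/
lemma UnifSmooth.comp_clm {ι' : Type*} {w : ι → V → ℝ} {F : ι → V → ℂ} (hF : UnifSmooth w F)
    (r : ι' → ι) (a : ι' → V) (g : ι' → V' →L[ℝ] V) (K : ℝ) (hK : ∀ i, ‖g i‖ ≤ K) :
    UnifSmooth (fun i v => w (r i) (a i + g i v)) (fun i v => F (r i) (a i + g i v)) := by
  refine ⟨fun i => (hF.1 (r i)).comp (contDiff_const.add (g i).contDiff), fun m => ?_⟩
  obtain ⟨C, hC0, hC⟩ := hF.2 m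
  refine ⟨C * |K| ^ m, by positivity, fun i v => ?_⟩
  have h1 : (fun v => F (r i) (a i + g i v)) = (fun z => F (r i) (a i + z)) ∘ (g i) := rfl
  have hs : ContDiff ℝ ∞ (fun z => F (r i) (a i + z)) :=
    (hF.1 (r i)).comp (contDiff_const.add contDiff_id)
  simp only [h1]
  rw [(g i).iteratedFDeriv_comp_right hs v (i := m) (by exact_mod_cast le_top),
    iteratedFDeriv_comp_add_left]
  refine (ContinuousMultilinearMap.norm_compContinuousLinearMap_le _ _).trans ?_
  simp only [Finset.prod_const, Finset.card_univ, Fintype.card_fin]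
  calc _ ≤ (C * w (r i) (a i + g i v)) * |K| ^ m := by
        gcongr
        · exact (norm_nonneg _).trans (hC (r i) _)
        · exact hC _ _
        · exact (hK i).trans (le_abs_self K)
    _ = _ := by ring

lemma UnifSchwartz.reindex {ι' : Type*} {F : ι → V → ℂ} (hF : UnifSchwartz F) (r : ι' → ι) :
    UnifSchwartz (fun i => F (r i)) := fun M =>
  ⟨fun i => (hF M).1 (r i), fun m => by
    obtain ⟨C, hC0, hC⟩ := (hF M).2 m
    exact ⟨C, hC0, fun i v => hC (r i) v⟩⟩

lemma UnifSchwartz.temperate_mul {F : ι → V → ℂ} (hF : UnifSchwartz F) {g : V → ℂ}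
    (hg : g.HasTemperateGrowth) : UnifSchwartz (fun i v => g v * F i v) := by
  intro M
  refine ⟨fun i => hg.1.mul ((hF 0).1 i), fun m => ?_⟩
  obtain ⟨k, C, hC0, hC⟩ := hg.norm_iteratedFDeriv_le_uniform m
  -- The derivatives of `g` up to order `m` grow at most like the `k`-th power of 1 + |v|; the
  -- additional `k` orders of decay compensate.
  choose D hD0 hD using (hF (M + k)).2
  refine ⟨∑ j ∈ Finset.range (m + 1), (m.choose j : ℝ) * C * D (m - j),
    Finset.sum_nonneg fun j _ => mul_nonneg (by positivity) (hD0 _), fun i v => ?_⟩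
  refine (norm_iteratedFDeriv_mul_le hg.1 ((hF 0).1 i) v (n := m)
    (by exact_mod_cast le_top)).trans ?_
  rw [Finset.sum_mul]
  refine Finset.sum_le_sum fun j hj => ?_
  have hpos : 0 < 1 + ‖v‖ := by positivity
  calc (m.choose j : ℝ) * ‖iteratedFDeriv ℝ j g v‖ * ‖iteratedFDeriv ℝ (m - j) (F i) v‖
      ≤ (m.choose j : ℝ) * (C * (1 + ‖v‖) ^ k) * (D (m - j) * ((1 + ‖v‖) ^ (M + k))⁻¹) := by
        gcongr
        · exact hC j (Nat.lt_succ_iff.1 (Finset.mem_range.1 hj)) v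
        · exact hD _ i v
    _ = _ := by
      rw [pow_add]
      field_simp

lemma SchwartzMap.unifSchwartz (f : 𝓢(V, ℂ)) : UnifSchwartz (fun (_ : Unit) => (f : V → ℂ)) := by
  intro M
  refine ⟨fun _ => f.smooth _, fun m => ?_⟩
  refine ⟨2 ^ M * ((Finset.Iic (M, m)).sup fun m => SchwartzMap.seminorm ℝ m.1 m.2) f,
    by positivity, fun _ v => ?_⟩
  rw [← div_eq_mul_inv, le_div_iff₀ (by positivity), mul_comm]
  exact SchwartzMap.one_add_le_sup_seminorm_apply (𝕜 := ℝ) (m := (M, m)) le_rfl le_rfl f v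

end Families

lemma hasTemperateGrowth_fourierChar :
    Function.HasTemperateGrowth (fun s : ℝ => (Real.fourierChar s : ℂ)) := by
  have hd : ∀ n : ℕ, iteratedDeriv n (fun s : ℝ => (Real.fourierChar s : ℂ)) =
      fun s => (2 * Real.pi * Complex.I) ^ n * (Real.fourierChar s : ℂ) := by
    intro n
    induction n with
    | zero => simp
    | succ n ih =>
      rw [iteratedDeriv_succ, ih]
      funext s
      rw [deriv_const_mul _ (Real.differentiable_fourierChar s), Real.deriv_fourierChar]
      ring
  refine ⟨?_, fun n => ⟨0, (2 * Real.pi) ^ n, fun x => ?_⟩⟩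
  · have : (fun s : ℝ => (Real.fourierChar s : ℂ)) =
        fun s : ℝ => Complex.exp (((2 * Real.pi * s : ℝ) : ℂ) * Complex.I) := by
      funext s; exact Real.fourierChar_apply s
    rw [this]
    exact Complex.contDiff_exp.comp
      ((Complex.ofRealCLM.contDiff.comp (contDiff_const.mul contDiff_id)).mul contDiff_const)
  · rw [norm_iteratedFDeriv_eq_norm_iteratedDeriv, hd]
    simp [abs_of_pos Real.pi_pos]

/-! ### Oscillatory integrals over `(ℝⁿ)³` -/

instance isAddHaarMeasure_pair (n : ℕ) :
    (volume : Measure (Rn n × Rn n)).IsAddHaarMeasure :=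
  Measure.prod.instIsAddHaarMeasure _ _

instance isAddHaarMeasure_triple (n : ℕ) :
    (volume : Measure (Rn n × Rn n × Rn n)).IsAddHaarMeasure :=
  Measure.prod.instIsAddHaarMeasure _ _

/-- The inner product of `(ℝⁿ)³` as a bilinear map. -/
def triplePairing (n : ℕ) : (Rn n × Rn n × Rn n) →L[ℝ] (Rn n × Rn n × Rn n) →L[ℝ] ℝ :=
  let a := ContinuousLinearMap.fst ℝ (Rn n) (Rn n × Rn n)
  let b := (ContinuousLinearMap.fst ℝ (Rn n) (Rn n)).comp
    (ContinuousLinearMap.snd ℝ (Rn n) (Rn n × Rn n))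
  let c := (ContinuousLinearMap.snd ℝ (Rn n) (Rn n)).comp
    (ContinuousLinearMap.snd ℝ (Rn n) (Rn n × Rn n))
  (innerSL ℝ).bilinearComp a a + (innerSL ℝ).bilinearComp b b + (innerSL ℝ).bilinearComp c c

@[simp] lemma triplePairing_apply {n : ℕ} (v w : Rn n × Rn n × Rn n) :
    triplePairing n v w = inner ℝ v.1 w.1 + inner ℝ v.2.1 w.2.1 + inner ℝ v.2.2 w.2.2 := by
  simp [triplePairing]

/-- `w` is paired by some unit vector to its norm. -/
lemma exists_triplePairing_eq_norm {n : ℕ} (w : Rn n × Rn n × Rn n) :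
    ∃ v : Rn n × Rn n × Rn n, ‖v‖ ≤ 1 ∧ triplePairing n v w = ‖w‖ := by
  have key : ∀ a : Rn n, ∃ u : Rn n, ‖u‖ ≤ 1 ∧ inner ℝ u a = ‖a‖ := by
    intro a
    refine ⟨‖a‖⁻¹ • a, ?_, ?_⟩
    · rw [norm_smul, norm_inv, norm_norm]
      exact inv_mul_le_one
    · rw [real_inner_smul_left, real_inner_self_eq_norm_sq]
      by_cases h : ‖a‖ = 0
      · simp [h]
      · field_simp
  rcases max_choice ‖w.1‖ ‖w.2‖ with h | h
  · obtain ⟨u, hu, hua⟩ := key w.1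
    exact ⟨(u, 0, 0), by simpa [Prod.norm_def] using hu, by simp [hua, Prod.norm_def w, h]⟩
  · rcases max_choice ‖w.2.1‖ ‖w.2.2‖ with h' | h'
    · obtain ⟨u, hu, hua⟩ := key w.2.1
      refine ⟨(0, u, 0), by simpa [Prod.norm_def] using hu, ?_⟩
      rw [Prod.norm_def w, h, Prod.norm_def w.2, h']
      simp [hua]
    · obtain ⟨u, hu, hua⟩ := key w.2.2
      refine ⟨(0, 0, u), by simpa [Prod.norm_def] using hu, ?_⟩
      rw [Prod.norm_def w, h, Prod.norm_def w.2, h']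
      simp [hua]

lemma integrable_inv_one_add_norm_pow (V : Type*) [NormedAddCommGroup V] [NormedSpace ℝ V]
    [FiniteDimensional ℝ V] [MeasurableSpace V] [BorelSpace V] (μ : Measure V)
    [μ.IsAddHaarMeasure] {M : ℕ} (hM : Module.finrank ℝ V < M) :
    Integrable (fun v : V => ((1 + ‖v‖) ^ M)⁻¹) μ := by
  have h := integrable_one_add_norm (E := V) (μ := μ) (r := M) (by exact_mod_cast hM)
  refine h.congr (Filter.Eventually.of_forall fun v => ?_)
  simp only [Real.rpow_neg (show (0 : ℝ) ≤ 1 + ‖v‖ by positivity), Real.rpow_natCast]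

/-- Integration by parts: the `N`-th power of |w| times the integral is controlled by the L¹ norms
of the derivatives up to order `N`, with constants that do not see `F`. -/
lemma norm_oscillatory_integral_le (n N : ℕ) :
    ∃ M : ℕ, ∃ C : ℝ, 0 ≤ C ∧ ∀ (F : Rn n × Rn n × Rn n → ℂ) (A : ℝ), ContDiff ℝ ∞ F →
      (∀ m ≤ N, ∀ v, ‖iteratedFDeriv ℝ m F v‖ ≤ A * ((1 + ‖v‖) ^ M)⁻¹) → ∀ w,
      ‖∫ v, (Real.fourierChar (triplePairing n v w) : ℂ) * F v‖ ≤ C * A * ((1 + ‖w‖) ^ N)⁻¹ := by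
  -- The least integer decay that makes the majorant integrable.
  set M := Module.finrank ℝ (Rn n × Rn n × Rn n) + 1 with hM
  have hint : Integrable (fun v : Rn n × Rn n × Rn n => ((1 + ‖v‖) ^ M)⁻¹) :=
    integrable_inv_one_add_norm_pow _ _ (by omega)
  obtain ⟨I, hI⟩ : ∃ I, I = ∫ v : Rn n × Rn n × Rn n, ((1 + ‖v‖) ^ M)⁻¹ := ⟨_, rfl⟩
  have hI0 : 0 ≤ I := hI ▸ integral_nonneg fun v => by positivity
  have hC : (0 : ℝ) ≤ 2 ^ N * (I + 2 ^ N * ((N + 1) * I)) := by positivity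
  refine ⟨M, _, hC, fun F A hF hA w => ?_⟩
  have hintF : ∀ m ≤ N, Integrable (fun v => ‖iteratedFDeriv ℝ m F v‖) := fun m hm =>
    (hint.const_mul A).mono' ((hF.continuous_iteratedFDeriv
      (by exact_mod_cast le_top)).norm.aestronglyMeasurable)
      (Filter.Eventually.of_forall fun v => by simpa using hA m hm v)
  have hbd : ∀ m ≤ N, ∫ v, ‖iteratedFDeriv ℝ m F v‖ ≤ A * I := fun m hm => by
    rw [hI, ← integral_const_mul]
    exact integral_mono (hintF m hm) (hint.const_mul A) (hA m hm)
  have hA0 : 0 ≤ A := by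
    have := (norm_nonneg _).trans (hA 0 (Nat.zero_le _) 0)
    simpa using this
  obtain ⟨J, hJ⟩ : ∃ J, J = ∫ v, (Real.fourierChar (triplePairing n v w) : ℂ) * F v := ⟨_, rfl⟩
  rw [← hJ]
  have hJ1 : ‖J‖ ≤ A * I := by
    rw [hJ]
    refine (norm_integral_le_integral_norm _).trans ?_
    simp only [norm_mul, norm_fourierChar, one_mul]
    simpa using hbd 0 (Nat.zero_le _)
  -- `VectorFourier.fourierIntegral` carries the opposite sign in the phase, hence the evaluation at
  -- `-w`.
  have hJF : J = VectorFourier.fourierIntegral Real.fourierChar volume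
      (triplePairing n).toLinearMap₁₂ F (-w) := by
    simp only [hJ, VectorFourier.fourierIntegral, Circle.smul_def, smul_eq_mul]
    refine integral_congr_ae (Filter.Eventually.of_forall fun v => ?_)
    simp only [map_neg, neg_neg]
    rfl
  -- The derivative estimate sees `w` only through its pairing with one vector; along `u` that
  -- pairing is the full norm.
  obtain ⟨u, hu, huw⟩ := exists_triplePairing_eq_norm w
  have hJ2 : ‖w‖ ^ N * ‖J‖ ≤ 2 ^ N * ((N + 1) * (A * I)) := by
    have h := VectorFourier.pow_mul_norm_iteratedFDeriv_fourierIntegral_le (triplePairing n)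
      (f := F) (μ := volume) (K := 0) (N := N) (hF.of_le (by exact_mod_cast le_top))
      (fun k m hk hm => by
        have : k = 0 := by simpa using hk
        subst this
        simpa using hintF m (by exact_mod_cast hm)) (k := 0) (n := N) le_rfl le_rfl u (-w)
    rw [map_neg, huw, abs_neg, abs_norm] at h
    simp only [norm_iteratedFDeriv_zero, pow_zero, mul_one, ← hJF] at h
    refine h.trans ?_
    have h2 : ∑ p ∈ Finset.range (0 + 1) ×ˢ Finset.range (N + 1),
        ∫ v, ‖v‖ ^ p.1 * ‖iteratedFDeriv ℝ p.2 F v‖ ≤ (N + 1) * (A * I) := by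
      rw [Finset.sum_product]
      simp only [zero_add, Finset.range_one, Finset.sum_singleton, pow_zero, one_mul]
      refine (Finset.sum_le_sum (g := fun _ => A * I) fun m hm =>
        hbd m (Nat.lt_succ_iff.1 (Finset.mem_range.1 hm))).trans (by simp)
    have h3 : ‖u‖ ^ N ≤ 1 := pow_le_one₀ (norm_nonneg _) hu
    refine (mul_le_mul_of_nonneg_left h2 (by positivity)).trans ?_
    refine mul_le_mul_of_nonneg_right ?_ (by positivity)
    simpa using mul_le_mul_of_nonneg_right h3 (show (0 : ℝ) ≤ 2 ^ N by positivity)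
  rw [← div_eq_mul_inv, le_div_iff₀ (by positivity)]
  have h3 : (1 + ‖w‖) ^ N ≤ 2 ^ N * (1 + ‖w‖ ^ N) := by
    have := add_pow_le (zero_le_one) (norm_nonneg w) N
    rw [one_pow] at this
    refine this.trans ?_
    gcongr
    · norm_num
    · omega
  calc ‖J‖ * (1 + ‖w‖) ^ N ≤ ‖J‖ * (2 ^ N * (1 + ‖w‖ ^ N)) := by gcongr
    _ = 2 ^ N * (‖J‖ + ‖w‖ ^ N * ‖J‖) := by ring
    _ ≤ 2 ^ N * (A * I + 2 ^ N * ((N + 1) * (A * I))) := by gcongr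
    _ = _ := by ring

/-! ### The kernel estimate -/

section MoreFamilies

variable {ι V : Type*} [NormedAddCommGroup V] [NormedSpace ℝ V]

lemma UnifSmooth.sub {w : ι → V → ℝ} {F G : ι → V → ℂ} (hF : UnifSmooth w F)
    (hG : UnifSmooth w G) : UnifSmooth w (fun i v => F i v - G i v) := by
  refine ⟨fun i => (hF.1 i).sub (hG.1 i), fun m => ?_⟩
  obtain ⟨C, hC0, hC⟩ := hF.2 m
  obtain ⟨D, hD0, hD⟩ := hG.2 m
  refine ⟨C + D, by positivity, fun i v => ?_⟩
  have hs : iteratedFDeriv ℝ m (fun v => F i v - G i v) v =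
      iteratedFDeriv ℝ m (F i) v - iteratedFDeriv ℝ m (G i) v :=
    iteratedFDeriv_sub_apply ((hF.1 i).contDiffAt.of_le (by exact_mod_cast le_top))
      ((hG.1 i).contDiffAt.of_le (by exact_mod_cast le_top))
  simp only [hs]
  exact (norm_sub_le _ _).trans ((add_le_add (hC i v) (hD i v)).trans (by rw [add_mul]))

lemma unifSmooth_const (b : ι → ℂ) (hb : ∀ i, ‖b i‖ ≤ 1) :
    UnifSmooth (fun (_ : ι) (_ : V) => 1) (fun i _ => b i) := by
  refine ⟨fun i => contDiff_const, fun m => ⟨1, zero_le_one, fun i v => ?_⟩⟩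
  rcases Nat.eq_zero_or_pos m with rfl | hm
  · simpa using hb i
  · rw [iteratedFDeriv_const_of_ne (by omega)]
    simp

end MoreFamilies

/-! ### Fourier transforms and tensor products of bounded families of Schwartz functions. -/

lemma UnifSchwartz.comp_neg {ι : Type*} {n : ℕ} {F : ι → Rn n → ℂ} (h : UnifSchwartz F) :
    UnifSchwartz (fun i v => F i (-v)) := by
  intro M
  have := (h M).comp_clm (ι' := ι) id (fun _ => 0) (fun _ => -ContinuousLinearMap.id ℝ (Rn n))
    ‖-ContinuousLinearMap.id ℝ (Rn n)‖ (fun _ => le_rfl)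
  simpa using this

/-- Weighted L¹ norms of the derivatives of the family are uniformly bounded, and finitely many of
them control a given polynomial weight times a given derivative of the transforms. -/
lemma UnifSchwartz.fourier {ι : Type*} {n : ℕ} {F : ι → Rn n → ℂ} (h : UnifSchwartz F) :
    UnifSchwartz (fun i => 𝓕 (F i)) := by
  set d := Module.finrank ℝ (Rn n) + 1 with hd
  have hint : Integrable (fun v : Rn n => ((1 + ‖v‖) ^ d)⁻¹) :=
    integrable_inv_one_add_norm_pow _ _ (by omega)
  have key : ∀ k m : ℕ, ∃ C : ℝ, 0 ≤ C ∧ ∀ i v,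
      ‖v‖ ^ k * ‖iteratedFDeriv ℝ m (F i) v‖ ≤ C * ((1 + ‖v‖) ^ d)⁻¹ := by
    intro k m
    obtain ⟨C, hC0, hC⟩ := (h (k + d)).2 m
    refine ⟨C, hC0, fun i v => ?_⟩
    calc ‖v‖ ^ k * ‖iteratedFDeriv ℝ m (F i) v‖
        ≤ (1 + ‖v‖) ^ k * (C * ((1 + ‖v‖) ^ (k + d))⁻¹) := by
          gcongr
          · linarith
          · exact hC i v
      _ = _ := by
          rw [pow_add]
          field_simp
  have hI : ∀ i (k m : ℕ), Integrable (fun v => ‖v‖ ^ k * ‖iteratedFDeriv ℝ m (F i) v‖) := by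
    intro i k m
    obtain ⟨C, hC0, hC⟩ := key k m
    refine (hint.const_mul C).mono' ?_ (Filter.Eventually.of_forall fun v => ?_)
    · exact ((continuous_norm.pow k).mul (((h 0).1 i).continuous_iteratedFDeriv
        (by exact_mod_cast le_top)).norm).aestronglyMeasurable
    · rw [Real.norm_of_nonneg (by positivity)]
      exact hC i v
  have key2 : ∀ k m : ℕ, ∃ C : ℝ, 0 ≤ C ∧ ∀ i,
      ∫ v, ‖v‖ ^ k * ‖iteratedFDeriv ℝ m (F i) v‖ ≤ C := by
    intro k m
    obtain ⟨C, hC0, hC⟩ := key k m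
    refine ⟨∫ v : Rn n, C * ((1 + ‖v‖) ^ d)⁻¹, integral_nonneg fun v => by positivity,
      fun i => integral_mono (hI i k m) (hint.const_mul C) (hC i)⟩
  choose C hC0 hC using key2
  have key3 : ∀ k N : ℕ, ∃ D : ℝ, 0 ≤ D ∧ ∀ i w,
      ‖w‖ ^ N * ‖iteratedFDeriv ℝ k (𝓕 (F i)) w‖ ≤ D := by
    intro k N
    refine ⟨(2 * Real.pi) ^ k * (2 * k + 2) ^ N *
      ∑ p ∈ Finset.range (k + 1) ×ˢ Finset.range (N + 1), C p.1 p.2,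
      mul_nonneg (mul_nonneg (pow_nonneg Real.two_pi_pos.le _) (by positivity))
        (Finset.sum_nonneg fun p _ => hC0 _ _), fun i w => ?_⟩
    refine (Real.pow_mul_norm_iteratedFDeriv_fourier_le (K := ⊤) (N := ⊤) ((h 0).1 i)
      (fun k m _ _ => hI i k m) (k := k) (n := N) le_top le_top w).trans ?_
    refine mul_le_mul_of_nonneg_left (Finset.sum_le_sum fun p _ => hC _ _ i)
      (mul_nonneg (pow_nonneg Real.two_pi_pos.le _) (by positivity))
  intro M
  refine ⟨fun i => Real.contDiff_fourier (N := ⊤) fun k _ => by simpa using hI i k 0,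
    fun k => ?_⟩
  obtain ⟨D, hD0, hD⟩ := key3 k 0
  obtain ⟨D', hD'0, hD'⟩ := key3 k M
  refine ⟨2 ^ M * (D + D'), by positivity, fun i w => ?_⟩
  rw [← div_eq_mul_inv, le_div_iff₀ (by positivity)]
  have h3 : (1 + ‖w‖) ^ M ≤ 2 ^ M * (1 + ‖w‖ ^ M) := by
    have := add_pow_le (zero_le_one) (norm_nonneg w) M
    rw [one_pow] at this
    refine this.trans ?_
    gcongr
    · norm_num
    · omega
  have h4 := hD i w
  rw [pow_zero, one_mul] at h4
  calc ‖iteratedFDeriv ℝ k (𝓕 (F i)) w‖ * (1 + ‖w‖) ^ M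
      ≤ ‖iteratedFDeriv ℝ k (𝓕 (F i)) w‖ * (2 ^ M * (1 + ‖w‖ ^ M)) := by gcongr
    _ = 2 ^ M * (‖iteratedFDeriv ℝ k (𝓕 (F i)) w‖ +
          ‖w‖ ^ M * ‖iteratedFDeriv ℝ k (𝓕 (F i)) w‖) := by ring
    _ ≤ 2 ^ M * (D + D') := by
        gcongr
        exact hD' i w

lemma UnifSchwartz.fourierInv {ι : Type*} {n : ℕ} {F : ι → Rn n → ℂ} (h : UnifSchwartz F) :
    UnifSchwartz (fun i => 𝓕⁻ (F i)) := by
  have := h.fourier.comp_neg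
  simpa only [← Real.fourierInv_eq_fourier_neg] using this

/-- Separate decay gives joint decay, because (1+|v₁|)(1+|v₂|)(1+|v₃|) ≥ 1+|v|. -/
lemma unifSchwartz_tensor {ι : Type*} {n : ℕ} {κ : ι → Rn n → ℂ} (hκ : UnifSchwartz κ)
    (χ : 𝓢(Rn n, ℂ)) :
    UnifSchwartz (fun i (v : Rn n × Rn n × Rn n) => κ i v.1 * χ v.2.1 * χ v.2.2) := by
  intro M
  let p1 := ContinuousLinearMap.fst ℝ (Rn n) (Rn n × Rn n)
  let p2 := (ContinuousLinearMap.fst ℝ (Rn n) (Rn n)).comp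
    (ContinuousLinearMap.snd ℝ (Rn n) (Rn n × Rn n))
  let p3 := (ContinuousLinearMap.snd ℝ (Rn n) (Rn n)).comp
    (ContinuousLinearMap.snd ℝ (Rn n) (Rn n × Rn n))
  have h1 := (hκ M).comp_clm (ι' := ι) id (fun _ => 0) (fun _ => p1) ‖p1‖ (fun _ => le_rfl)
  have h2 := (SchwartzMap.unifSchwartz χ M).comp_clm (ι' := ι) (fun _ => ()) (fun _ => 0)
    (fun _ => p2) ‖p2‖ (fun _ => le_rfl)
  have h3 := (SchwartzMap.unifSchwartz χ M).comp_clm (ι' := ι) (fun _ => ()) (fun _ => 0)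
    (fun _ => p3) ‖p3‖ (fun _ => le_rfl)
  have h := (h1.mul h2).mul h3
  simp only [p1, p2, p3, ContinuousLinearMap.coe_fst', ContinuousLinearMap.coe_comp,
    ContinuousLinearMap.coe_snd', Function.comp_apply, zero_add, id_eq] at h
  refine h.mono 1 zero_le_one fun i v => ?_
  rw [one_mul, ← mul_inv, ← mul_inv, ← mul_pow, ← mul_pow]
  refine inv_anti₀ (by positivity) (pow_le_pow_left₀ (by positivity) ?_ M)
  have h1 := norm_nonneg v.1
  have h2 := norm_nonneg v.2.1
  have h3 := norm_nonneg v.2.2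
  have h4 : ‖v‖ ≤ ‖v.1‖ + ‖v.2.1‖ + ‖v.2.2‖ := by
    rw [Prod.norm_def, Prod.norm_def]
    refine max_le (by linarith) (max_le (by linarith) (by linarith))
  nlinarith [mul_nonneg h1 h2, mul_nonneg h1 h3, mul_nonneg h2 h3,
    mul_nonneg (mul_nonneg h1 h2) h3]

/-- The quadratic phase has derivatives of polynomial growth, which the Schwartz amplitude of the
kernel absorbs. -/
lemma hasTemperateGrowth_phase (n : ℕ) : Function.HasTemperateGrowth
    (fun v : Rn n × Rn n × Rn n =>
      (Real.fourierChar (-(inner ℝ v.1 (v.2.1 + v.2.2))) : ℂ)) := by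
  let p1 := ContinuousLinearMap.fst ℝ (Rn n) (Rn n × Rn n)
  let p2 := (ContinuousLinearMap.fst ℝ (Rn n) (Rn n)).comp
    (ContinuousLinearMap.snd ℝ (Rn n) (Rn n × Rn n))
  let p3 := (ContinuousLinearMap.snd ℝ (Rn n) (Rn n)).comp
    (ContinuousLinearMap.snd ℝ (Rn n) (Rn n × Rn n))
  have h := ContinuousLinearMap.bilinear_hasTemperateGrowth (-innerSL ℝ : Rn n →L[ℝ] Rn n →L[ℝ] ℝ)
    p1.hasTemperateGrowth (p2 + p3).hasTemperateGrowth
  exact hasTemperateGrowth_fourierChar.comp h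

/-- Peetre's inequality. -/
lemma one_add_norm_add_rpow_le {V : Type*} [NormedAddCommGroup V] (a b : V) (m : ℝ) :
    (1 + ‖a + b‖) ^ m ≤ (1 + ‖a‖) ^ m * (1 + ‖b‖) ^ |m| := by
  have ha := norm_nonneg a
  have hb := norm_nonneg b
  have hab := norm_nonneg (a + b)
  rcases le_total 0 m with hm | hm
  · rw [abs_of_nonneg hm, ← Real.mul_rpow (by positivity) (by positivity)]
    refine Real.rpow_le_rpow (by positivity) ?_ hm
    nlinarith [norm_add_le a b]
  · rw [abs_of_nonpos hm]
    have h1 : 1 + ‖a‖ ≤ (1 + ‖a + b‖) * (1 + ‖b‖) := by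
      have : ‖a‖ ≤ ‖a + b‖ + ‖b‖ := by simpa using norm_sub_le (a + b) b
      nlinarith
    have h2 := Real.rpow_le_rpow_of_nonpos (by positivity) h1 hm
    rw [Real.mul_rpow (by positivity) (by positivity)] at h2
    rw [Real.rpow_neg (by positivity), ← div_eq_mul_inv, le_div_iff₀ (by positivity)]
    exact h2

/-- The weight of the class `BS^{(m₁,m₂)}_{0,0}`. -/
def symbolWeight {n : ℕ} (m₁ m₂ : ℝ) (ξ₁ ξ₂ : Rn n) : ℝ := (1 + ‖ξ₁‖) ^ m₁ * (1 + ‖ξ₂‖) ^ m₂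

lemma symbolWeight_nonneg {n : ℕ} (m₁ m₂ : ℝ) (ξ₁ ξ₂ : Rn n) : 0 ≤ symbolWeight m₁ m₂ ξ₁ ξ₂ := by
  unfold symbolWeight; positivity

/-- The integral kernel of `T_σ` between two wave packets and a third one. -/
def packetKernel {n : ℕ} (σ : Rn n × Rn n × Rn n → ℂ) (χ κ : Rn n → ℂ) (x η₁ η₂ : Rn n)
    (w : Rn n × Rn n × Rn n) : ℂ :=
  ∫ v : Rn n × Rn n × Rn n, (Real.fourierChar (triplePairing n v w) : ℂ) *
    ((Real.fourierChar (-(inner ℝ v.1 (v.2.1 + v.2.2))) : ℂ) * (κ v.1 * χ v.2.1 * χ v.2.2) *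
      σ (x - v.1, (2 * Real.pi) • (η₁ + v.2.1), (2 * Real.pi) • (η₂ + v.2.2)))

/-- After the shift to (η₁, η₂) the amplitude is a Schwartz function of `v`. Its bounds are uniform
up to the symbol weight at the centre, so the oscillatory integral estimate applies with that weight
as a factor. -/
lemma norm_packetKernel_le {n : ℕ} {m₁ m₂ : ℝ} {σ : Rn n × Rn n × Rn n → ℂ}
    (hσ : HasSymbolBounds (fun z => symbolWeight m₁ m₂ z.2.1 z.2.2) σ) (χ : 𝓢(Rn n, ℂ))
    {ι : Type*} {κ : ι → Rn n → ℂ} (hκ : UnifSchwartz κ) (N : ℕ) :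
    ∃ C : ℝ, 0 ≤ C ∧ ∀ i x η₁ η₂ w, ‖packetKernel σ χ (κ i) x η₁ η₂ w‖ ≤
      C * symbolWeight m₁ m₂ ((2 * Real.pi) • η₁) ((2 * Real.pi) • η₂) *
        ((1 + ‖w‖) ^ N)⁻¹ := by
  obtain ⟨M, C₀, hC₀, hosc⟩ := norm_oscillatory_integral_le n N
  have hσ' : UnifSmooth (fun (_ : Unit) z => symbolWeight m₁ m₂ z.2.1 z.2.2)
      (fun (_ : Unit) => σ) := by
    refine ⟨fun _ => hσ.1, fun m => ?_⟩
    obtain ⟨C, hC⟩ := hσ.norm_iteratedFDeriv_le m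
    exact ⟨|C|, abs_nonneg _, fun _ v => (hC v).trans
      (mul_le_mul_of_nonneg_right (le_abs_self C) (symbolWeight_nonneg _ _ _ _))⟩
  let p1 := ContinuousLinearMap.fst ℝ (Rn n) (Rn n × Rn n)
  let p2 := (ContinuousLinearMap.fst ℝ (Rn n) (Rn n)).comp
    (ContinuousLinearMap.snd ℝ (Rn n) (Rn n × Rn n))
  let p3 := (ContinuousLinearMap.snd ℝ (Rn n) (Rn n)).comp
    (ContinuousLinearMap.snd ℝ (Rn n) (Rn n × Rn n))
  let A : (Rn n × Rn n × Rn n) →L[ℝ] (Rn n × Rn n × Rn n) :=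
    (-p1).prod (((2 * Real.pi) • p2).prod ((2 * Real.pi) • p3))
  -- Peetre's inequality moves the weight from η + v to η at the cost of the power |m₁| + |m₂| of 1
  -- + |v|. The amplitude is therefore asked for `L` further orders of decay.
  obtain ⟨L, hL⟩ := exists_nat_ge (|m₁| + |m₂|)
  have hS := hσ'.comp_clm (ι' := ι × Rn n × Rn n × Rn n) (fun _ => ())
    (fun i => (i.2.1, (2 * Real.pi) • i.2.2.1, (2 * Real.pi) • i.2.2.2)) (fun _ => A) ‖A‖
    (fun _ => le_rfl)
  have hT := ((unifSchwartz_tensor hκ χ).temperate_mul (hasTemperateGrowth_phase n)).reindex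
    (fun i : ι × Rn n × Rn n × Rn n => i.1)
  have hH := ((hT (M + L)).mul hS)
  have hw : ∀ (i : ι × Rn n × Rn n × Rn n) (v : Rn n × Rn n × Rn n),
      ((1 + ‖v‖) ^ (M + L))⁻¹ * symbolWeight m₁ m₂ ((2 * Real.pi) • i.2.2.1 + (A v).2.1)
        ((2 * Real.pi) • i.2.2.2 + (A v).2.2) ≤
      ((2 * Real.pi + 1) ^ (|m₁| + |m₂|)) * (((1 + ‖v‖) ^ M)⁻¹ *
        symbolWeight m₁ m₂ ((2 * Real.pi) • i.2.2.1) ((2 * Real.pi) • i.2.2.2)) := by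
    intro i v
    have hpi := Real.pi_pos
    have hc : ∀ (u : Rn n) (m : ℝ), ‖u‖ ≤ ‖v‖ → (1 + ‖(2 * Real.pi) • u‖) ^ |m| ≤
        ((2 * Real.pi + 1) * (1 + ‖v‖)) ^ |m| := by
      intro u m hu
      refine Real.rpow_le_rpow (by positivity) ?_ (abs_nonneg m)
      rw [norm_smul, Real.norm_of_nonneg (by positivity)]
      nlinarith [norm_nonneg v, norm_nonneg u]
    have hv1 : ‖v.2.1‖ ≤ ‖v‖ := (norm_fst_le v.2).trans (norm_snd_le v)
    have hv2 : ‖v.2.2‖ ≤ ‖v‖ := (norm_snd_le v.2).trans (norm_snd_le v)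
    have e1 : (A v).2.1 = (2 * Real.pi) • v.2.1 := rfl
    have e2 : (A v).2.2 = (2 * Real.pi) • v.2.2 := rfl
    rw [e1, e2]
    unfold symbolWeight
    have k1 := (one_add_norm_add_rpow_le ((2 * Real.pi) • i.2.2.1) ((2 * Real.pi) • v.2.1)
      m₁).trans (mul_le_mul_of_nonneg_left (hc _ m₁ hv1) (by positivity))
    have k2 := (one_add_norm_add_rpow_le ((2 * Real.pi) • i.2.2.2) ((2 * Real.pi) • v.2.2)
      m₂).trans (mul_le_mul_of_nonneg_left (hc _ m₂ hv2) (by positivity))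
    have k3 : ((2 * Real.pi + 1) * (1 + ‖v‖)) ^ |m₁| * ((2 * Real.pi + 1) * (1 + ‖v‖)) ^ |m₂| ≤
        (2 * Real.pi + 1) ^ (|m₁| + |m₂|) * (1 + ‖v‖) ^ L := by
      rw [← Real.rpow_add (by positivity), Real.mul_rpow (by positivity) (by positivity)]
      refine mul_le_mul_of_nonneg_left ?_ (by positivity)
      rw [← Real.rpow_natCast]
      exact Real.rpow_le_rpow_of_exponent_le (by linarith [norm_nonneg v]) hL
    have k4 := mul_le_mul k1 k2 (by positivity) (by positivity)
    refine (mul_le_mul_of_nonneg_left k4 (by positivity)).trans ?_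
    set X := (1 + ‖(2 * Real.pi) • i.2.2.1‖) ^ m₁
    set Y := (1 + ‖(2 * Real.pi) • i.2.2.2‖) ^ m₂
    have hX : 0 ≤ X := by positivity
    have hY : 0 ≤ Y := by positivity
    calc _ = ((1 + ‖v‖) ^ (M + L))⁻¹ * (X * Y) * (((2 * Real.pi + 1) * (1 + ‖v‖)) ^ |m₁| *
          ((2 * Real.pi + 1) * (1 + ‖v‖)) ^ |m₂|) := by ring
      _ ≤ ((1 + ‖v‖) ^ (M + L))⁻¹ * (X * Y) *
          ((2 * Real.pi + 1) ^ (|m₁| + |m₂|) * (1 + ‖v‖) ^ L) := by gcongr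
      _ = _ := by
        have : (1 + ‖v‖) ≠ 0 := by positivity
        rw [pow_add]
        field_simp
  have hH2 := hH.mono _ (Real.rpow_nonneg (by positivity) _) hw
  choose D hD0 hD using hH2.2
  refine ⟨C₀ * ∑ m ∈ Finset.range (N + 1), D m,
    mul_nonneg hC₀ (Finset.sum_nonneg fun m _ => hD0 m), fun i x η₁ η₂ w => ?_⟩
  have := hosc _ ((∑ m ∈ Finset.range (N + 1), D m) *
    symbolWeight m₁ m₂ ((2 * Real.pi) • η₁) ((2 * Real.pi) • η₂)) (hH2.1 (i, x, η₁, η₂))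
    (fun m hm v => ?_) w
  · refine le_trans (le_of_eq ?_) (this.trans (le_of_eq (by ring)))
    unfold packetKernel
    congr 1
    refine integral_congr_ae (Filter.Eventually.of_forall fun v => ?_)
    simp only [A, p1, p2, p3]
    congr 3
    refine Prod.ext ?_ (Prod.ext ?_ ?_)
    · simp [sub_eq_add_neg]
    · simp [smul_add]
    · simp [smul_add]
  · refine (hD m _ v).trans ?_
    have h1 : D m ≤ ∑ m ∈ Finset.range (N + 1), D m :=
      Finset.single_le_sum (fun m _ => hD0 m) (Finset.mem_range.2 (Nat.lt_succ_of_le hm))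
    have h2 := symbolWeight_nonneg m₁ m₂ ((2 * Real.pi) • η₁) ((2 * Real.pi) • η₂)
    calc D m * (((1 + ‖v‖) ^ M)⁻¹ * symbolWeight m₁ m₂ ((2 * Real.pi) • η₁)
          ((2 * Real.pi) • η₂))
        ≤ (∑ m ∈ Finset.range (N + 1), D m) * (((1 + ‖v‖) ^ M)⁻¹ *
          symbolWeight m₁ m₂ ((2 * Real.pi) • η₁) ((2 * Real.pi) • η₂)) := by gcongr
      _ = _ := by ring

/-! ### Wave packets -/

/-- The function `χ` restricts the frequencies to a ball about the origin, on which it is real and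
nonnegative. -/
structure IsWindow {n : ℕ} (χ : 𝓢(Rn n, ℂ)) : Prop where
  eq_zero : ∀ ξ : Rn n, (2 * Real.pi)⁻¹ < ‖ξ‖ → χ ξ = 0
  integral_sq_ne_zero : ∫ ξ, χ ξ * χ ξ ≠ 0
  fourierInv_zero_ne_zero : 𝓕⁻ (χ : Rn n → ℂ) 0 ≠ 0

/-- A nonnegative bump has positive integral and positive integral of its square. The square permits
division in the wave packet expansion; the integral makes `𝓕⁻ χ` nonzero near the origin, so that
its squared modulus is a usable local weight. -/
lemma exists_isWindow (n : ℕ) : ∃ χ : 𝓢(Rn n, ℂ), IsWindow χ := by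
  have hr : (0 : ℝ) < (2 * Real.pi)⁻¹ := by positivity
  let b : ContDiffBump (0 : Rn n) := ⟨(2 * Real.pi)⁻¹ / 2, (2 * Real.pi)⁻¹, by positivity,
    by linarith⟩
  have hs : ContDiff ℝ ∞ (fun ξ => (b ξ : ℂ)) := Complex.ofRealCLM.contDiff.comp b.contDiff
  have hc : HasCompactSupport (fun ξ => (b ξ : ℂ)) :=
    b.hasCompactSupport.comp_left (g := fun x : ℝ => (x : ℂ)) (by simp)
  refine ⟨hc.toSchwartzMap hs, ⟨fun ξ hξ => ?_, ?_, ?_⟩⟩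
  · have : b ξ = 0 := b.zero_of_le_dist (by rw [dist_zero_right]; exact hξ.le)
    simp [this]
  · have h1 : ∫ ξ, (hc.toSchwartzMap hs) ξ * (hc.toSchwartzMap hs) ξ =
        ((∫ ξ, b ξ * b ξ : ℝ) : ℂ) := by
      rw [← integral_complex_ofReal]
      simp
    rw [h1]
    have h2 : 0 < ∫ ξ, b ξ * b ξ := by
      refine (b.continuous.mul b.continuous).integral_pos_of_hasCompactSupport_nonneg_nonzero
        (b.hasCompactSupport.mul_right) (fun ξ => mul_self_nonneg _) (x := 0) ?_
      have : b 0 = 1 := b.one_of_mem_closedBall (by simp; positivity)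
      simp [this]
    exact_mod_cast h2.ne'
  · rw [Real.fourierInv_eq]
    have h1 : ∫ v : Rn n, Real.fourierChar (inner ℝ v 0) • (hc.toSchwartzMap hs) v =
        ((∫ ξ, b ξ : ℝ) : ℂ) := by
      rw [← integral_complex_ofReal]
      simp
    rw [h1]
    exact_mod_cast b.integral_pos.ne'

section Packet

variable {n : ℕ}

/-- The part of `f` with frequencies near `η`. -/
def packet (χ f : 𝓢(Rn n, ℂ)) (η : Rn n) : 𝓢(Rn n, ℂ) :=
  SchwartzMap.fourierMultiplierCLM ℂ (fun ξ => χ (ξ - η)) f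

lemma fourier_fourierMultiplier {g : Rn n → ℂ} (hg : g.HasTemperateGrowth) (f : 𝓢(Rn n, ℂ))
    (ξ : Rn n) :
    𝓕 (SchwartzMap.fourierMultiplierCLM ℂ g f : Rn n → ℂ) ξ = g ξ * 𝓕 (f : Rn n → ℂ) ξ := by
  rw [← SchwartzMap.fourier_coe, SchwartzMap.fourierMultiplierCLM_apply,
    FourierTransform.fourier_fourierInv_eq, SchwartzMap.smulLeftCLM_apply_apply hg, smul_eq_mul,
    SchwartzMap.fourier_coe]

lemma hasTemperateGrowth_shift (χ : 𝓢(Rn n, ℂ)) (η : Rn n) :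
    Function.HasTemperateGrowth (fun ξ => χ (ξ - η)) :=
  (SchwartzMap.compSubConstCLM ℂ η χ).hasTemperateGrowth

lemma fourier_packet (χ f : 𝓢(Rn n, ℂ)) (η ξ : Rn n) :
    𝓕 (packet χ f η : Rn n → ℂ) ξ = χ (ξ - η) * 𝓕 (f : Rn n → ℂ) ξ :=
  fourier_fourierMultiplier (hasTemperateGrowth_shift χ η) f ξ

lemma fourierMultiplier_apply_eq {g : Rn n → ℂ} (hg : g.HasTemperateGrowth) (f : 𝓢(Rn n, ℂ))
    (y : Rn n) : SchwartzMap.fourierMultiplierCLM ℂ g f y =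
      ∫ ξ, (Real.fourierChar (inner ℝ ξ y) : ℂ) * (g ξ * 𝓕 (f : Rn n → ℂ) ξ) := by
  rw [SchwartzMap.fourierMultiplierCLM_apply, SchwartzMap.fourierInv_coe, Real.fourierInv_eq]
  refine integral_congr_ae (Filter.Eventually.of_forall fun ξ => ?_)
  simp only [Circle.smul_def, smul_eq_mul]
  rw [SchwartzMap.smulLeftCLM_apply_apply hg, smul_eq_mul, SchwartzMap.fourier_coe]

lemma packet_apply (χ f : 𝓢(Rn n, ℂ)) (η y : Rn n) :
    packet χ f η y =
      ∫ ξ, (Real.fourierChar (inner ℝ ξ y) : ℂ) * (χ (ξ - η) * 𝓕 (f : Rn n → ℂ) ξ) :=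
  fourierMultiplier_apply_eq (hasTemperateGrowth_shift χ η) f y

/-- A wave packet as a convolution. -/
lemma packet_eq_integral (χ f : 𝓢(Rn n, ℂ)) (η y : Rn n) :
    packet χ f η y =
      ∫ t, (Real.fourierChar (inner ℝ t η) : ℂ) * (f (y - t) * 𝓕⁻ (χ : Rn n → ℂ) t) := by
  set g : Rn n → ℂ := fun ξ => (Real.fourierChar (inner ℝ ξ y) : ℂ) * χ (ξ - η) with hg
  have hgi : Integrable g := by
    refine ((SchwartzMap.compSubConstCLM ℂ η χ).integrable (μ := volume)).bdd_mul (c := 1) ?_ ?_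
    · exact (Real.continuous_fourierChar.comp (by fun_prop)).subtype_val.aestronglyMeasurable
    · exact Filter.Eventually.of_forall fun ξ => by simp
  have h1 : packet χ f η y = ∫ ξ, 𝓕 (f : Rn n → ℂ) ξ • g ξ := by
    rw [packet_apply]
    refine integral_congr_ae (Filter.Eventually.of_forall fun ξ => ?_)
    simp only [hg, smul_eq_mul]; ring
  -- The multiplication formula moves the Fourier transform from `f` to the modulated, translated
  -- window.
  have h2 : ∫ ξ, 𝓕 (f : Rn n → ℂ) ξ • g ξ = ∫ s, f s • 𝓕 g s := by
    have := VectorFourier.integral_fourierIntegral_smul_eq_flip (L := innerₗ (Rn n))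
      Real.continuous_fourierChar continuous_inner (f.integrable (μ := volume)) hgi
    rw [flip_innerₗ] at this
    exact this
  have h3 : ∀ s, 𝓕 g s = (Real.fourierChar (inner ℝ (y - s) η) : ℂ) *
      𝓕⁻ (χ : Rn n → ℂ) (y - s) := by
    intro s
    rw [Real.fourier_eq, Real.fourierInv_eq, ← integral_const_mul,
      ← integral_add_right_eq_self _ η]
    refine integral_congr_ae (Filter.Eventually.of_forall fun ξ => ?_)
    simp only [hg, Circle.smul_def, smul_eq_mul, add_sub_cancel_right]
    rw [← mul_assoc, ← mul_assoc, ← Circle.coe_mul, ← Circle.coe_mul, ← AddChar.map_add_eq_mul,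
      ← AddChar.map_add_eq_mul]
    congr 3
    simp only [inner_add_left, inner_sub_right, real_inner_comm η]
    ring_nf
  rw [h1, h2, ← integral_sub_left_eq_self _ volume y]
  refine integral_congr_ae (Filter.Eventually.of_forall fun t => ?_)
  simp only [h3, sub_sub_cancel, smul_eq_mul]
  ring

lemma continuous_fourierChar_comp {X : Type*} [TopologicalSpace X] {g : X → ℝ}
    (hg : Continuous g) : Continuous (fun x => (Real.fourierChar (g x) : ℂ)) :=
  (Real.continuous_fourierChar.comp hg).subtype_val

lemma norm_integral_char_mul {V : Type*} [MeasurableSpace V] {μ : Measure V} (c : ℝ)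
    (F : V → ℂ) : ‖∫ v, (Real.fourierChar c : ℂ) * F v ∂μ‖ = ‖∫ v, F v ∂μ‖ := by
  rw [integral_const_mul, norm_mul, norm_fourierChar, one_mul]

/-- Expansion of a bilinear Fourier integral in wave packets. -/
lemma integral_eq_integral_packet (χ f₁ f₂ : 𝓢(Rn n, ℂ)) (G : Rn n × Rn n × Rn n → ℂ)
    (hGc : Continuous G)
    (hG : Integrable (fun v => G v * (𝓕 (f₁ : Rn n → ℂ) v.2.1 * 𝓕 (f₂ : Rn n → ℂ) v.2.2)))
    (hGχ : ∀ η : Rn n × Rn n,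
      Integrable (fun v => G v * (χ (v.2.1 - η.1) * χ (v.2.2 - η.2)))) :
    (∫ ξ, χ ξ * χ ξ) ^ 2 * ∫ v, G v * (𝓕 (f₁ : Rn n → ℂ) v.2.1 * 𝓕 (f₂ : Rn n → ℂ) v.2.2) =
      ∫ η : Rn n × Rn n, ∫ y : Rn n × Rn n, packet χ f₁ η.1 y.1 * packet χ f₂ η.2 y.2 *
        ∫ v : Rn n × Rn n × Rn n,
          (Real.fourierChar (-(inner ℝ y.1 v.2.1 + inner ℝ y.2 v.2.2)) : ℂ) *
            (G v * (χ (v.2.1 - η.1) * χ (v.2.2 - η.2))) := by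
  have hcf : ∀ f : 𝓢(Rn n, ℂ), Continuous (𝓕 (f : Rn n → ℂ)) := fun f => by
    rw [← SchwartzMap.fourier_coe]; exact (𝓕 f).continuous
  have hχ2 : Integrable (fun ξ => χ ξ * χ ξ) :=
    (χ.integrable (μ := volume)).mul_bdd (c := ‖χ.toBoundedContinuousFunction‖)
      χ.continuous.aestronglyMeasurable
      (Filter.Eventually.of_forall fun ξ => χ.toBoundedContinuousFunction.norm_coe_le_norm ξ)
  have hχ2' : ∀ ξ : Rn n, Integrable (fun η => χ (ξ - η) * χ (ξ - η)) := fun ξ =>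
    hχ2.comp_sub_left ξ
  -- Resolution of the identity: the translates of χ² integrate to a nonzero multiple of 1 in each
  -- frequency variable.
  have hc0 : ∀ v : Rn n × Rn n × Rn n, ∫ η : Rn n × Rn n,
      (χ (v.2.1 - η.1) * χ (v.2.1 - η.1)) * (χ (v.2.2 - η.2) * χ (v.2.2 - η.2)) =
        (∫ ξ, χ ξ * χ ξ) ^ 2 := by
    intro v
    rw [Measure.volume_eq_prod, integral_prod_mul (fun a => χ (v.2.1 - a) * χ (v.2.1 - a))
      (fun a => χ (v.2.2 - a) * χ (v.2.2 - a)),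
      integral_sub_left_eq_self (fun a => χ a * χ a), integral_sub_left_eq_self
      (fun a => χ a * χ a), sq]
  set H : Rn n × Rn n × Rn n → ℂ :=
    fun v => G v * (𝓕 (f₁ : Rn n → ℂ) v.2.1 * 𝓕 (f₂ : Rn n → ℂ) v.2.2) with hH
  have hHc : Continuous H := by
    have := hcf f₁
    have := hcf f₂
    fun_prop
  have hχc := χ.continuous
  have hswap : Integrable (Function.uncurry fun (v : Rn n × Rn n × Rn n) (η : Rn n × Rn n) =>
      H v * ((χ (v.2.1 - η.1) * χ (v.2.1 - η.1)) * (χ (v.2.2 - η.2) * χ (v.2.2 - η.2))))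
      (volume.prod volume) := by
    rw [integrable_prod_iff]
    · refine ⟨Filter.Eventually.of_forall fun v => ?_, ?_⟩
      · exact ((hχ2' v.2.1).mul_prod (hχ2' v.2.2)).const_mul (H v)
      · have : ∀ v : Rn n × Rn n × Rn n, ∫ η : Rn n × Rn n, ‖H v * ((χ (v.2.1 - η.1) *
            χ (v.2.1 - η.1)) * (χ (v.2.2 - η.2) * χ (v.2.2 - η.2)))‖ =
            ‖H v‖ * (∫ ξ, ‖χ ξ * χ ξ‖) ^ 2 := by
          intro v
          simp_rw [norm_mul (H v), norm_mul (χ _ * χ _)]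
          rw [integral_const_mul, Measure.volume_eq_prod,
            integral_prod_mul (fun a => ‖χ (v.2.1 - a) * χ (v.2.1 - a)‖)
            (fun a => ‖χ (v.2.2 - a) * χ (v.2.2 - a)‖),
            integral_sub_left_eq_self (fun a => ‖χ a * χ a‖), integral_sub_left_eq_self
            (fun a => ‖χ a * χ a‖), sq]
        simp only [Function.uncurry_apply_pair, this]
        exact hG.norm.mul_const _
    · refine Continuous.aestronglyMeasurable ?_
      unfold Function.uncurry
      fun_prop
  calc (∫ ξ, χ ξ * χ ξ) ^ 2 * ∫ v, H v
      = ∫ v, ∫ η : Rn n × Rn n, H v * ((χ (v.2.1 - η.1) * χ (v.2.1 - η.1)) *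
          (χ (v.2.2 - η.2) * χ (v.2.2 - η.2))) := by
        rw [← integral_const_mul]
        refine integral_congr_ae (Filter.Eventually.of_forall fun v => ?_)
        simp only
        rw [integral_const_mul, hc0, mul_comm]
    _ = ∫ η : Rn n × Rn n, ∫ v, H v * ((χ (v.2.1 - η.1) * χ (v.2.1 - η.1)) *
          (χ (v.2.2 - η.2) * χ (v.2.2 - η.2))) := integral_integral_swap hswap
    _ = _ := by
        refine integral_congr_ae (Filter.Eventually.of_forall fun η => ?_)
        simp only
        set Q : Rn n × Rn n × Rn n → ℂ := fun v => G v * (χ (v.2.1 - η.1) * χ (v.2.2 - η.2))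
          with hQ
        -- Of the two factors χ in each variable, one turns the transform of the input into that of
        -- a packet, written as an integral over positions. The other stays with `G` and localizes
        -- the kernel.
        have hpk : ∀ v : Rn n × Rn n × Rn n, 𝓕 (packet χ f₁ η.1 : Rn n → ℂ) v.2.1 *
            𝓕 (packet χ f₂ η.2 : Rn n → ℂ) v.2.2 = ∫ y : Rn n × Rn n,
              (Real.fourierChar (-(inner ℝ y.1 v.2.1 + inner ℝ y.2 v.2.2)) : ℂ) *
                (packet χ f₁ η.1 y.1 * packet χ f₂ η.2 y.2) := by
          intro v
          rw [Real.fourier_eq, Real.fourier_eq, Measure.volume_eq_prod, ← integral_prod_mul]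
          refine integral_congr_ae (Filter.Eventually.of_forall fun y => ?_)
          simp only [Circle.smul_def, smul_eq_mul, neg_add, AddChar.map_add_eq_mul, Circle.coe_mul]
          ring
        have hswap2 : Integrable (Function.uncurry fun (v : Rn n × Rn n × Rn n)
            (y : Rn n × Rn n) => (Real.fourierChar (-(inner ℝ y.1 v.2.1 + inner ℝ y.2 v.2.2)) : ℂ) *
              (Q v * (packet χ f₁ η.1 y.1 * packet χ f₂ η.2 y.2))) (volume.prod volume) := by
          have h1 := (hGχ η).mul_prod (((packet χ f₁ η.1).integrable (μ := volume)).mul_prod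
            ((packet χ f₂ η.2).integrable (μ := volume)))
          refine h1.bdd_mul (c := 1) (Continuous.aestronglyMeasurable ?_)
            (Filter.Eventually.of_forall fun p => by simp)
          exact continuous_fourierChar_comp (by fun_prop)
        calc ∫ v, H v * ((χ (v.2.1 - η.1) * χ (v.2.1 - η.1)) *
              (χ (v.2.2 - η.2) * χ (v.2.2 - η.2)))
            = ∫ v : Rn n × Rn n × Rn n, ∫ y : Rn n × Rn n,
                (Real.fourierChar (-(inner ℝ y.1 v.2.1 + inner ℝ y.2 v.2.2)) : ℂ) *
                  (Q v * (packet χ f₁ η.1 y.1 * packet χ f₂ η.2 y.2)) := by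
              refine integral_congr_ae (Filter.Eventually.of_forall fun v => ?_)
              simp only
              have : ∀ y : Rn n × Rn n,
                  (Real.fourierChar (-(inner ℝ y.1 v.2.1 + inner ℝ y.2 v.2.2)) : ℂ) *
                  (Q v * (packet χ f₁ η.1 y.1 * packet χ f₂ η.2 y.2)) = Q v *
                  ((Real.fourierChar (-(inner ℝ y.1 v.2.1 + inner ℝ y.2 v.2.2)) : ℂ) *
                  (packet χ f₁ η.1 y.1 * packet χ f₂ η.2 y.2)) := fun y => by ring
              simp_rw [this]
              rw [integral_const_mul, ← hpk, fourier_packet, fourier_packet]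
              simp only [hH, hQ]
              ring
          _ = ∫ y : Rn n × Rn n, ∫ v : Rn n × Rn n × Rn n,
                (Real.fourierChar (-(inner ℝ y.1 v.2.1 + inner ℝ y.2 v.2.2)) : ℂ) *
                  (Q v * (packet χ f₁ η.1 y.1 * packet χ f₂ η.2 y.2)) :=
              integral_integral_swap hswap2
          _ = _ := by
              refine integral_congr_ae (Filter.Eventually.of_forall fun y => ?_)
              simp only
              rw [← integral_const_mul]
              refine integral_congr_ae (Filter.Eventually.of_forall fun v => ?_)
              simp only
              ring

end Packet

/-! ### The bilinear operator in wave packets -/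

section Operator

variable {n : ℕ}

lemma hat_smul (f : Rn n → ℂ) (η : Rn n) : hat f ((2 * Real.pi) • η) = 𝓕 f η := by
  rw [Real.fourier_eq', hat]
  refine integral_congr_ae (Filter.Eventually.of_forall fun x => ?_)
  simp only [smul_eq_mul, real_inner_smul_right]
  congr 2
  push_cast
  ring

/-- The integrand of the bilinear operator, in the normalization of Mathlib's Fourier transform. -/
def bilinearIntegrand (σ : Rn n × Rn n × Rn n → ℂ) (f₁ f₂ : 𝓢(Rn n, ℂ)) (x : Rn n)
    (ξ : Rn n × Rn n) : ℂ :=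
  (Real.fourierChar (inner ℝ x (ξ.1 + ξ.2)) : ℂ) *
    σ (x, (2 * Real.pi) • ξ.1, (2 * Real.pi) • ξ.2) *
      (𝓕 (f₁ : Rn n → ℂ) ξ.1 * 𝓕 (f₂ : Rn n → ℂ) ξ.2)

/-- The substitution ξ ↦ 2πξ in dimension 2n consumes exactly the prefactor (2π)^{-2n}. -/
lemma bilinearOp_eq (σ : Rn n × Rn n × Rn n → ℂ) (f₁ f₂ : 𝓢(Rn n, ℂ)) (x : Rn n) :
    bilinearOp σ f₁ f₂ x = ∫ ξ, bilinearIntegrand σ f₁ f₂ x ξ := by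
  set g : Rn n × Rn n → ℂ := fun ξ => Complex.exp (Complex.I * (inner ℝ x (ξ.1 + ξ.2) : ℝ)) *
      σ (x, ξ.1, ξ.2) * hat f₁ ξ.1 * hat f₂ ξ.2 with hg
  have h1 := Measure.integral_comp_smul (volume : Measure (Rn n × Rn n)) g (2 * Real.pi)
  have h2 : ∀ ξ, g ((2 * Real.pi) • ξ) = bilinearIntegrand σ f₁ f₂ x ξ := by
    intro ξ
    simp only [hg, bilinearIntegrand, Prod.smul_fst, Prod.smul_snd, hat_smul, mul_assoc]
    congr 1
    rw [Real.fourierChar_apply, ← smul_add, real_inner_smul_right]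
    congr 1
    push_cast
    ring
  simp_rw [h2] at h1
  rw [h1]
  have h3 : Module.finrank ℝ (Rn n × Rn n) = 2 * n := by
    simp [Module.finrank_prod]; ring
  rw [h3, abs_of_nonneg (by positivity)]
  unfold bilinearOp
  rw [Complex.real_smul]
  push_cast
  rw [one_div]

lemma integrable_rpow_mul_fourier (m : ℝ) (f : 𝓢(Rn n, ℂ)) :
    Integrable (fun ξ => (1 + ‖(2 * Real.pi) • ξ‖) ^ m * ‖𝓕 (f : Rn n → ℂ) ξ‖) := by
  obtain ⟨L, hL⟩ := exists_nat_ge |m|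
  obtain ⟨d, hd⟩ : ∃ d, d = Module.finrank ℝ (Rn n) + 1 := ⟨_, rfl⟩
  have hint : Integrable (fun v : Rn n => ((1 + ‖v‖) ^ d)⁻¹) :=
    integrable_inv_one_add_norm_pow _ _ (by omega)
  obtain ⟨C, hC0, hC⟩ := (SchwartzMap.unifSchwartz (𝓕 f) (L + d)).2 0
  have hpi := Real.pi_pos
  refine (hint.const_mul ((1 + 2 * Real.pi) ^ L * C)).mono' ?_
    (Filter.Eventually.of_forall fun ξ => ?_)
  · refine Continuous.aestronglyMeasurable (Continuous.mul ?_ ?_)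
    · refine Continuous.rpow_const (by fun_prop) fun ξ => Or.inl ?_
      positivity
    · rw [← SchwartzMap.fourier_coe]; exact (𝓕 f).continuous.norm
  · rw [Real.norm_of_nonneg (by positivity)]
    have h1 := hC () ξ
    simp only [norm_iteratedFDeriv_zero, SchwartzMap.fourier_coe] at h1
    have h2 : (1 + ‖(2 * Real.pi) • ξ‖) ^ m ≤ ((1 + 2 * Real.pi) * (1 + ‖ξ‖)) ^ L := by
      rw [← Real.rpow_natCast]
      refine (Real.rpow_le_rpow_of_exponent_le (by linarith [norm_nonneg ((2 * Real.pi) • ξ)])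
        ((le_abs_self m).trans hL)).trans ?_
      refine Real.rpow_le_rpow (by positivity) ?_ (by positivity)
      rw [norm_smul, Real.norm_of_nonneg (by positivity)]
      nlinarith [norm_nonneg ξ]
    refine (mul_le_mul h2 h1 (norm_nonneg _) (by positivity)).trans (le_of_eq ?_)
    have : (1 + ‖ξ‖) ≠ 0 := by positivity
    rw [pow_add, mul_pow]
    field_simp

variable {m₁ m₂ : ℝ} {σ : Rn n × Rn n × Rn n → ℂ}

/-- A majorant of the integrand of the bilinear operator. -/
lemma exists_majorant (hσ : HasSymbolBounds (fun z => symbolWeight m₁ m₂ z.2.1 z.2.2) σ)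
    (f₁ f₂ : 𝓢(Rn n, ℂ)) : ∃ g : Rn n × Rn n → ℝ, Integrable g ∧
      ∀ x ξ, ‖bilinearIntegrand σ f₁ f₂ x ξ‖ ≤ g ξ := by
  obtain ⟨C, hC⟩ := hσ.norm_iteratedFDeriv_le 0
  refine ⟨fun ξ => C * (((1 + ‖(2 * Real.pi) • ξ.1‖) ^ m₁ * ‖𝓕 (f₁ : Rn n → ℂ) ξ.1‖) *
    ((1 + ‖(2 * Real.pi) • ξ.2‖) ^ m₂ * ‖𝓕 (f₂ : Rn n → ℂ) ξ.2‖)),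
    ((integrable_rpow_mul_fourier m₁ f₁).mul_prod (integrable_rpow_mul_fourier m₂ f₂)).const_mul C,
    fun x ξ => ?_⟩
  have h := hC (x, (2 * Real.pi) • ξ.1, (2 * Real.pi) • ξ.2)
  rw [norm_iteratedFDeriv_zero] at h
  simp only [bilinearIntegrand, norm_mul, norm_fourierChar, one_mul]
  refine (mul_le_mul_of_nonneg_right h (by positivity)).trans (le_of_eq ?_)
  simp only [symbolWeight]
  ring

lemma continuous_fourier_coe (f : 𝓢(Rn n, ℂ)) : Continuous (𝓕 (f : Rn n → ℂ)) := by
  rw [← SchwartzMap.fourier_coe]; exact (𝓕 f).continuous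

lemma continuous_bilinearIntegrand (hσ : Continuous σ) (f₁ f₂ : 𝓢(Rn n, ℂ)) :
    Continuous (fun p : Rn n × Rn n × Rn n => bilinearIntegrand σ f₁ f₂ p.1 p.2) := by
  have h1 := continuous_fourier_coe f₁
  have h2 := continuous_fourier_coe f₂
  unfold bilinearIntegrand
  refine Continuous.mul (Continuous.mul (continuous_fourierChar_comp ?_) ?_) ?_ <;> fun_prop

lemma continuous_bilinearOp (hσ : HasSymbolBounds (fun z => symbolWeight m₁ m₂ z.2.1 z.2.2) σ)
    (f₁ f₂ : 𝓢(Rn n, ℂ)) : Continuous (bilinearOp σ f₁ f₂) := by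
  obtain ⟨g, hg, hb⟩ := exists_majorant hσ f₁ f₂
  have hc := continuous_bilinearIntegrand hσ.1.continuous f₁ f₂
  have : bilinearOp σ f₁ f₂ = fun x => ∫ ξ, bilinearIntegrand σ f₁ f₂ x ξ :=
    funext (bilinearOp_eq σ f₁ f₂)
  rw [this]
  refine continuous_of_dominated (fun x => ?_) (fun x => Filter.Eventually.of_forall (hb x)) hg
    (Filter.Eventually.of_forall fun ξ => ?_)
  · exact (hc.comp (Continuous.prodMk_right x)).aestronglyMeasurable
  · exact hc.comp (f := fun x : Rn n => (x, ξ)) (by fun_prop)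

lemma exists_norm_bilinearOp_le
    (hσ : HasSymbolBounds (fun z => symbolWeight m₁ m₂ z.2.1 z.2.2) σ) (f₁ f₂ : 𝓢(Rn n, ℂ)) :
    ∃ B : ℝ, ∀ x, ‖bilinearOp σ f₁ f₂ x‖ ≤ B := by
  obtain ⟨g, hg, hb⟩ := exists_majorant hσ f₁ f₂
  refine ⟨∫ ξ, g ξ, fun x => ?_⟩
  rw [bilinearOp_eq]
  exact norm_integral_le_of_norm_le hg (Filter.Eventually.of_forall (hb x))

/-- Recentring the frequencies at η₁, η₂ leaves a constant unimodular factor, which the norm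
discards. The remaining linear phase is dual to (τ-η₁-η₂, x-y₁, x-y₂), and the quadratic phase joins
the amplitude. -/
lemma integral_shift_eq_packetKernel (χ κ : Rn n → ℂ) (x τ : Rn n) (η y : Rn n × Rn n) :
    ‖∫ v : Rn n × Rn n × Rn n,
      (Real.fourierChar (-(inner ℝ y.1 v.2.1 + inner ℝ y.2 v.2.2)) : ℂ) *
        ((Real.fourierChar (inner ℝ v.1 τ) : ℂ) * κ v.1 *
          ((Real.fourierChar (inner ℝ (x - v.1) (v.2.1 + v.2.2)) : ℂ) *
            σ (x - v.1, (2 * Real.pi) • v.2.1, (2 * Real.pi) • v.2.2)) *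
          (χ (v.2.1 - η.1) * χ (v.2.2 - η.2)))‖ =
      ‖packetKernel σ χ κ x η.1 η.2 (τ - η.1 - η.2, x - y.1, x - y.2)‖ := by
  unfold packetKernel
  rw [← norm_integral_char_mul (μ := volume) (inner ℝ x (η.1 + η.2) -
    (inner ℝ y.1 η.1 + inner ℝ y.2 η.2)) (F := fun v : Rn n × Rn n × Rn n =>
      (Real.fourierChar (triplePairing n v (τ - η.1 - η.2, x - y.1, x - y.2)) : ℂ) *
    ((Real.fourierChar (-(inner ℝ v.1 (v.2.1 + v.2.2))) : ℂ) * (κ v.1 * χ v.2.1 * χ v.2.2) *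
      σ (x - v.1, (2 * Real.pi) • (η.1 + v.2.1), (2 * Real.pi) • (η.2 + v.2.2))))]
  rw [← integral_add_left_eq_self _ ((0 : Rn n), η.1, η.2)]
  congr 1
  refine integral_congr_ae (Filter.Eventually.of_forall fun v => ?_)
  simp only [Prod.fst_add, Prod.snd_add, zero_add, add_sub_cancel_left, triplePairing_apply]
  have key : (Real.fourierChar (-(inner ℝ y.1 (η.1 + v.2.1) + inner ℝ y.2 (η.2 + v.2.2))) : ℂ) *
      (Real.fourierChar (inner ℝ v.1 τ) : ℂ) *
      (Real.fourierChar (inner ℝ (x - v.1) (η.1 + v.2.1 + (η.2 + v.2.2))) : ℂ) =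
      (Real.fourierChar (inner ℝ x (η.1 + η.2) - (inner ℝ y.1 η.1 + inner ℝ y.2 η.2)) : ℂ) *
      (Real.fourierChar (inner ℝ v.1 (τ - η.1 - η.2) + inner ℝ v.2.1 (x - y.1) +
        inner ℝ v.2.2 (x - y.2)) : ℂ) *
      (Real.fourierChar (-(inner ℝ v.1 (v.2.1 + v.2.2))) : ℂ) := by
    simp only [← Circle.coe_mul, ← AddChar.map_add_eq_mul]
    congr 2
    simp only [inner_add_right, inner_sub_left, inner_sub_right, real_inner_comm x,
      real_inner_comm y.1, real_inner_comm y.2]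
    ring
  linear_combination (κ v.1 * χ v.2.1 * χ v.2.2 *
    σ (x - v.1, (2 * Real.pi) • (η.1 + v.2.1), (2 * Real.pi) • (η.2 + v.2.2))) * key

/-- The frequency-localized pieces of `T_σ(f₁, f₂)` are controlled by the wave packets of
`f₁` and `f₂`. -/
lemma enorm_localized_bilinearOp_le {l₁ l₂ : ℝ}
    (hσ : HasSymbolBounds (fun z => symbolWeight m₁ m₂ z.2.1 z.2.2) σ)
    (hσ' : HasSymbolBounds (fun z => symbolWeight l₁ l₂ z.2.1 z.2.2) σ) {χ : 𝓢(Rn n, ℂ)}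
    (hχ : IsWindow χ) {ι : Type*} {κ : ι → Rn n → ℂ} (hκ : UnifSchwartz κ) (N : ℕ) :
    ∃ C : ℝ≥0, ∀ (f₁ f₂ : 𝓢(Rn n, ℂ)) (i : ι) (x τ : Rn n),
      ‖∫ t, bilinearOp σ f₁ f₂ (x - t) * ((Real.fourierChar (inner ℝ t τ) : ℂ) * κ i t)‖ₑ ≤
        C * ∫⁻ η : Rn n × Rn n, ∫⁻ y : Rn n × Rn n,
          ‖packet χ f₁ η.1 y.1‖ₑ * ‖packet χ f₂ η.2 y.2‖ₑ * ENNReal.ofReal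
            (min (symbolWeight m₁ m₂ ((2 * Real.pi) • η.1) ((2 * Real.pi) • η.2))
              (symbolWeight l₁ l₂ ((2 * Real.pi) • η.1) ((2 * Real.pi) • η.2)) *
              ((1 + ‖(τ - η.1 - η.2, x - y.1, x - y.2)‖) ^ N)⁻¹) := by
  obtain ⟨C₁, hC₁0, hC₁⟩ := norm_packetKernel_le hσ χ hκ N
  obtain ⟨C₂, hC₂0, hC₂⟩ := norm_packetKernel_le hσ' χ hκ N
  -- Both kernel bounds hold for the same operator, so the smaller weight is available at every (η₁,
  -- η₂). The class can then be chosen according to which input has the higher frequency.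
  obtain ⟨C, hC0, hC⟩ : ∃ C : ℝ, 0 ≤ C ∧ ∀ i x η₁ η₂ w, ‖packetKernel σ χ (κ i) x η₁ η₂ w‖ ≤
      C * min (symbolWeight m₁ m₂ ((2 * Real.pi) • η₁) ((2 * Real.pi) • η₂))
        (symbolWeight l₁ l₂ ((2 * Real.pi) • η₁) ((2 * Real.pi) • η₂)) *
        ((1 + ‖w‖) ^ N)⁻¹ := by
    refine ⟨max C₁ C₂, le_max_of_le_left hC₁0, fun i x η₁ η₂ w => ?_⟩
    rcases min_choice (symbolWeight m₁ m₂ ((2 * Real.pi) • η₁) ((2 * Real.pi) • η₂))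
        (symbolWeight l₁ l₂ ((2 * Real.pi) • η₁) ((2 * Real.pi) • η₂)) with h | h
    · rw [h]
      refine (hC₁ i x η₁ η₂ w).trans (mul_le_mul_of_nonneg_right (mul_le_mul_of_nonneg_right
        (le_max_left _ _) (symbolWeight_nonneg _ _ _ _)) (by positivity))
    · rw [h]
      refine (hC₂ i x η₁ η₂ w).trans (mul_le_mul_of_nonneg_right (mul_le_mul_of_nonneg_right
        (le_max_right _ _) (symbolWeight_nonneg _ _ _ _)) (by positivity))
  set c₀ := ∫ ξ, χ ξ * χ ξ with hc₀
  have hc₀n : 0 < ‖c₀ ^ 2‖ := norm_pos_iff.2 (pow_ne_zero 2 hχ.integral_sq_ne_zero)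
  refine ⟨Real.toNNReal (‖c₀ ^ 2‖⁻¹ * C), fun f₁ f₂ i x τ => ?_⟩
  obtain ⟨g, hg, hb⟩ := exists_majorant hσ f₁ f₂
  have hσc := hσ.1.continuous
  have hκc : Continuous (κ i) := ((hκ 0).1 i).continuous
  have hχc := χ.continuous
  obtain ⟨d, hd⟩ : ∃ d, d = Module.finrank ℝ (Rn n) + 1 := ⟨_, rfl⟩
  have hint : Integrable (fun v : Rn n => ((1 + ‖v‖) ^ d)⁻¹) :=
    integrable_inv_one_add_norm_pow _ _ (by omega)
  have hκi : Integrable (κ i) := by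
    obtain ⟨D, hD0, hD⟩ := (hκ d).2 0
    exact (hint.const_mul D).mono' hκc.aestronglyMeasurable
      (Filter.Eventually.of_forall fun t => by simpa using hD i t)
  set G : Rn n × Rn n × Rn n → ℂ := fun v => (Real.fourierChar (inner ℝ v.1 τ) : ℂ) * κ i v.1 *
    ((Real.fourierChar (inner ℝ (x - v.1) (v.2.1 + v.2.2)) : ℂ) *
      σ (x - v.1, (2 * Real.pi) • v.2.1, (2 * Real.pi) • v.2.2)) with hG
  have hGc : Continuous G := by
    refine Continuous.mul (Continuous.mul (continuous_fourierChar_comp (by fun_prop)) ?_)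
      (Continuous.mul (continuous_fourierChar_comp (by fun_prop)) ?_)
    · exact hκc.comp continuous_fst
    · exact hσc.comp (by fun_prop)
  have hGeq : ∀ v, G v * (𝓕 (f₁ : Rn n → ℂ) v.2.1 * 𝓕 (f₂ : Rn n → ℂ) v.2.2) =
      ((Real.fourierChar (inner ℝ v.1 τ) : ℂ) * κ i v.1) *
        bilinearIntegrand σ f₁ f₂ (x - v.1) v.2 := by
    intro v
    simp only [hG, bilinearIntegrand]
    ring
  have hGint : Integrable
      (fun v => G v * (𝓕 (f₁ : Rn n → ℂ) v.2.1 * 𝓕 (f₂ : Rn n → ℂ) v.2.2)) := by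
    have := continuous_fourier_coe f₁
    have := continuous_fourier_coe f₂
    refine (hκi.norm.mul_prod hg).mono'
      (Continuous.aestronglyMeasurable (by fun_prop)) (Filter.Eventually.of_forall fun v => ?_)
    rw [hGeq, norm_mul, norm_mul, norm_fourierChar, one_mul]
    exact mul_le_mul_of_nonneg_left (hb _ _) (norm_nonneg _)
  have hGχ : ∀ η : Rn n × Rn n,
      Integrable (fun v => G v * (χ (v.2.1 - η.1) * χ (v.2.2 - η.2))) := by
    intro η
    -- The translated windows are Fourier transforms of Schwartz functions, so the majorant for the
    -- integrand of the operator covers them too.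
    obtain ⟨g', hg', hb'⟩ := exists_majorant hσ (𝓕⁻ (SchwartzMap.compSubConstCLM ℂ η.1 χ))
      (𝓕⁻ (SchwartzMap.compSubConstCLM ℂ η.2 χ))
    refine (hκi.norm.mul_prod hg').mono'
      (Continuous.aestronglyMeasurable (by fun_prop)) (Filter.Eventually.of_forall fun v => ?_)
    have h := hb' (x - v.1) v.2
    simp only [bilinearIntegrand, ← SchwartzMap.fourier_coe,
      FourierTransform.fourier_fourierInv_eq, SchwartzMap.compSubConstCLM_apply] at h
    simp only [hG]
    rw [mul_assoc, norm_mul, norm_mul, norm_fourierChar, one_mul]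
    exact mul_le_mul_of_nonneg_left h (norm_nonneg _)
  have hrep := integral_eq_integral_packet χ f₁ f₂ G hGc hGint hGχ
  have hleft : ∫ v, G v * (𝓕 (f₁ : Rn n → ℂ) v.2.1 * 𝓕 (f₂ : Rn n → ℂ) v.2.2) =
      ∫ t, bilinearOp σ f₁ f₂ (x - t) * ((Real.fourierChar (inner ℝ t τ) : ℂ) * κ i t) := by
    rw [Measure.volume_eq_prod, integral_prod _ hGint]
    refine integral_congr_ae (Filter.Eventually.of_forall fun t => ?_)
    simp only [hGeq]
    rw [integral_const_mul, bilinearOp_eq, mul_comm]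
  rw [hleft] at hrep
  set I := ∫ t, bilinearOp σ f₁ f₂ (x - t) * ((Real.fourierChar (inner ℝ t τ) : ℂ) * κ i t)
    with hI
  have hI2 : I = (c₀ ^ 2)⁻¹ * (c₀ ^ 2 * I) := by
    rw [← mul_assoc, inv_mul_cancel₀ (norm_pos_iff.1 hc₀n), one_mul]
  have hK : ∀ η y : Rn n × Rn n, ‖∫ v : Rn n × Rn n × Rn n,
          (Real.fourierChar (-(inner ℝ y.1 v.2.1 + inner ℝ y.2 v.2.2)) : ℂ) *
            (G v * (χ (v.2.1 - η.1) * χ (v.2.2 - η.2)))‖ₑ ≤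
      ENNReal.ofReal C * ENNReal.ofReal
        (min (symbolWeight m₁ m₂ ((2 * Real.pi) • η.1) ((2 * Real.pi) • η.2))
          (symbolWeight l₁ l₂ ((2 * Real.pi) • η.1) ((2 * Real.pi) • η.2)) *
          ((1 + ‖(τ - η.1 - η.2, x - y.1, x - y.2)‖) ^ N)⁻¹) := by
    intro η y
    rw [← ENNReal.ofReal_mul hC0, ← ofReal_norm]
    refine ENNReal.ofReal_le_ofReal ?_
    have h := integral_shift_eq_packetKernel (σ := σ) χ (κ i) x τ η y
    simp only [hG]
    rw [h, ← mul_assoc]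
    exact hC i x η.1 η.2 _
  rw [hI2, enorm_mul, hrep]
  have hfac : ‖(c₀ ^ 2)⁻¹‖ₑ * ENNReal.ofReal C = (Real.toNNReal (‖c₀ ^ 2‖⁻¹ * C) : ℝ≥0) := by
    rw [← ofReal_norm, ← ENNReal.ofReal_mul (norm_nonneg _), norm_inv]
    rfl
  rw [← hfac, mul_assoc]
  refine mul_le_mul_right ?_ _
  rw [← lintegral_const_mul' _ _ ENNReal.ofReal_ne_top]
  refine (enorm_integral_le_lintegral_enorm _).trans (lintegral_mono fun η => ?_)
  rw [← lintegral_const_mul' _ _ ENNReal.ofReal_ne_top]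
  refine (enorm_integral_le_lintegral_enorm _).trans (lintegral_mono fun y => ?_)
  rw [enorm_mul, enorm_mul, mul_left_comm]
  exact mul_le_mul_right (hK η y) _

end Operator

/-! ### Plancherel's theorem and the uniqueness of representing functions -/

section Plancherel

variable {n : ℕ}

/-- Locally integrable functions that agree as distributions agree almost everywhere. -/
lemma ae_eq_of_forall_integral_schwartz_eq {f g : Rn n → ℂ} (hf : LocallyIntegrable f)
    (hg : LocallyIntegrable g) (h : ∀ φ : 𝓢(Rn n, ℂ), ∫ x, φ x * f x = ∫ x, φ x * g x) :
    f =ᵐ[volume] g := by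
  refine ae_eq_of_integral_contDiff_smul_eq hf hg fun b hb hbc => ?_
  have hs : ContDiff ℝ ∞ (fun ξ => (b ξ : ℂ)) := Complex.ofRealCLM.contDiff.comp hb
  have hc : HasCompactSupport (fun ξ => (b ξ : ℂ)) :=
    hbc.comp_left (g := fun x : ℝ => (x : ℂ)) (by simp)
  simpa [Complex.real_smul] using h (hc.toSchwartzMap hs)

/-- On L¹ ∩ L² the transform defined by the integral agrees almost everywhere with the L² extension,
since both give the same pairing with Schwartz functions. -/
lemma lintegral_enorm_fourier_sq {F : Rn n → ℂ} (h1 : Integrable F) (h2 : MemLp F 2) :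
    ∫⁻ τ, ‖𝓕 F τ‖ₑ ^ 2 = ∫⁻ t, ‖F t‖ₑ ^ 2 := by
  have hsq : ∀ G : Rn n → ℂ, eLpNorm G 2 volume ^ 2 = ∫⁻ t, ‖G t‖ₑ ^ 2 := fun G => by
    have := eLpNorm_nnreal_pow_eq_lintegral (f := G) (μ := volume) (p := 2) (by norm_num)
    simpa using this
  have hcont : Continuous (𝓕 F) :=
    VectorFourier.fourierIntegral_continuous Real.continuous_fourierChar continuous_inner h1
  have hae : (𝓕 (h2.toLp F) : Lp ℂ 2 (volume : Measure (Rn n))) =ᵐ[volume] 𝓕 F := by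
    refine ae_eq_of_forall_integral_schwartz_eq
      ((Lp.memLp (𝓕 (h2.toLp F))).locallyIntegrable (by norm_num))
      hcont.locallyIntegrable fun φ => ?_
    have e1 := congrArg (fun u : 𝓢'(Rn n, ℂ) => u φ)
      (Lp.fourier_toTemperedDistribution_eq (h2.toLp F))
    simp only [TemperedDistribution.fourier_apply, Lp.toTemperedDistribution_apply,
      smul_eq_mul] at e1
    rw [← e1]
    have e2 : ∫ x, (𝓕 φ) x * (h2.toLp F) x = ∫ x, 𝓕 (φ : Rn n → ℂ) x • F x := by
      refine integral_congr_ae ?_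
      filter_upwards [h2.coeFn_toLp] with x hx
      rw [hx, smul_eq_mul, SchwartzMap.fourier_coe]
    rw [e2]
    have := VectorFourier.integral_fourierIntegral_smul_eq_flip (L := innerₗ (Rn n))
      Real.continuous_fourierChar continuous_inner (φ.integrable (μ := volume)) h1
    rw [flip_innerₗ] at this
    exact this
  rw [← hsq, ← hsq, ← eLpNorm_congr_ae hae, ← eLpNorm_congr_ae h2.coeFn_toLp]
  have := Lp.norm_fourier_eq (h2.toLp F)
  rw [Lp.norm_def, Lp.norm_def, ENNReal.toReal_eq_toReal_iff' (Lp.eLpNorm_ne_top _)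
    (Lp.eLpNorm_ne_top _)] at this
  rw [this]

/-- For fixed `x` the windowed transform is the Fourier transform of one function in L¹ ∩ L², up to
τ ↦ -τ; boundedness of `u` is what puts the product with the window there. -/
lemma lintegral_enorm_windowed_sq (w : 𝓢(Rn n, ℂ)) {u : Rn n → ℂ} (hu : Continuous u) {B : ℝ}
    (hB : ∀ x, ‖u x‖ ≤ B) (x : Rn n) :
    ∫⁻ τ, ‖∫ t, (Real.fourierChar (inner ℝ t τ) : ℂ) * (u (x - t) * w t)‖ₑ ^ 2 =
      ∫⁻ t, ‖u (x - t)‖ₑ ^ 2 * ‖w t‖ₑ ^ 2 := by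
  set F : Rn n → ℂ := fun t => u (x - t) * w t with hF
  have hc : Continuous (fun t => u (x - t)) := hu.comp (by fun_prop)
  have h1 : Integrable F := (w.integrable (μ := volume)).bdd_mul (c := B)
    hc.aestronglyMeasurable (Filter.Eventually.of_forall fun t => hB _)
  have h2 : MemLp F 2 := by
    refine MemLp.of_le_mul (c := B) (w.memLp 2) (hc.mul w.continuous).aestronglyMeasurable
      (Filter.Eventually.of_forall fun t => ?_)
    rw [hF, norm_mul]
    exact mul_le_mul_of_nonneg_right (hB _) (norm_nonneg _)
  have h3 : ∀ τ, ∫ t, (Real.fourierChar (inner ℝ t τ) : ℂ) * (u (x - t) * w t) =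
      𝓕 F (-τ) := by
    intro τ
    rw [Real.fourier_eq]
    simp [Circle.smul_def, hF]
  simp_rw [h3]
  rw [lintegral_neg_eq_self (fun τ => ‖𝓕 F τ‖ₑ ^ 2), lintegral_enorm_fourier_sq h1 h2]
  refine lintegral_congr fun t => ?_
  rw [hF, enorm_mul, mul_pow]

lemma lintegral_enorm_packet_sq (χ f : 𝓢(Rn n, ℂ)) (y : Rn n) :
    ∫⁻ η, ‖packet χ f η y‖ₑ ^ 2 = ∫⁻ t, ‖f (y - t)‖ₑ ^ 2 * ‖𝓕⁻ χ t‖ₑ ^ 2 := by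
  rw [← lintegral_enorm_windowed_sq (𝓕⁻ χ) f.continuous
    (fun x => f.toBoundedContinuousFunction.norm_coe_le_norm x) y]
  refine lintegral_congr fun η => ?_
  rw [packet_eq_integral, SchwartzMap.fourierInv_coe]

lemma integrable_convolution_integrand (Ψ w : 𝓢(Rn n, ℂ)) :
    Integrable (Function.uncurry fun t v : Rn n => Ψ (v - t) * w t) (volume.prod volume) := by
  have hc : Continuous (Function.uncurry fun t v : Rn n => Ψ (v - t) * w t) := by
    have := Ψ.continuous
    have := w.continuous
    unfold Function.uncurry
    fun_prop
  rw [integrable_prod_iff hc.aestronglyMeasurable]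
  refine ⟨Filter.Eventually.of_forall fun t => ?_, ?_⟩
  · exact ((Ψ.integrable (μ := volume)).comp_sub_right t).mul_const (w t)
  · have : ∀ t : Rn n, ∫ v, ‖Ψ (v - t) * w t‖ = (∫ v, ‖Ψ v‖) * ‖w t‖ := by
      intro t
      simp_rw [norm_mul]
      rw [integral_mul_const, integral_sub_right_eq_self (fun v => ‖Ψ v‖)]
    simp only [Function.uncurry_apply_pair, this]
    exact (w.integrable (μ := volume)).norm.const_mul _

/-- Localizing the frequencies of a convolution near `τ`. -/
lemma integral_windowed_convolution (χ Ψ : 𝓢(Rn n, ℂ)) {h : Rn n → ℂ} (hh : Continuous h)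
    {B : ℝ} (hB : ∀ x, ‖h x‖ ≤ B) (x τ : Rn n) :
    ∫ t, (Real.fourierChar (inner ℝ t τ) : ℂ) * ((∫ s, h (x - t - s) * Ψ s) * 𝓕⁻ χ t) =
      ∫ v, h (x - v) * packet χ Ψ τ v := by
  have hint : Integrable (Function.uncurry fun t v : Rn n =>
      (Real.fourierChar (inner ℝ t τ) : ℂ) * h (x - v) * (Ψ (v - t) * 𝓕⁻ χ t))
      (volume.prod volume) := by
    have h0 := integrable_convolution_integrand Ψ (𝓕⁻ χ)
    refine h0.bdd_mul (c := B) (Continuous.aestronglyMeasurable ?_)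
      (Filter.Eventually.of_forall fun p => ?_)
    · exact (continuous_fourierChar_comp (by fun_prop)).mul (hh.comp (by fun_prop))
    · rw [norm_mul, norm_fourierChar, one_mul]
      exact hB _
  calc _ = ∫ t, ∫ v, (Real.fourierChar (inner ℝ t τ) : ℂ) * h (x - v) *
        (Ψ (v - t) * 𝓕⁻ χ t) := by
        refine integral_congr_ae (Filter.Eventually.of_forall fun t => ?_)
        simp only
        rw [← integral_mul_const, ← integral_const_mul,
          ← integral_sub_right_eq_self _ t]
        refine integral_congr_ae (Filter.Eventually.of_forall fun v => ?_)
        simp only [sub_sub, add_sub_cancel]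
        ring
    _ = ∫ v, ∫ t, (Real.fourierChar (inner ℝ t τ) : ℂ) * h (x - v) *
        (Ψ (v - t) * 𝓕⁻ χ t) := integral_integral_swap hint
    _ = _ := by
        refine integral_congr_ae (Filter.Eventually.of_forall fun v => ?_)
        simp only
        rw [packet_eq_integral, ← integral_const_mul]
        refine integral_congr_ae (Filter.Eventually.of_forall fun t => ?_)
        simp only [SchwartzMap.fourierInv_coe]
        ring

/-- Separates the modulation at τ from an envelope. For Littlewood–Paley kernels the envelopes form
a bounded Schwartz family as τ and ℓ vary. -/
lemma packet_eq_char_mul (χ Ψ : 𝓢(Rn n, ℂ)) (τ v : Rn n) :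
    packet χ Ψ τ v = (Real.fourierChar (inner ℝ v τ) : ℂ) *
      𝓕⁻ (fun ζ => χ ζ * 𝓕 (Ψ : Rn n → ℂ) (τ + ζ)) v := by
  rw [packet_apply, Real.fourierInv_eq, ← integral_const_mul,
    ← integral_add_right_eq_self _ τ]
  refine integral_congr_ae (Filter.Eventually.of_forall fun ζ => ?_)
  simp only [add_sub_cancel_right, inner_add_left, AddChar.map_add_eq_mul, Circle.coe_mul,
    Circle.smul_def, smul_eq_mul, add_comm τ ζ, real_inner_comm τ]
  ring

end Plancherel

/-! ### Littlewood–Paley pieces -/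

section LittlewoodPaley

variable {n : ℕ}

/-- The dilation `ξ ↦ f (c ξ)` of a Schwartz function, for `c ≠ 0`. -/
def dilate (c : ℝ) (hc : c ≠ 0) (f : 𝓢(Rn n, ℂ)) : 𝓢(Rn n, ℂ) :=
  SchwartzMap.compCLMOfContinuousLinearEquiv ℂ
    (ContinuousLinearEquiv.smulLeft (R₁ := ℝ) (M₁ := Rn n) (Units.mk0 c hc)) f

@[simp] lemma dilate_apply (c : ℝ) (hc : c ≠ 0) (f : 𝓢(Rn n, ℂ)) (ξ : Rn n) :
    dilate c hc f ξ = f (c • ξ) := rfl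

/-- The function `ψ_ℓ` in the frequency variable of Mathlib's Fourier transform. -/
def lpFreq (ψ₀ : 𝓢(Rn n, ℂ)) (ℓ : ℕ) : 𝓢(Rn n, ℂ) :=
  if ℓ = 0 then dilate (2 * Real.pi) (by positivity) ψ₀
  else dilate (((2 : ℝ) ^ ℓ)⁻¹ * (2 * Real.pi)) (by positivity) ψ₀ -
    dilate (2 * (((2 : ℝ) ^ ℓ)⁻¹ * (2 * Real.pi))) (by positivity) ψ₀

lemma lpFreq_apply (ψ₀ : 𝓢(Rn n, ℂ)) (ℓ : ℕ) (η : Rn n) :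
    lpFreq ψ₀ ℓ η = lpPiece ψ₀ ℓ ((2 * Real.pi) • η) := by
  unfold lpFreq lpPiece
  split_ifs with h
  · rfl
  · simp [smul_smul]

lemma lpFreq_coe (ψ₀ : 𝓢(Rn n, ℂ)) (ℓ : ℕ) :
    (lpFreq ψ₀ ℓ : Rn n → ℂ) = fun η => lpPiece ψ₀ ℓ ((2 * Real.pi) • η) :=
  funext (lpFreq_apply ψ₀ ℓ)

/-- The differences telescope. -/
lemma sum_lpFreq (ψ₀ : 𝓢(Rn n, ℂ)) (J : ℕ) (η : Rn n) :
    ∑ j ∈ Finset.range (J + 1), lpFreq ψ₀ j η =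
      ψ₀ (((2 : ℝ) ^ J)⁻¹ • (2 * Real.pi) • η) := by
  induction J with
  | zero => simp [lpFreq_apply, lpPiece]
  | succ J ih =>
    rw [Finset.sum_range_succ, ih, lpFreq_apply, lpPiece, if_neg (Nat.succ_ne_zero J)]
    have : (2 : ℝ) • ((2 : ℝ) ^ (J + 1))⁻¹ • (2 * Real.pi) • η =
        ((2 : ℝ) ^ J)⁻¹ • (2 * Real.pi) • η := by
      rw [smul_smul]
      congr 1
      rw [pow_succ]
      field_simp
    rw [this]
    ring

/-- The frequencies of the wave packets of the `j`-th Littlewood–Paley piece. -/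
def band (n j : ℕ) : Set (Rn n) :=
  {η | (2 : ℝ) ^ j / 2 - 1 ≤ 2 * Real.pi * ‖η‖ ∧ 2 * Real.pi * ‖η‖ ≤ 2 * 2 ^ j + 1}

lemma measurableSet_band (n j : ℕ) : MeasurableSet (band n j) := by
  have h : Measurable (fun η : Rn n => 2 * Real.pi * ‖η‖) := by fun_prop
  exact (measurableSet_le measurable_const h).inter (measurableSet_le h measurable_const)

lemma lpFreq_eq_zero {ψ₀ : 𝓢(Rn n, ℂ)} (hψ₀ : IsLPGenerator ψ₀) {j : ℕ} {ξ : Rn n}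
    (h : (j ≠ 0 ∧ 2 * Real.pi * ‖ξ‖ < 2 ^ j / 2) ∨ 2 * 2 ^ j < 2 * Real.pi * ‖ξ‖) :
    lpFreq ψ₀ j ξ = 0 := by
  have hz : ∀ ζ : Rn n, 2 < ‖ζ‖ → ψ₀ ζ = 0 := by
    intro ζ hζ
    by_contra hne
    have := hψ₀.1 (subset_tsupport _ (Function.mem_support.2 hne))
    rw [mem_closedBall_zero_iff] at this
    linarith
  have hpi := Real.pi_pos
  have hnorm : ‖(2 * Real.pi) • ξ‖ = 2 * Real.pi * ‖ξ‖ := by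
    rw [norm_smul, Real.norm_of_nonneg (by positivity)]
  have h2 : (0 : ℝ) < 2 ^ j := by positivity
  have hn1 : ‖((2 : ℝ) ^ j)⁻¹ • (2 * Real.pi) • ξ‖ = (2 * Real.pi * ‖ξ‖) / 2 ^ j := by
    rw [norm_smul, hnorm, norm_inv, Real.norm_of_nonneg h2.le]
    ring
  have hn2 : ‖(2 : ℝ) • ((2 : ℝ) ^ j)⁻¹ • (2 * Real.pi) • ξ‖ =
      2 * ((2 * Real.pi * ‖ξ‖) / 2 ^ j) := by
    rw [norm_smul, hn1]; simp
  rw [lpFreq_apply, lpPiece]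
  split_ifs with hj
  · subst hj
    rcases h with h | h
    · exact absurd rfl h.1
    · refine hz _ ?_
      rw [hnorm]; simpa using h
  · rcases h with h | h
    · have : (2 * Real.pi * ‖ξ‖) / 2 ^ j ≤ 1 / 2 := by
        rw [div_le_iff₀ h2]; linarith [h.2]
      rw [hψ₀.2 _ (by rw [hn1]; linarith), hψ₀.2 _ (by rw [hn2]; linarith), sub_self]
    · have : 2 < (2 * Real.pi * ‖ξ‖) / 2 ^ j := by
        rw [lt_div_iff₀ h2]; linarith
      rw [hz _ (by rw [hn1]; linarith), hz _ (by rw [hn2]; linarith), sub_self]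

end LittlewoodPaley

/-! ### Decomposition of wave packets into frequency bands -/

section Bands

variable {n : ℕ}

/-- The `j`-th Littlewood–Paley piece of a Schwartz function. -/
def lpProj (ψ₀ : 𝓢(Rn n, ℂ)) (j : ℕ) (f : 𝓢(Rn n, ℂ)) : 𝓢(Rn n, ℂ) :=
  SchwartzMap.fourierMultiplierCLM ℂ (lpFreq ψ₀ j) f

lemma fourier_lpProj (ψ₀ : 𝓢(Rn n, ℂ)) (j : ℕ) (f : 𝓢(Rn n, ℂ)) (ξ : Rn n) :
    𝓕 (lpProj ψ₀ j f : Rn n → ℂ) ξ = lpFreq ψ₀ j ξ * 𝓕 (f : Rn n → ℂ) ξ :=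
  fourier_fourierMultiplier (lpFreq ψ₀ j).hasTemperateGrowth f ξ

/-- The window has radius (2π)⁻¹, that is, radius 1 in the variable 2πξ, which is the margin built
into `band`. For `j = 0` the lower bound in `band` is negative and excludes nothing. -/
lemma window_mul_lpFreq_eq_zero {χ ψ₀ : 𝓢(Rn n, ℂ)} (hχ : IsWindow χ) (hψ₀ : IsLPGenerator ψ₀)
    {j : ℕ} {η : Rn n} (hη : η ∉ band n j) (ξ : Rn n) : χ (ξ - η) * lpFreq ψ₀ j ξ = 0 := by
  by_cases hξ : (2 * Real.pi)⁻¹ < ‖ξ - η‖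
  · rw [hχ.eq_zero _ hξ, zero_mul]
  · rw [not_lt] at hξ
    have hpi := Real.two_pi_pos
    have h1 : 2 * Real.pi * ‖ξ - η‖ ≤ 1 := by
      calc 2 * Real.pi * ‖ξ - η‖ ≤ 2 * Real.pi * (2 * Real.pi)⁻¹ := by gcongr
        _ = 1 := mul_inv_cancel₀ hpi.ne'
    have h2 : 2 * Real.pi * ‖ξ‖ ≤ 2 * Real.pi * ‖η‖ + 1 := by
      have : ‖ξ‖ ≤ ‖η‖ + ‖ξ - η‖ := by simpa using norm_add_le η (ξ - η)
      nlinarith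
    have h3 : 2 * Real.pi * ‖η‖ ≤ 2 * Real.pi * ‖ξ‖ + 1 := by
      have : ‖η‖ ≤ ‖ξ‖ + ‖ξ - η‖ := by simpa using norm_sub_le ξ (ξ - η)
      nlinarith
    rw [lpFreq_eq_zero hψ₀, mul_zero]
    simp only [band, Set.mem_ofPred_eq, not_and_or, not_le] at hη
    rcases hη with hη | hη
    · refine Or.inl ⟨?_, by linarith⟩
      rintro rfl
      have := norm_nonneg η
      rw [pow_zero] at hη
      nlinarith
    · exact Or.inr (by linarith)

lemma packet_eq_zero {χ f : 𝓢(Rn n, ℂ)} {η : Rn n}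
    (h : ∀ ξ, χ (ξ - η) * 𝓕 (f : Rn n → ℂ) ξ = 0) (y : Rn n) : packet χ f η y = 0 := by
  rw [packet_apply]
  simp [h]

lemma packet_lpProj_eq_zero {χ ψ₀ : 𝓢(Rn n, ℂ)} (hχ : IsWindow χ) (hψ₀ : IsLPGenerator ψ₀)
    (f : 𝓢(Rn n, ℂ)) {j : ℕ} {η : Rn n} (hη : η ∉ band n j) (y : Rn n) :
    packet χ (lpProj ψ₀ j f) η y = 0 := by
  refine packet_eq_zero (fun ξ => ?_) y
  rw [fourier_lpProj, ← mul_assoc, window_mul_lpFreq_eq_zero hχ hψ₀ hη, zero_mul]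

lemma schwartz_eq_of_fourier_eq {f g : 𝓢(Rn n, ℂ)}
    (h : ∀ ξ, 𝓕 (f : Rn n → ℂ) ξ = 𝓕 (g : Rn n → ℂ) ξ) : f = g := by
  have h1 : 𝓕 f = 𝓕 g := by
    ext ξ
    rw [SchwartzMap.fourier_coe, SchwartzMap.fourier_coe, h]
  have h2 := congrArg (fun u : 𝓢(Rn n, ℂ) => (𝓕⁻ u : 𝓢(Rn n, ℂ))) h1
  simpa only [FourierTransform.fourierInv_fourier_eq] using h2

lemma enorm_packet_le_tsum {χ ψ₀ : 𝓢(Rn n, ℂ)} (hχ : IsWindow χ) (hψ₀ : IsLPGenerator ψ₀)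
    (f : 𝓢(Rn n, ℂ)) (η y : Rn n) :
    ‖packet χ f η y‖ₑ ≤ ∑' j, ‖packet χ (lpProj ψ₀ j f) η y‖ₑ := by
  -- Beyond 2^J no frequency of the window around η is left, so the partial sum up to `J` acts as
  -- the identity on the packet.
  obtain ⟨J, hJ⟩ := pow_unbounded_of_one_lt (2 * Real.pi * ‖η‖ + 1) (one_lt_two (α := ℝ))
  have hpi := Real.two_pi_pos
  have key : packet χ f η = ∑ j ∈ Finset.range (J + 1), packet χ (lpProj ψ₀ j f) η := by
    refine schwartz_eq_of_fourier_eq fun ξ => ?_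
    have hsum : 𝓕 ((∑ j ∈ Finset.range (J + 1), packet χ (lpProj ψ₀ j f) η : 𝓢(Rn n, ℂ)) :
        Rn n → ℂ) ξ = ∑ j ∈ Finset.range (J + 1),
          𝓕 (packet χ (lpProj ψ₀ j f) η : Rn n → ℂ) ξ := by
      simp only [← SchwartzMap.fourier_coe]
      have := map_sum (FourierTransform.fourierCLM ℂ 𝓢(Rn n, ℂ))
        (fun j => packet χ (lpProj ψ₀ j f) η) (Finset.range (J + 1))
      simp only [FourierTransform.fourierCLM_apply] at this
      rw [this, _root_.sum_apply]
    rw [hsum, fourier_packet]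
    simp_rw [fourier_packet, fourier_lpProj]
    rw [← Finset.mul_sum, ← Finset.sum_mul, sum_lpFreq]
    by_cases hξ : (2 * Real.pi)⁻¹ < ‖ξ - η‖
    · rw [hχ.eq_zero _ hξ, zero_mul, zero_mul]
    · rw [not_lt] at hξ
      have h1 : 2 * Real.pi * ‖ξ - η‖ ≤ 1 := by
        calc 2 * Real.pi * ‖ξ - η‖ ≤ 2 * Real.pi * (2 * Real.pi)⁻¹ := by gcongr
          _ = 1 := mul_inv_cancel₀ hpi.ne'
      have h2 : 2 * Real.pi * ‖ξ‖ ≤ 2 * Real.pi * ‖η‖ + 1 := by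
        have : ‖ξ‖ ≤ ‖η‖ + ‖ξ - η‖ := by simpa using norm_add_le η (ξ - η)
        nlinarith
      rw [hψ₀.2, one_mul]
      rw [norm_smul, norm_smul, norm_inv, Real.norm_of_nonneg (by positivity),
        Real.norm_of_nonneg hpi.le, inv_mul_le_iff₀ (by positivity)]
      linarith
  rw [key, _root_.sum_apply]
  exact (enorm_sum_le _ _).trans (ENNReal.sum_le_tsum _)

/-- Uniform in ℓ and in the translation: the dilation factors never exceed 4π, so large ℓ only
flattens ψ₀, while the fixed window supplies the decay. -/
lemma unifSchwartz_lpFreq (χ ψ₀ : 𝓢(Rn n, ℂ)) :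
    UnifSchwartz (fun (i : ℕ × Rn n) => 𝓕⁻ (fun ζ => χ ζ * lpFreq ψ₀ i.1 (i.2 + ζ))) := by
  refine UnifSchwartz.fourierInv fun M => ?_
  have hχ := (SchwartzMap.unifSchwartz χ).reindex (fun (_ : ℕ × Rn n) => ()) M
  have h0 := SchwartzMap.unifSchwartz ψ₀ 0
  have hpi := Real.pi_pos
  have hc : ∀ ℓ : ℕ, ((2 : ℝ) ^ ℓ)⁻¹ * (2 * Real.pi) ≤ 2 * Real.pi := fun ℓ =>
    mul_le_of_le_one_left (by positivity) (inv_le_one_of_one_le₀ (one_le_pow₀ one_le_two))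
  have hbound : ∀ a : ℝ, 0 ≤ a → a ≤ 2 * (2 * Real.pi) →
      ‖a • ContinuousLinearMap.id ℝ (Rn n)‖ ≤ 2 * (2 * Real.pi) := by
    intro a ha ha'
    rw [norm_smul, Real.norm_of_nonneg ha]
    exact (mul_le_of_le_one_right ha ContinuousLinearMap.norm_id_le).trans ha'
  have hA := h0.comp_clm (ι' := ℕ × Rn n) (fun _ => ())
    (fun i => (((2 : ℝ) ^ i.1)⁻¹ * (2 * Real.pi)) • i.2)
    (fun i => (((2 : ℝ) ^ i.1)⁻¹ * (2 * Real.pi)) • ContinuousLinearMap.id ℝ (Rn n))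
    (2 * (2 * Real.pi)) (fun i => hbound _ (by positivity) (by linarith [hc i.1]))
  have hB := h0.comp_clm (ι' := ℕ × Rn n) (fun _ => ())
    (fun i => (2 * (((2 : ℝ) ^ i.1)⁻¹ * (2 * Real.pi))) • i.2)
    (fun i => (2 * (((2 : ℝ) ^ i.1)⁻¹ * (2 * Real.pi))) • ContinuousLinearMap.id ℝ (Rn n))
    (2 * (2 * Real.pi)) (fun i => hbound _ (by positivity) (by linarith [hc i.1]))
  -- A factor 0 or 1 removes the subtracted term for ℓ = 0, so that one family covers all ℓ.
  have hb := (unifSmooth_const (V := Rn n) (fun i : ℕ × Rn n => if i.1 = 0 then (0 : ℂ) else 1)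
    (fun i => by split_ifs <;> simp)).mul hB
  have hAB := hχ.mul (UnifSmooth.sub hA (hb.mono 1 zero_le_one (fun i v => by simp)))
  refine (show (fun (i : ℕ × Rn n) ζ => χ ζ * lpFreq ψ₀ i.1 (i.2 + ζ)) = _ from ?_) ▸
    hAB.mono 1 zero_le_one (fun i v => by simp)
  funext i ζ
  rw [lpFreq_apply, lpPiece]
  split_ifs with h
  · simp [h]
  · simp [smul_smul]

end Bands

/-! ### Integral inequalities -/

section Inequalities

lemma lintegral_mul_mul_sq_le {α : Type*} [MeasurableSpace α] (μ : Measure α)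
    {w f h : α → ℝ≥0∞} (hw : Measurable w) (hf : Measurable f) (hh : Measurable h) :
    (∫⁻ a, w a * (f a * h a) ∂μ) ^ 2 ≤ (∫⁻ a, w a * f a ^ 2 ∂μ) * ∫⁻ a, w a * h a ^ 2 ∂μ := by
  have h1 := ENNReal.lintegral_mul_le_Lp_mul_Lq (μ.withDensity w) Real.HolderConjugate.two_two
    hf.aemeasurable hh.aemeasurable
  simp only [ENNReal.rpow_two] at h1
  rw [lintegral_withDensity_eq_lintegral_mul _ hw (hf.mul hh),
    lintegral_withDensity_eq_lintegral_mul _ hw (hf.pow_const 2),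
    lintegral_withDensity_eq_lintegral_mul _ hw (hh.pow_const 2)] at h1
  simp only [Pi.mul_apply] at h1
  calc _ ≤ ((∫⁻ a, w a * f a ^ 2 ∂μ) ^ (1 / (2 : ℝ)) *
        (∫⁻ a, w a * h a ^ 2 ∂μ) ^ (1 / (2 : ℝ))) ^ 2 := pow_le_pow_left' h1 2
    _ = _ := by
      rw [mul_pow]
      congr 1 <;> rw [← ENNReal.rpow_natCast, ← ENNReal.rpow_mul] <;> simp

variable {n : ℕ}

/-- Tonelli, regrouping frequencies and positions by input: each input is then a single function on
phase space. -/
lemma lintegral_four {Φ : Rn n → Rn n → Rn n → Rn n → ℝ≥0∞}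
    (hΦ : Measurable fun q : (Rn n × Rn n) × (Rn n × Rn n) => Φ q.1.1 q.2.1 q.1.2 q.2.2) :
    ∫⁻ η : Rn n × Rn n, ∫⁻ y : Rn n × Rn n, Φ η.1 η.2 y.1 y.2 =
      ∫⁻ q : (Rn n × Rn n) × (Rn n × Rn n), Φ q.1.1 q.2.1 q.1.2 q.2.2 := by
  have hm : Measurable fun p : ((Rn n × Rn n) × Rn n) × Rn n =>
      Φ p.1.1.1 p.1.1.2 p.1.2 p.2 := by
    have : Measurable fun p : ((Rn n × Rn n) × Rn n) × Rn n =>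
        (((p.1.1.1, p.1.2), (p.1.1.2, p.2)) : (Rn n × Rn n) × (Rn n × Rn n)) := by fun_prop
    exact hΦ.comp this
  have hm4 : ∀ a : Rn n, Measurable fun p : (Rn n × Rn n) × Rn n => Φ a p.1.1 p.1.2 p.2 :=
    fun a => hm.comp (f := fun p : (Rn n × Rn n) × Rn n => (((a, p.1.1), p.1.2), p.2))
      (by fun_prop)
  have hm2 : ∀ a b : Rn n, Measurable fun p : Rn n × Rn n => Φ a b p.1 p.2 :=
    fun a b => hm.comp (f := fun p : Rn n × Rn n => (((a, b), p.1), p.2)) (by fun_prop)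
  have hm3 : Measurable fun p : (Rn n × Rn n) × (Rn n × Rn n) =>
      Φ p.1.1 p.1.2 p.2.1 p.2.2 :=
    hm.comp (f := fun p : (Rn n × Rn n) × (Rn n × Rn n) => (((p.1.1, p.1.2), p.2.1), p.2.2))
      (by fun_prop)
  calc _ = ∫⁻ a : Rn n, ∫⁻ b : Rn n, ∫⁻ c : Rn n, ∫⁻ d : Rn n, Φ a b c d := by
        rw [Measure.volume_eq_prod, lintegral_prod _ (hm3.lintegral_prod_right').aemeasurable]
        refine lintegral_congr fun a => lintegral_congr fun b => ?_
        rw [lintegral_prod _ (hm2 a b).aemeasurable]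
    _ = ∫⁻ a : Rn n, ∫⁻ c : Rn n, ∫⁻ b : Rn n, ∫⁻ d : Rn n, Φ a b c d := by
        refine lintegral_congr fun a => ?_
        exact lintegral_lintegral_swap ((hm4 a).lintegral_prod_right').aemeasurable
    _ = _ := by
        rw [Measure.volume_eq_prod, lintegral_prod _ hΦ.aemeasurable]
        rw [Measure.volume_eq_prod, lintegral_prod _ (hΦ.lintegral_prod_right').aemeasurable]
        refine lintegral_congr fun a => lintegral_congr fun c => ?_
        have : Measurable fun p : Rn n × Rn n => Φ a p.1 c p.2 :=
          hm.comp (f := fun p : Rn n × Rn n => (((a, p.1), c), p.2)) (by fun_prop)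
        rw [lintegral_prod _ this.aemeasurable]

variable {g : Rn n → ℝ≥0∞} {a b : Rn n × Rn n → ℝ≥0∞}

lemma lintegral_translates (hg : Measurable g) (x z : Rn n) (r : ℝ≥0∞) {S : Set (Rn n)}
    (hS : MeasurableSet S) :
    ∫⁻ q : Rn n × Rn n, g (x - q.2) * S.indicator 1 q.1 = (∫⁻ z, g z) * volume S ∧
    ∫⁻ q : Rn n × Rn n, g (x - q.2) * g (z - q.1) * r = (∫⁻ z, g z) ^ 2 * r := by
  have hx : Measurable fun y => g (x - y) := hg.comp (measurable_const.sub measurable_id)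
  have hz : Measurable fun y => g (z - y) := hg.comp (measurable_const.sub measurable_id)
  have h1 : ∀ x, ∫⁻ y, g (x - y) = ∫⁻ z, g z := fun x => lintegral_sub_left_eq_self g x
  have hi : Measurable (S.indicator (1 : Rn n → ℝ≥0∞)) := measurable_one.indicator hS
  constructor
  · simp_rw [mul_comm (g _)]
    rw [Measure.volume_eq_prod, lintegral_prod_mul (f := S.indicator 1)
      (g := fun y => g (x - y)) hi.aemeasurable hx.aemeasurable, h1, lintegral_indicator_one hS]
    rw [mul_comm]
  · rw [lintegral_mul_const _ (by fun_prop)]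
    simp_rw [mul_comm (g (x - _))]
    rw [Measure.volume_eq_prod, lintegral_prod_mul (f := fun y => g (z - y))
      (g := fun y => g (x - y)) hz.aemeasurable hx.aemeasurable, h1, h1, sq]

/-- The trilinear estimate behind the bilinear one: the gain is the measure of the smallest of the
three frequency bands. -/
lemma lintegral_sq_trilinear_le (hg : Measurable g) (ha : Measurable a) (hb : Measurable b)
    {S₁ S₂ S₃ : Set (Rn n)} (hS₁ : MeasurableSet S₁) (hS₂ : MeasurableSet S₂)
    (hS₃ : MeasurableSet S₃) (ha0 : ∀ q, q.1 ∉ S₁ → a q = 0) (hb0 : ∀ q, q.1 ∉ S₂ → b q = 0)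
    (x : Rn n) :
    ∫⁻ τ, S₃.indicator 1 τ * (∫⁻ q : (Rn n × Rn n) × (Rn n × Rn n),
      g (x - q.1.2) * g (x - q.2.2) * g (τ - q.1.1 - q.2.1) * (a q.1 * b q.2)) ^ 2 ≤
      (∫⁻ z, g z) ^ 4 * min (volume S₁) (min (volume S₂) (volume S₃)) *
        ((∫⁻ q, g (x - q.2) * a q ^ 2) * ∫⁻ q, g (x - q.2) * b q ^ 2) := by
  set G := ∫⁻ z, g z with hG
  set A := ∫⁻ q, g (x - q.2) * a q ^ 2 with hA
  set B := ∫⁻ q, g (x - q.2) * b q ^ 2 with hB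
  set W : Rn n → (Rn n × Rn n) × (Rn n × Rn n) → ℝ≥0∞ := fun τ q =>
    g (x - q.1.2) * g (x - q.2.2) * g (τ - q.1.1 - q.2.1) with hW
  have hWm : ∀ τ, Measurable (W τ) := fun τ => by simp only [hW]; fun_prop
  have hWm2 : Measurable (Function.uncurry W) := by
    simp only [hW]; unfold Function.uncurry; fun_prop
  have hi1 : Measurable (S₁.indicator (1 : Rn n → ℝ≥0∞)) := measurable_one.indicator hS₁
  have hi2 : Measurable (S₂.indicator (1 : Rn n → ℝ≥0∞)) := measurable_one.indicator hS₂
  -- the mass of the kernel on the bands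
  have hmass1 : ∀ τ, ∫⁻ q, W τ q * (S₁.indicator 1 q.1.1) ^ 2 = G ^ 3 * volume S₁ := by
    intro τ
    have hsq : ∀ z : Rn n, (S₁.indicator (1 : Rn n → ℝ≥0∞) z) ^ 2 = S₁.indicator 1 z := fun z => by
      by_cases h : z ∈ S₁ <;> simp [h]
    simp_rw [hsq]
    rw [Measure.volume_eq_prod, lintegral_prod _ (by simp only [hW]; fun_prop)]
    have h2 : ∀ q₁ : Rn n × Rn n, ∫⁻ q₂ : Rn n × Rn n, W τ (q₁, q₂) * S₁.indicator 1 q₁.1 =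
        g (x - q₁.2) * S₁.indicator 1 q₁.1 * G ^ 2 := by
      intro q₁
      rw [mul_comm (g (x - q₁.2) * _), ← (lintegral_translates hg x (τ - q₁.1)
        (g (x - q₁.2) * S₁.indicator 1 q₁.1) hS₁).2]
      refine lintegral_congr fun q₂ => ?_
      simp only [hW]; ring
    simp_rw [h2]
    rw [lintegral_mul_const _ (by fun_prop), (lintegral_translates hg x 0 0 hS₁).1]
    ring
  have hmass2 : ∀ τ, ∫⁻ q, W τ q * (S₂.indicator 1 q.2.1) ^ 2 = G ^ 3 * volume S₂ := by
    intro τ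
    have hsq : ∀ z : Rn n, (S₂.indicator (1 : Rn n → ℝ≥0∞) z) ^ 2 = S₂.indicator 1 z := fun z => by
      by_cases h : z ∈ S₂ <;> simp [h]
    simp_rw [hsq]
    rw [Measure.volume_eq_prod, lintegral_prod_symm _ (by simp only [hW]; fun_prop)]
    have h2 : ∀ q₂ : Rn n × Rn n, ∫⁻ q₁ : Rn n × Rn n, W τ (q₁, q₂) * S₂.indicator 1 q₂.1 =
        g (x - q₂.2) * S₂.indicator 1 q₂.1 * G ^ 2 := by
      intro q₂
      rw [mul_comm (g (x - q₂.2) * _), ← (lintegral_translates hg x (τ - q₂.1)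
        (g (x - q₂.2) * S₂.indicator 1 q₂.1) hS₂).2]
      refine lintegral_congr fun q₁ => ?_
      simp only [hW, sub_right_comm τ q₁.1]; ring
    simp_rw [h2]
    rw [lintegral_mul_const _ (by fun_prop), (lintegral_translates hg x 0 0 hS₂).1]
    ring
  have hA2 : ∀ τ, ∫⁻ q, W τ q * a q.1 ^ 2 = G ^ 2 * A := by
    intro τ
    rw [Measure.volume_eq_prod, lintegral_prod _ (by simp only [hW]; fun_prop)]
    have h2 : ∀ q₁ : Rn n × Rn n, ∫⁻ q₂ : Rn n × Rn n, W τ (q₁, q₂) * a q₁ ^ 2 =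
        G ^ 2 * (g (x - q₁.2) * a q₁ ^ 2) := by
      intro q₁
      rw [← (lintegral_translates hg x (τ - q₁.1) (g (x - q₁.2) * a q₁ ^ 2) hS₁).2]
      refine lintegral_congr fun q₂ => ?_
      simp only [hW]; ring
    simp_rw [h2]
    rw [lintegral_const_mul _ (by fun_prop)]
  have hB2 : ∀ τ, ∫⁻ q, W τ q * b q.2 ^ 2 = G ^ 2 * B := by
    intro τ
    rw [Measure.volume_eq_prod, lintegral_prod_symm _ (by simp only [hW]; fun_prop)]
    have h2 : ∀ q₂ : Rn n × Rn n, ∫⁻ q₁ : Rn n × Rn n, W τ (q₁, q₂) * b q₂ ^ 2 =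
        G ^ 2 * (g (x - q₂.2) * b q₂ ^ 2) := by
      intro q₂
      rw [← (lintegral_translates hg x (τ - q₂.1) (g (x - q₂.2) * b q₂ ^ 2) hS₁).2]
      refine lintegral_congr fun q₁ => ?_
      simp only [hW, sub_right_comm τ q₁.1]; ring
    simp_rw [h2]
    rw [lintegral_const_mul _ (by fun_prop)]
  have hAB : ∫⁻ τ, ∫⁻ q, W τ q * (a q.1 * b q.2) ^ 2 = G * (A * B) := by
    rw [lintegral_lintegral_swap (by
      have : Measurable (Function.uncurry fun (τ : Rn n)
          (q : (Rn n × Rn n) × (Rn n × Rn n)) => W τ q * (a q.1 * b q.2) ^ 2) := by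
        simp only [hW]; unfold Function.uncurry; fun_prop
      exact this.aemeasurable)]
    have h2 : ∀ q : (Rn n × Rn n) × (Rn n × Rn n), ∫⁻ τ, W τ q * (a q.1 * b q.2) ^ 2 =
        G * ((g (x - q.1.2) * a q.1 ^ 2) * (g (x - q.2.2) * b q.2 ^ 2)) := by
      intro q
      rw [lintegral_mul_const _ (by simp only [hW]; fun_prop)]
      simp only [hW]
      rw [lintegral_const_mul _ (by fun_prop)]
      simp_rw [sub_sub]
      rw [lintegral_sub_right_eq_self g]
      ring
    simp_rw [h2]
    rw [lintegral_const_mul _ (by fun_prop), Measure.volume_eq_prod,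
      lintegral_prod_mul (f := fun q : Rn n × Rn n => g (x - q.2) * a q ^ 2)
        (g := fun q : Rn n × Rn n => g (x - q.2) * b q ^ 2) (by fun_prop) (by fun_prop)]
  have hi3 : ∀ τ (r : ℝ≥0∞), S₃.indicator (1 : Rn n → ℝ≥0∞) τ * r ≤ r := fun τ r => by
    refine mul_le_of_le_one_left zero_le ?_
    by_cases h : τ ∈ S₃ <;> simp [h]
  rw [mul_assoc, mul_comm (min _ _), ← mul_assoc]
  -- Cauchy–Schwarz with weight `W` in three ways. Pairing the indicator of S₁ or S₂ with the
  -- product a·b gives |S₁| or |S₂|, and the integral over all τ costs one more factor `G`. Pairing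
  -- a with b gives a bound independent of τ, and integrating over S₃ gives |S₃|.
  rcases min_choice (volume S₁) (min (volume S₂) (volume S₃)) with h | h <;> rw [h]
  · calc _ ≤ ∫⁻ τ, (G ^ 3 * volume S₁) * ∫⁻ q, W τ q * (a q.1 * b q.2) ^ 2 := by
          refine lintegral_mono fun τ => (hi3 τ _).trans ?_
          rw [← hmass1 τ]
          have := lintegral_mul_mul_sq_le volume (hWm τ) (f := fun q => S₁.indicator 1 q.1.1)
            (h := fun q => a q.1 * b q.2) (by fun_prop) (by fun_prop)
          refine le_trans (le_of_eq ?_) this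
          congr 1
          refine lintegral_congr fun q => ?_
          by_cases hq : q.1.1 ∈ S₁
          · simp [hq, hW]
          · simp [hq, ha0 q.1 hq]
      _ = _ := by
          rw [lintegral_const_mul _ (by
            have : Measurable (Function.uncurry fun (τ : Rn n)
              (q : (Rn n × Rn n) × (Rn n × Rn n)) => W τ q * (a q.1 * b q.2) ^ 2) := by
              simp only [hW]; unfold Function.uncurry; fun_prop
            exact this.lintegral_prod_right'), hAB]
          ring
  rcases min_choice (volume S₂) (volume S₃) with h | h <;> rw [h]
  · calc _ ≤ ∫⁻ τ, (G ^ 3 * volume S₂) * ∫⁻ q, W τ q * (a q.1 * b q.2) ^ 2 := by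
          refine lintegral_mono fun τ => (hi3 τ _).trans ?_
          rw [← hmass2 τ]
          have := lintegral_mul_mul_sq_le volume (hWm τ) (f := fun q => S₂.indicator 1 q.2.1)
            (h := fun q => a q.1 * b q.2) (by fun_prop) (by fun_prop)
          refine le_trans (le_of_eq ?_) this
          congr 1
          refine lintegral_congr fun q => ?_
          by_cases hq : q.2.1 ∈ S₂
          · simp [hq, hW]
          · simp [hq, hb0 q.2 hq]
      _ = _ := by
          rw [lintegral_const_mul _ (by
            have : Measurable (Function.uncurry fun (τ : Rn n)
              (q : (Rn n × Rn n) × (Rn n × Rn n)) => W τ q * (a q.1 * b q.2) ^ 2) := by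
              simp only [hW]; unfold Function.uncurry; fun_prop
            exact this.lintegral_prod_right'), hAB]
          ring
  · calc _ ≤ ∫⁻ τ, S₃.indicator 1 τ * (G ^ 2 * A * (G ^ 2 * B)) := by
          refine lintegral_mono fun τ => mul_le_mul_right ?_ _
          rw [← hA2 τ, ← hB2 τ]
          exact lintegral_mul_mul_sq_le volume (hWm τ) (f := fun q => a q.1)
            (h := fun q => b q.2) (by fun_prop) (by fun_prop)
      _ = _ := by
          rw [lintegral_mul_const _ (measurable_one.indicator hS₃), lintegral_indicator_one hS₃]
          ring

lemma volume_band_le (n : ℕ) : ∃ C : ℝ≥0, ∀ j, volume (band n j) ≤ C * 2 ^ (j * n) := by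
  refine ⟨(volume (Metric.ball (0 : Rn n) 1)).toNNReal, fun j => ?_⟩
  -- 2·2^j + 1 ≤ 3·2^j < 2π·2^j.
  have hsub : band n j ⊆ Metric.closedBall 0 ((2 : ℝ) ^ j) := by
    intro η hη
    rw [mem_closedBall_zero_iff]
    have h1 := hη.2
    have h2 : (1 : ℝ) ≤ 2 ^ j := one_le_pow₀ one_le_two
    have h3 := Real.pi_gt_three
    nlinarith [norm_nonneg η]
  refine (measure_mono hsub).trans ?_
  rw [Measure.addHaar_closedBall _ _ (by positivity), ENNReal.coe_toNNReal
    (measure_ball_lt_top).ne, mul_comm]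
  refine mul_le_mul_right ?_ _
  rw [finrank_euclideanSpace_fin, ← pow_mul, ENNReal.ofReal_pow (by norm_num)]
  simp

end Inequalities

/-! ### Inequalities for integrals -/

/-- Minkowski's inequality for finite sums, then monotone convergence along the finite subsets. -/
lemma lintegral_tsum_rpow_le {α ι : Type*} [MeasurableSpace α] [Countable ι] {μ : Measure α}
    {f : ι → α → ℝ≥0∞} (hf : ∀ i, Measurable (f i)) {r : ℝ} (hr : 1 ≤ r) :
    (∫⁻ a, (∑' i, f i a) ^ r ∂μ) ^ (1 / r) ≤ ∑' i, (∫⁻ a, f i a ^ r ∂μ) ^ (1 / r) := by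
  have hr0 : 0 < r := zero_lt_one.trans_le hr
  have hfin : ∀ s : Finset ι, (∫⁻ a, (∑ i ∈ s, f i a) ^ r ∂μ) ^ (1 / r) ≤
      ∑ i ∈ s, (∫⁻ a, f i a ^ r ∂μ) ^ (1 / r) := by
    classical
    intro s
    induction s using Finset.induction_on with
    | empty => simp [ENNReal.zero_rpow_of_pos hr0, hr0]
    | insert i s hi ih =>
      rw [Finset.sum_insert hi]
      simp_rw [Finset.sum_insert hi]
      refine le_trans ?_ (add_le_add le_rfl ih)
      exact ENNReal.lintegral_Lp_add_le (hf i).aemeasurable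
        (Finset.measurable_fun_sum s fun i _ => hf i).aemeasurable hr
  have hsup : ∀ {κ : Type _} (t : ℝ) (_ : 0 < t) (F : κ → ℝ≥0∞), (⨆ i, F i) ^ t = ⨆ i, F i ^ t :=
    fun t ht F => (ENNReal.orderIsoRpow t ht).map_iSup F
  have h1 : ∫⁻ a, (∑' i, f i a) ^ r ∂μ = ⨆ s : Finset ι, ∫⁻ a, (∑ i ∈ s, f i a) ^ r ∂μ := by
    rw [← lintegral_iSup_directed]
    · refine lintegral_congr fun a => ?_
      rw [ENNReal.tsum_eq_iSup_sum, hsup r hr0]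
    · exact fun s => ((Finset.measurable_fun_sum s fun i _ => hf i).pow_const r).aemeasurable
    · refine Monotone.directed_le fun s t hst a => ?_
      exact ENNReal.rpow_le_rpow (Finset.sum_le_sum_of_subset hst) hr0.le
  rw [h1, hsup (1 / r) (by positivity)]
  exact iSup_le fun s => (hfin s).trans (ENNReal.sum_le_tsum s)

section Convolution

variable {n : ℕ} {v : Rn n → ℝ≥0∞} {V : ℝ≥0}

lemma rpow_le_self_add_one (V : ℝ≥0∞) {e : ℝ} (he0 : 0 ≤ e) (he1 : e ≤ 1) : V ^ e ≤ V + 1 := by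
  calc V ^ e ≤ (V + 1) ^ e := ENNReal.rpow_le_rpow le_self_add he0
    _ ≤ (V + 1) ^ (1 : ℝ) := ENNReal.rpow_le_rpow_of_exponent_le le_add_self he1
    _ = V + 1 := ENNReal.rpow_one _

/-- The average of a power of an `L^p` function against a bounded integrable weight. -/
lemma exists_average_le (hv : Measurable v) (hvV : ∀ z, v z ≤ V) (hv1 : ∫⁻ z, v z ≤ V)
    {p : ℝ≥0∞} (hp : 2 ≤ p) {F : Rn n → ℂ} (hF : Measurable F) (hS : eLpNorm F p volume ≠ ⊤) :
    ∃ γ : Rn n → ℝ≥0∞, Measurable γ ∧ (∀ x, γ x ≤ V) ∧ ∫⁻ x, γ x ≤ V ∧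
      ∀ x, (∫⁻ s, ‖F s‖ₑ ^ 2 * v (x - s)) ^ (1 / 2 : ℝ) ≤
        (V + 1) * eLpNorm F p volume * γ x ^ (p⁻¹).toReal := by
  have hvx : ∀ x, Measurable fun s => v (x - s) := fun x =>
    hv.comp (measurable_const.sub measurable_id)
  -- Hölder from exponent 2 to `p` for the measure v(x - s) ds, whose mass is at most `V`.
  have key : ∀ x, (∫⁻ s, ‖F s‖ₑ ^ 2 * v (x - s)) ^ (1 / 2 : ℝ) ≤
      eLpNorm F p (volume.withDensity fun s => v (x - s)) * (V + 1) := by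
    intro x
    have h1 := eLpNorm_le_eLpNorm_mul_rpow_measure_univ hp
      (μ := volume.withDensity fun s => v (x - s)) hF.aestronglyMeasurable
    have h2 : (∫⁻ s, ‖F s‖ₑ ^ 2 * v (x - s)) ^ (1 / 2 : ℝ) =
        eLpNorm F 2 (volume.withDensity fun s => v (x - s)) := by
      rw [eLpNorm_eq_lintegral_rpow_enorm_toReal two_ne_zero ENNReal.ofNat_ne_top,
        lintegral_withDensity_eq_lintegral_mul _ (hvx x) (by fun_prop)]
      simp only [ENNReal.toReal_ofNat, ENNReal.rpow_two, Pi.mul_apply]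
      congr 1
      exact lintegral_congr fun s => mul_comm _ _
    rw [h2]
    refine h1.trans (mul_le_mul_right ?_ _)
    rw [withDensity_apply _ MeasurableSet.univ, Measure.restrict_univ,
      lintegral_sub_left_eq_self v]
    have hp0 : (0 : ℝ) ≤ 1 / p.toReal := by positivity
    have hp2 : 1 / p.toReal ≤ 1 / 2 := by
      by_cases hpt : p = ⊤
      · simp [hpt]
      · have : (2 : ℝ) ≤ p.toReal := by
          simpa using (ENNReal.toReal_le_toReal ENNReal.ofNat_ne_top hpt).2 hp
        gcongr
    refine (ENNReal.rpow_le_rpow hv1 ?_).trans (rpow_le_self_add_one _ ?_ ?_) <;>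
    · simp only [ENNReal.toReal_ofNat]; linarith
  have hV0 : ∫⁻ _ : Rn n, (0 : ℝ≥0∞) ≤ V := by simp
  by_cases hpt : p = ⊤
  · subst hpt
    -- For p = ∞ the exponent 1/p is 0 and 0⁰ = 1, so the zero function serves.
    refine ⟨fun _ => 0, measurable_const, fun _ => zero_le, hV0, fun x => ?_⟩
    rw [ENNReal.inv_top, ENNReal.toReal_zero, ENNReal.rpow_zero, mul_one, mul_comm]
    refine (key x).trans (mul_le_mul_left ?_ _)
    rw [eLpNorm_exponent_top, eLpNorm_exponent_top]
    exact eLpNormEssSup_mono_measure _ (withDensity_absolutelyContinuous _ _)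
  have hp0 : p ≠ 0 := (zero_lt_two.trans_le hp).ne'
  have hpr : 0 < p.toReal := ENNReal.toReal_pos hp0 hpt
  by_cases hS0 : eLpNorm F p volume = 0
  · refine ⟨fun _ => 0, measurable_const, fun _ => zero_le, hV0, fun x => ?_⟩
    rw [hS0, mul_zero, zero_mul]
    refine (key x).trans ?_
    rw [eLpNorm_eq_zero_iff hF.aestronglyMeasurable hp0] at hS0
    have := (withDensity_absolutelyContinuous volume fun s => v (x - s)).ae_le hS0
    rw [eLpNorm_congr_ae this, eLpNorm_zero, zero_mul]
  obtain ⟨S, hSdef⟩ : ∃ S, S = eLpNorm F p volume := ⟨_, rfl⟩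
  rw [← hSdef] at hS hS0 ⊢
  have hSp0 : S ^ p.toReal ≠ 0 := by simp [ENNReal.rpow_eq_zero_iff, hS0, hS]
  have hSpt : S ^ p.toReal ≠ ⊤ := ENNReal.rpow_ne_top_of_nonneg hpr.le hS
  have hSp : ∫⁻ s, ‖F s‖ₑ ^ p.toReal = S ^ p.toReal := by
    rw [hSdef, eLpNorm_eq_lintegral_rpow_enorm_toReal hp0 hpt, ← ENNReal.rpow_mul,
      one_div_mul_cancel hpr.ne', ENNReal.rpow_one]
  have hm : Measurable fun z : Rn n × Rn n => ‖F z.2‖ₑ ^ p.toReal * v (z.1 - z.2) := by fun_prop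
  -- The convolution of |F|^p with `v`, divided by the integral of |F|^p: an average of translates
  -- of `v`, which inherits its supremum and integral bounds.
  refine ⟨fun x => (∫⁻ s, ‖F s‖ₑ ^ p.toReal * v (x - s)) * (S ^ p.toReal)⁻¹,
    hm.lintegral_prod_right'.mul_const _, fun x => ?_, ?_, fun x => ?_⟩
  · calc (∫⁻ s, ‖F s‖ₑ ^ p.toReal * v (x - s)) * (S ^ p.toReal)⁻¹
        ≤ (∫⁻ s, ‖F s‖ₑ ^ p.toReal * V) * (S ^ p.toReal)⁻¹ := by
          gcongr; exact hvV _
      _ = V := by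
          rw [lintegral_mul_const _ (by fun_prop), hSp, mul_right_comm,
            ENNReal.mul_inv_cancel hSp0 hSpt, one_mul]
  · rw [lintegral_mul_const _ hm.lintegral_prod_right', lintegral_lintegral_swap hm.aemeasurable]
    have h1 : ∀ s, ∫⁻ x, ‖F s‖ₑ ^ p.toReal * v (x - s) = ‖F s‖ₑ ^ p.toReal * ∫⁻ z, v z := by
      intro s
      rw [lintegral_const_mul _ (by fun_prop), lintegral_sub_right_eq_self v]
    simp_rw [h1]
    rw [lintegral_mul_const _ (by fun_prop), hSp, mul_right_comm,
      ENNReal.mul_inv_cancel hSp0 hSpt, one_mul]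
    exact hv1
  · refine (key x).trans (le_of_eq ?_)
    rw [mul_comm, mul_assoc]
    congr 1
    rw [eLpNorm_eq_lintegral_rpow_enorm_toReal hp0 hpt,
      lintegral_withDensity_eq_lintegral_mul _ (hvx x) (by fun_prop)]
    simp only [Pi.mul_apply]
    rw [ENNReal.toReal_inv, ENNReal.mul_rpow_of_nonneg _ _ (by positivity), ENNReal.inv_rpow,
      ← ENNReal.rpow_mul, mul_inv_cancel₀ hpr.ne', ENNReal.rpow_one, mul_left_comm,
      ENNReal.mul_inv_cancel hS0 hS, mul_one, one_div]
    congr 1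
    exact lintegral_congr fun s => mul_comm _ _

/-- Hölder's inequality for two averages, `1/p ≤ 1/p₁ + 1/p₂`. -/
lemma exists_lintegral_averages_le (hv : Measurable v) (hvV : ∀ z, v z ≤ V)
    (hv1 : ∫⁻ z, v z ≤ V) {p p₁ p₂ : ℝ≥0∞} (hp : 1 ≤ p) (hp2 : p ≤ 2) (hp₁ : 2 ≤ p₁)
    (hp₂ : 2 ≤ p₂) (hpp : p⁻¹ ≤ p₁⁻¹ + p₂⁻¹) :
    ∃ C : ℝ≥0, ∀ F H : Rn n → ℂ, Measurable F → Measurable H → eLpNorm F p₁ volume ≠ ⊤ →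
      eLpNorm H p₂ volume ≠ ⊤ →
      (∫⁻ x, ((∫⁻ s, ‖F s‖ₑ ^ 2 * v (x - s)) ^ (1 / 2 : ℝ) *
        (∫⁻ s, ‖H s‖ₑ ^ 2 * v (x - s)) ^ (1 / 2 : ℝ)) ^ p.toReal) ^ (1 / p.toReal) ≤
      C * (eLpNorm F p₁ volume * eLpNorm H p₂ volume) := by
  have hpt : p ≠ ⊤ := ne_top_of_le_ne_top ENNReal.ofNat_ne_top hp2
  obtain ⟨r, hr⟩ : ∃ r, r = p.toReal := ⟨_, rfl⟩
  have hr1 : 1 ≤ r := by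
    rw [hr]; simpa using (ENNReal.toReal_le_toReal ENNReal.one_ne_top hpt).2 hp
  have hr0 : 0 < r := by linarith
  obtain ⟨θ₁, hθ₁⟩ : ∃ r, r = (p₁⁻¹).toReal := ⟨_, rfl⟩
  obtain ⟨θ₂, hθ₂⟩ : ∃ r, r = (p₂⁻¹).toReal := ⟨_, rfl⟩
  have hfin : ∀ {a : ℝ≥0∞}, 2 ≤ a → a⁻¹ ≠ ⊤ := fun ha =>
    ENNReal.inv_ne_top.2 (zero_lt_two.trans_le ha).ne'
  have hsum : r⁻¹ ≤ θ₁ + θ₂ := by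
    rw [hr, hθ₁, hθ₂, ← ENNReal.toReal_inv, ← ENNReal.toReal_add (hfin hp₁) (hfin hp₂)]
    exact (ENNReal.toReal_le_toReal (ENNReal.inv_ne_top.2 (zero_lt_one.trans_le hp).ne')
      (ENNReal.add_ne_top.2 ⟨hfin hp₁, hfin hp₂⟩)).2 hpp
  have h1 : 1 ≤ (θ₁ + θ₂) * r := by rwa [inv_le_iff_one_le_mul₀ hr0] at hsum
  have hθ₁0 : 0 ≤ θ₁ := hθ₁ ▸ ENNReal.toReal_nonneg
  have hθ₂0 : 0 ≤ θ₂ := hθ₂ ▸ ENNReal.toReal_nonneg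
  obtain ⟨W, hW⟩ : ∃ W : ℝ≥0, (W : ℝ≥0∞) = V + V := ⟨V + V, by push_cast; rfl⟩
  have hfinal : (W : ℝ≥0∞) ^ ((θ₁ + θ₂) * r - 1) * (W : ℝ≥0∞) ≠ ⊤ :=
    ENNReal.mul_ne_top (ENNReal.rpow_ne_top_of_nonneg (by linarith) ENNReal.coe_ne_top)
      ENNReal.coe_ne_top
  refine ⟨(V + 1) ^ 2 * (((W : ℝ≥0∞) ^ ((θ₁ + θ₂) * r - 1) *
    (W : ℝ≥0∞)) ^ (1 / r)).toNNReal, fun F H hF hH hFt hHt => ?_⟩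
  obtain ⟨γ₁, hγ₁, hγ₁V, hγ₁1, hF'⟩ := exists_average_le hv hvV hv1 hp₁ hF hFt
  obtain ⟨γ₂, hγ₂, hγ₂V, hγ₂1, hH'⟩ := exists_average_le hv hvV hv1 hp₂ hH hHt
  rw [← hθ₁] at hF'
  rw [← hθ₂] at hH'
  obtain ⟨S₁, hS₁⟩ : ∃ S, S = eLpNorm F p₁ volume := ⟨_, rfl⟩
  obtain ⟨S₂, hS₂⟩ : ∃ S, S = eLpNorm H p₂ volume := ⟨_, rfl⟩
  rw [← hS₁] at hF' ⊢
  rw [← hS₂] at hH' ⊢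
  rw [← hr]
  have hpt : ∀ x, ((∫⁻ s, ‖F s‖ₑ ^ 2 * v (x - s)) ^ (1 / 2 : ℝ) *
      (∫⁻ s, ‖H s‖ₑ ^ 2 * v (x - s)) ^ (1 / 2 : ℝ)) ^ r ≤
      ((V + 1) ^ 2 * (S₁ * S₂)) ^ r * (((W : ℝ≥0∞) ^ ((θ₁ + θ₂) * r - 1)) *
        (γ₁ x + γ₂ x)) := by
    intro x
    -- The total exponent (1/p₁ + 1/p₂) p is at least 1. Since γ₁ + γ₂ is bounded, the excess over 1
    -- becomes a constant and the integrable first power remains.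
    have ha : γ₁ x ^ θ₁ * γ₂ x ^ θ₂ ≤ (γ₁ x + γ₂ x) ^ (θ₁ + θ₂) := by
      rw [ENNReal.rpow_add_of_nonneg _ _ hθ₁0 hθ₂0]
      gcongr
      · exact le_self_add
      · exact le_add_self
    have hb : (γ₁ x + γ₂ x) ^ ((θ₁ + θ₂) * r) ≤
        (W : ℝ≥0∞) ^ ((θ₁ + θ₂) * r - 1) * (γ₁ x + γ₂ x) := by
      have : (θ₁ + θ₂) * r = ((θ₁ + θ₂) * r - 1) + 1 := by ring
      conv_lhs => rw [this, ENNReal.rpow_add_of_nonneg _ _ (by linarith) zero_le_one,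
        ENNReal.rpow_one]
      gcongr
      rw [hW]
      exact add_le_add (hγ₁V x) (hγ₂V x)
    calc _ ≤ (((V + 1) * S₁ * γ₁ x ^ θ₁) * ((V + 1) * S₂ * γ₂ x ^ θ₂)) ^ r := by
          gcongr
          · exact hF' x
          · exact hH' x
      _ = ((V + 1) ^ 2 * (S₁ * S₂)) ^ r * (γ₁ x ^ θ₁ * γ₂ x ^ θ₂) ^ r := by
          rw [← ENNReal.mul_rpow_of_nonneg _ _ hr0.le]
          congr 1; ring
      _ ≤ ((V + 1) ^ 2 * (S₁ * S₂)) ^ r * ((γ₁ x + γ₂ x) ^ (θ₁ + θ₂)) ^ r := by gcongr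
      _ ≤ _ := by
          rw [← ENNReal.rpow_mul]
          gcongr
  calc _ ≤ (∫⁻ x, ((V + 1) ^ 2 * (S₁ * S₂)) ^ r * (((W : ℝ≥0∞) ^
          ((θ₁ + θ₂) * r - 1)) * (γ₁ x + γ₂ x))) ^ (1 / r) := by
        gcongr with x
        exact hpt x
    _ ≤ (((V + 1) ^ 2 * (S₁ * S₂)) ^ r * (((W : ℝ≥0∞) ^
          ((θ₁ + θ₂) * r - 1)) * (W : ℝ≥0∞))) ^ (1 / r) := by
        rw [lintegral_const_mul _ (by fun_prop), lintegral_const_mul _ (by fun_prop),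
          lintegral_add_left hγ₁]
        gcongr
        rw [hW]
        exact add_le_add hγ₁1 hγ₂1
    _ = _ := by
        rw [ENNReal.mul_rpow_of_nonneg _ _ (by positivity), ← ENNReal.rpow_mul,
          mul_one_div_cancel hr0.ne', ENNReal.rpow_one, ENNReal.coe_mul, ENNReal.coe_toNNReal
            (ENNReal.rpow_ne_top_of_nonneg (by positivity) hfinal)]
        push_cast
        ring

/-- The `L^p` norm, `p ≤ 2`, is bounded by the `L^p` norm of local `L²` averages. -/
lemma exists_lintegral_le_local {w : Rn n → ℝ≥0∞} (hw : Measurable w) {c : ℝ≥0} (hc : c ≠ 0)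
    {δ : ℝ} (hδ : 0 < δ) (hwc : ∀ t ∈ Metric.ball (0 : Rn n) δ, c ≤ w t) {p : ℝ≥0∞} (hp : 1 ≤ p)
    (hp2 : p ≤ 2) :
    ∃ C : ℝ≥0, ∀ u : Rn n → ℂ, Measurable u → eLpNorm u p volume ≤
      C * (∫⁻ x, ((∫⁻ t, ‖u (x - t)‖ₑ ^ 2 * w t) ^ (1 / 2 : ℝ)) ^ p.toReal) ^ (1 / p.toReal) := by
  have hpt : p ≠ ⊤ := ne_top_of_le_ne_top ENNReal.ofNat_ne_top hp2
  have hp0 : p ≠ 0 := (zero_lt_one.trans_le hp).ne'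
  obtain ⟨r, hr⟩ : ∃ r, r = p.toReal := ⟨_, rfl⟩
  have hr0 : 0 < r := hr ▸ ENNReal.toReal_pos hp0 hpt
  have hr2 : r ≤ 2 := by
    rw [hr]; simpa using (ENNReal.toReal_le_toReal hpt ENNReal.ofNat_ne_top).2 hp2
  obtain ⟨B, hB⟩ : ∃ B, B = Metric.ball (0 : Rn n) δ := ⟨_, rfl⟩
  have hBm : MeasurableSet B := hB ▸ measurableSet_ball
  have hB0 : volume B ≠ 0 := by rw [hB]; exact (Metric.measure_ball_pos _ _ hδ).ne'
  have hBt : volume B ≠ ⊤ := by rw [hB]; exact measure_ball_lt_top.ne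
  have hcc : (c : ℝ≥0∞) ≠ 0 := by simpa using hc
  obtain ⟨K, hK⟩ : ∃ K, K = ((c : ℝ≥0∞)⁻¹) ^ (1 / 2 : ℝ) * volume B ^ (1 / r - 1 / 2) := ⟨_, rfl⟩
  have hKt : K ≠ ⊤ := by
    rw [hK]
    refine ENNReal.mul_ne_top (ENNReal.rpow_ne_top_of_nonneg (by norm_num)
      (ENNReal.inv_ne_top.2 hcc)) (ENNReal.rpow_ne_top_of_ne_zero hB0 hBt)
  have hC : (volume B)⁻¹ ^ (1 / r) * K ≠ ⊤ := ENNReal.mul_ne_top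
    (ENNReal.rpow_ne_top_of_nonneg (by positivity) (ENNReal.inv_ne_top.2 hB0)) hKt
  refine ⟨((volume B)⁻¹ ^ (1 / r) * K).toNNReal, fun u hu => ?_⟩
  rw [ENNReal.coe_toNNReal hC, eLpNorm_eq_lintegral_rpow_enorm_toReal hp0 hpt, ← hr]
  -- Hölder on the ball, where the weight is at least `c`. Integrating in `x` and exchanging the
  -- integrals then recovers the global norm times the volume of the ball.
  have hx : ∀ x, ∫⁻ t in B, ‖u (x - t)‖ₑ ^ r ≤
      (K * (∫⁻ t, ‖u (x - t)‖ₑ ^ 2 * w t) ^ (1 / 2 : ℝ)) ^ r := by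
    intro x
    have hux : Measurable fun t => u (x - t) := hu.comp (measurable_const.sub measurable_id)
    have h1 := eLpNorm_le_eLpNorm_mul_rpow_measure_univ hp2
      (μ := volume.restrict B) hux.aestronglyMeasurable
    rw [eLpNorm_eq_lintegral_rpow_enorm_toReal hp0 hpt, eLpNorm_eq_lintegral_rpow_enorm_toReal
      two_ne_zero ENNReal.ofNat_ne_top, ← hr, Measure.restrict_apply_univ] at h1
    simp only [ENNReal.toReal_ofNat, ENNReal.rpow_two] at h1
    have h2 : ∫⁻ t in B, ‖u (x - t)‖ₑ ^ 2 ≤ (c : ℝ≥0∞)⁻¹ * ∫⁻ t, ‖u (x - t)‖ₑ ^ 2 * w t := by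
      rw [← lintegral_const_mul _ (by fun_prop)]
      refine (setLIntegral_mono' hBm (fun t ht => ?_)).trans (setLIntegral_le_lintegral B _)
      rw [mul_left_comm]
      refine le_mul_of_one_le_right zero_le ?_
      rw [← ENNReal.inv_mul_cancel hcc ENNReal.coe_ne_top]
      gcongr
      exact hwc t (hB ▸ ht)
    calc ∫⁻ t in B, ‖u (x - t)‖ₑ ^ r
        = ((∫⁻ t in B, ‖u (x - t)‖ₑ ^ r) ^ (1 / r)) ^ r := by
          rw [← ENNReal.rpow_mul, one_div_mul_cancel hr0.ne', ENNReal.rpow_one]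
      _ ≤ (((c : ℝ≥0∞)⁻¹ * ∫⁻ t, ‖u (x - t)‖ₑ ^ 2 * w t) ^ (1 / 2 : ℝ) *
          volume B ^ (1 / r - 1 / 2)) ^ r := by
          refine ENNReal.rpow_le_rpow (h1.trans ?_) hr0.le
          gcongr
      _ = _ := by
          rw [ENNReal.mul_rpow_of_nonneg _ _ (by norm_num : (0 : ℝ) ≤ 1 / 2), hK, mul_right_comm]
  have hm : Measurable fun z : Rn n × Rn n => ‖u (z.1 - z.2)‖ₑ ^ r := by fun_prop
  have htot : ∫⁻ x, ∫⁻ t in B, ‖u (x - t)‖ₑ ^ r = volume B * ∫⁻ x, ‖u x‖ₑ ^ r := by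
    rw [lintegral_lintegral_swap hm.aemeasurable]
    simp_rw [fun t : Rn n => lintegral_sub_right_eq_self (μ := volume)
      (fun x => ‖u x‖ₑ ^ r) t]
    rw [setLIntegral_const, mul_comm]
  have hmN : Measurable fun x => ((∫⁻ t, ‖u (x - t)‖ₑ ^ 2 * w t) ^ (1 / 2 : ℝ)) ^ r := by
    have : Measurable fun z : Rn n × Rn n => ‖u (z.1 - z.2)‖ₑ ^ 2 * w z.2 := by fun_prop
    exact (this.lintegral_prod_right'.pow_const _).pow_const _
  have h3 : ∫⁻ x, ‖u x‖ₑ ^ r ≤ (volume B)⁻¹ * (K ^ r *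
      ∫⁻ x, ((∫⁻ t, ‖u (x - t)‖ₑ ^ 2 * w t) ^ (1 / 2 : ℝ)) ^ r) := by
    rw [← lintegral_const_mul _ hmN]
    calc ∫⁻ x, ‖u x‖ₑ ^ r = (volume B)⁻¹ * (volume B * ∫⁻ x, ‖u x‖ₑ ^ r) := by
          rw [← mul_assoc, ENNReal.inv_mul_cancel hB0 hBt, one_mul]
      _ ≤ _ := by
          rw [← htot]
          gcongr with x
          rw [← ENNReal.mul_rpow_of_nonneg _ _ hr0.le]
          exact hx x
  refine (ENNReal.rpow_le_rpow h3 (by positivity)).trans (le_of_eq ?_)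
  rw [ENNReal.mul_rpow_of_nonneg _ _ (by positivity),
    ENNReal.mul_rpow_of_nonneg _ _ (by positivity), ← ENNReal.rpow_mul,
    mul_one_div_cancel hr0.ne', ENNReal.rpow_one, mul_assoc]

end Convolution

/-! ### Kernel bounds on frequency bands -/

section KernelBands

variable {n : ℕ}

/-- The distance of the largest of three indices to the second largest one. -/
def gap (ℓ j k : ℕ) : ℕ := max (ℓ - max j k) (max (j - max ℓ k) (k - max ℓ j))

/-- If P ≤ M + 4 the power is at most 16. Otherwise 4·2^M ≤ 2^P/8, so `B` is too small to account
for `A` and 7t ≥ (3/8)·2^P - 3. -/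
lemma two_pow_sub_le {P M : ℕ} {A B t : ℝ} (hA : 2 ^ P / 2 - 1 ≤ A) (hB : B ≤ 4 * 2 ^ M + 2)
    (ht : 0 ≤ t) (h : A ≤ B + 2 * Real.pi * t) : (2 : ℝ) ^ (P - M) ≤ 32 * (1 + t) := by
  have hpi := Real.pi_lt_d2
  have h1 : 2 * Real.pi * t ≤ 7 * t := by nlinarith
  by_cases hPM : P ≤ M + 4
  · have : (2 : ℝ) ^ (P - M) ≤ 2 ^ 4 := pow_le_pow_right₀ one_le_two (by omega)
    linarith
  · have h2 : (2 : ℝ) ^ (P - M) ≤ 2 ^ P := pow_le_pow_right₀ one_le_two (by omega)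
    have h3 : (2 : ℝ) ^ (M + 5) ≤ 2 ^ P := pow_le_pow_right₀ one_le_two (by omega)
    rw [pow_add] at h3
    linarith

/-- By the triangle inequality, three frequencies with τ ≈ η₁ + η₂ cannot have one much larger than
the other two. A gap is therefore paid for by |τ-η₁-η₂|, and the decay of the kernel beats it. -/
lemma two_pow_gap_le {ℓ j k : ℕ} {τ η₁ η₂ : Rn n} (hτ : τ ∈ band n ℓ) (h₁ : η₁ ∈ band n j)
    (h₂ : η₂ ∈ band n k) : (2 : ℝ) ^ gap ℓ j k ≤ 32 * (1 + ‖τ - η₁ - η₂‖) := by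
  have hpow : ∀ {a b : ℕ}, a ≤ b → (2 : ℝ) ^ a ≤ 2 ^ b := fun h => pow_le_pow_right₀ one_le_two h
  have hpi := Real.two_pi_pos
  have ht := norm_nonneg (τ - η₁ - η₂)
  have e1 : ‖τ‖ ≤ ‖η₁‖ + ‖η₂‖ + ‖τ - η₁ - η₂‖ := by
    calc ‖τ‖ = ‖η₁ + η₂ + (τ - η₁ - η₂)‖ := by congr 1; abel
      _ ≤ _ := norm_add₃_le
  have e2 : ‖η₁‖ ≤ ‖τ‖ + ‖η₂‖ + ‖τ - η₁ - η₂‖ := by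
    calc ‖η₁‖ = ‖τ + -η₂ + -(τ - η₁ - η₂)‖ := by congr 1; abel
      _ ≤ _ := norm_add₃_le.trans (by rw [norm_neg, norm_neg])
  have e3 : ‖η₂‖ ≤ ‖τ‖ + ‖η₁‖ + ‖τ - η₁ - η₂‖ := by
    calc ‖η₂‖ = ‖τ + -η₁ + -(τ - η₁ - η₂)‖ := by congr 1; abel
      _ ≤ _ := norm_add₃_le.trans (by rw [norm_neg, norm_neg])
  have hmax : ∀ {a b : ℕ} {x y : Rn n}, x ∈ band n a → y ∈ band n b →
      2 * Real.pi * (‖x‖ + ‖y‖) ≤ 4 * 2 ^ max a b + 2 := by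
    intro a b x y hx hy
    have := hpow (le_max_left a b)
    have := hpow (le_max_right a b)
    linarith [hx.2, hy.2]
  unfold gap
  rcases max_choice (ℓ - max j k) (max (j - max ℓ k) (k - max ℓ j)) with h | h <;> rw [h]
  · exact two_pow_sub_le hτ.1 (hmax h₁ h₂) ht (by nlinarith)
  · rcases max_choice (j - max ℓ k) (k - max ℓ j) with h | h <;> rw [h]
    · exact two_pow_sub_le h₁.1 (hmax hτ h₂) ht (by nlinarith)
    · exact two_pow_sub_le h₂.1 (hmax hτ h₁) ht (by nlinarith)

lemma one_add_norm_rpow_le_of_mem_band {j : ℕ} {η : Rn n} (h : η ∈ band n j) (m : ℝ) :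
    (1 + ‖(2 * Real.pi) • η‖) ^ m ≤ 4 ^ |m| * (2 : ℝ) ^ (j * m) := by
  rw [norm_smul, Real.norm_of_nonneg Real.two_pi_pos.le]
  obtain ⟨t, ht⟩ : ∃ t, t = 1 + 2 * Real.pi * ‖η‖ := ⟨_, rfl⟩
  have h1 : (1 : ℝ) ≤ 2 ^ j := one_le_pow₀ one_le_two
  have hlo : 2 ^ j / 2 ≤ t := by linarith [h.1]
  have hhi : t ≤ 4 * 2 ^ j := by linarith [h.2]
  rw [← ht, Real.rpow_mul two_pos.le, Real.rpow_natCast]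
  rcases le_total 0 m with hm | hm
  · rw [abs_of_nonneg hm, ← Real.mul_rpow (by norm_num) (by positivity)]
    exact Real.rpow_le_rpow (by linarith) hhi hm
  · rw [abs_of_nonpos hm, Real.rpow_neg (by norm_num), ← Real.inv_rpow (by norm_num),
      ← Real.mul_rpow (by norm_num) (by positivity)]
    exact Real.rpow_le_rpow_of_nonpos (by positivity) (by linarith) hm

/-- The exponent of the kernel bound on a triple of frequency bands. -/
def kernelExp (m₁ m₂ l₁ l₂ : ℝ) (N ℓ j k : ℕ) : ℝ :=
  (if k ≤ j then j * m₁ + k * m₂ else j * l₁ + k * l₂) - N * gap ℓ j k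

/-- An integrable radial weight. -/
def decayWeight (n : ℕ) (z : Rn n) : ℝ≥0∞ := ENNReal.ofReal (((1 + ‖z‖) ^ (n + 1))⁻¹)

lemma measurable_decayWeight (n : ℕ) : Measurable (decayWeight n) := by
  unfold decayWeight; fun_prop

lemma decayWeight_le_one (z : Rn n) : decayWeight n z ≤ 1 := by
  refine ENNReal.ofReal_le_one.2 (inv_le_one_of_one_le₀ (one_le_pow₀ ?_))
  linarith [norm_nonneg z]

lemma lintegral_decayWeight_ne_top (n : ℕ) : ∫⁻ z, decayWeight n z ≠ ⊤ := by
  have h := integrable_inv_one_add_norm_pow (Rn n) volume (M := n + 1) (by simp)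
  have := h.lintegral_lt_top
  exact this.ne

lemma exists_kernel_le_of_mem_band (n : ℕ) (m₁ m₂ l₁ l₂ : ℝ) (N : ℕ) :
    ∃ C : ℝ≥0, ∀ (ℓ j k : ℕ) (τ η₁ η₂ z₁ z₂ : Rn n), τ ∈ band n ℓ → η₁ ∈ band n j →
      η₂ ∈ band n k → ENNReal.ofReal
        (min (symbolWeight m₁ m₂ ((2 * Real.pi) • η₁) ((2 * Real.pi) • η₂))
          (symbolWeight l₁ l₂ ((2 * Real.pi) • η₁) ((2 * Real.pi) • η₂)) *
          ((1 + ‖(τ - η₁ - η₂, z₁, z₂)‖) ^ (N + 3 * (n + 1)))⁻¹) ≤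
      C * 2 ^ kernelExp m₁ m₂ l₁ l₂ N ℓ j k *
        (decayWeight n z₁ * decayWeight n z₂ * decayWeight n (τ - η₁ - η₂)) := by
  obtain ⟨A, hA⟩ : ∃ A : ℝ, A = max (4 ^ |m₁| * 4 ^ |m₂|) (4 ^ |l₁| * 4 ^ |l₂|) := ⟨_, rfl⟩
  have hA0 : 0 ≤ A := hA ▸ le_max_of_le_left (by positivity)
  refine ⟨⟨A * 32 ^ N, by positivity⟩, fun ℓ j k τ η₁ η₂ z₁ z₂ hτ h₁ h₂ => ?_⟩
  have hgap := two_pow_gap_le hτ h₁ h₂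
  obtain ⟨e, he⟩ : ∃ e : ℝ, e = if k ≤ j then j * m₁ + k * m₂ else j * l₁ + k * l₂ := ⟨_, rfl⟩
  have hsw : ∀ a₁ a₂ : ℝ, symbolWeight a₁ a₂ ((2 * Real.pi) • η₁) ((2 * Real.pi) • η₂) ≤
      4 ^ |a₁| * 4 ^ |a₂| * 2 ^ (j * a₁ + k * a₂) := by
    intro a₁ a₂
    unfold symbolWeight
    calc _ ≤ (4 ^ |a₁| * (2 : ℝ) ^ (j * a₁)) * (4 ^ |a₂| * (2 : ℝ) ^ (k * a₂)) := by
          gcongr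
          · exact one_add_norm_rpow_le_of_mem_band h₁ a₁
          · exact one_add_norm_rpow_le_of_mem_band h₂ a₂
      _ = _ := by rw [Real.rpow_add two_pos]; ring
  have hmin : min (symbolWeight m₁ m₂ ((2 * Real.pi) • η₁) ((2 * Real.pi) • η₂))
      (symbolWeight l₁ l₂ ((2 * Real.pi) • η₁) ((2 * Real.pi) • η₂)) ≤ A * 2 ^ e := by
    rw [he]
    split_ifs with hkj
    · refine (min_le_left _ _).trans ((hsw m₁ m₂).trans ?_)
      gcongr
      exact hA ▸ le_max_left _ _
    · refine (min_le_right _ _).trans ((hsw l₁ l₂).trans ?_)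
      gcongr
      exact hA ▸ le_max_right _ _
  obtain ⟨θ, hθ⟩ : ∃ θ, θ = τ - η₁ - η₂ := ⟨_, rfl⟩
  rw [← hθ] at hgap ⊢
  obtain ⟨w, hw⟩ : ∃ w : Rn n × Rn n × Rn n, w = (θ, z₁, z₂) := ⟨_, rfl⟩
  rw [← hw]
  have hw1 : ‖θ‖ ≤ ‖w‖ := by rw [hw]; exact norm_fst_le (θ, z₁, z₂)
  have hw2 : ‖z₁‖ ≤ ‖w‖ := by
    rw [hw]; exact (norm_fst_le (z₁, z₂)).trans (norm_snd_le (θ, z₁, z₂))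
  have hw3 : ‖z₂‖ ≤ ‖w‖ := by
    rw [hw]; exact (norm_snd_le (z₁, z₂)).trans (norm_snd_le (θ, z₁, z₂))
  -- `N` of the powers pay for the gap; the rest give n + 1 powers, hence integrability, in each of
  -- the three variables.
  have hdec : ((1 + ‖w‖) ^ (N + 3 * (n + 1)))⁻¹ ≤ 32 ^ N * ((2 : ℝ) ^ (N * gap ℓ j k))⁻¹ *
      (((1 + ‖z₁‖) ^ (n + 1))⁻¹ * ((1 + ‖z₂‖) ^ (n + 1))⁻¹ * ((1 + ‖θ‖) ^ (n + 1))⁻¹) := by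
    have h4 : ((1 + ‖w‖) ^ N)⁻¹ ≤ 32 ^ N * ((2 : ℝ) ^ (N * gap ℓ j k))⁻¹ := by
      rw [inv_le_comm₀ (by positivity) (by positivity), mul_inv, inv_inv, mul_comm N, pow_mul,
        ← inv_pow, ← mul_pow]
      refine pow_le_pow_left₀ (by positivity) ?_ N
      rw [inv_mul_le_iff₀ (by norm_num)]
      linarith
    calc ((1 + ‖w‖) ^ (N + 3 * (n + 1)))⁻¹ = ((1 + ‖w‖) ^ N)⁻¹ *
          (((1 + ‖w‖) ^ (n + 1))⁻¹ * ((1 + ‖w‖) ^ (n + 1))⁻¹ * ((1 + ‖w‖) ^ (n + 1))⁻¹) := by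
          rw [← mul_inv, ← mul_inv, ← mul_inv]; congr 1; ring
      _ ≤ _ := by gcongr
  have htotal : min (symbolWeight m₁ m₂ ((2 * Real.pi) • η₁) ((2 * Real.pi) • η₂))
      (symbolWeight l₁ l₂ ((2 * Real.pi) • η₁) ((2 * Real.pi) • η₂)) *
        ((1 + ‖w‖) ^ (N + 3 * (n + 1)))⁻¹ ≤ A * 32 ^ N * 2 ^ kernelExp m₁ m₂ l₁ l₂ N ℓ j k *
      (((1 + ‖z₁‖) ^ (n + 1))⁻¹ * ((1 + ‖z₂‖) ^ (n + 1))⁻¹ * ((1 + ‖θ‖) ^ (n + 1))⁻¹) := by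
    calc _ ≤ A * 2 ^ e * (32 ^ N * ((2 : ℝ) ^ (N * gap ℓ j k))⁻¹ *
          (((1 + ‖z₁‖) ^ (n + 1))⁻¹ * ((1 + ‖z₂‖) ^ (n + 1))⁻¹ *
            ((1 + ‖θ‖) ^ (n + 1))⁻¹)) := by gcongr
      _ = _ := by
          rw [kernelExp, ← he, Real.rpow_sub two_pos, ← Nat.cast_mul, Real.rpow_natCast]
          ring
  refine (ENNReal.ofReal_le_ofReal htotal).trans (le_of_eq ?_)
  unfold decayWeight
  rw [← ENNReal.ofReal_mul (by positivity), ← ENNReal.ofReal_mul (by positivity),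
    ENNReal.ofReal_mul (by positivity), ENNReal.ofReal_mul (by positivity),
    ← ENNReal.ofReal_rpow_of_pos two_pos, ENNReal.ofReal_ofNat]
  congr 2
  exact ENNReal.ofReal_eq_coe_nnreal _

lemma measurable_enorm_packet (χ f : 𝓢(Rn n, ℂ)) :
    Measurable fun q : Rn n × Rn n => ‖packet χ f q.1 q.2‖ₑ := by
  have h1 := continuous_fourier_coe f
  have h2 := χ.continuous
  have hc : Continuous fun p : (Rn n × Rn n) × Rn n =>
      (Real.fourierChar (inner ℝ p.2 p.1.2) : ℂ) *
        (χ (p.2 - p.1.1) * 𝓕 (f : Rn n → ℂ) p.2) :=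
    (continuous_fourierChar_comp (by fun_prop)).mul (by fun_prop)
  have h3 := hc.stronglyMeasurable.integral_prod_right' (ν := (volume : Measure (Rn n)))
  simp_rw [packet_apply]
  exact h3.measurable.enorm

end KernelBands

/-! ### The `L^p` bound on a frequency band -/

section BandBound

variable {n : ℕ} {σ : Rn n × Rn n × Rn n → ℂ} {m₁ m₂ l₁ l₂ : ℝ}

/-- The convolution with the `ℓ`-th Littlewood–Paley kernel. -/
def lpConv (ψ₀ : 𝓢(Rn n, ℂ)) (ℓ : ℕ) (h : Rn n → ℂ) (x : Rn n) : ℂ :=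
  ∫ s, h (x - s) * (𝓕⁻ (lpFreq ψ₀ ℓ) : 𝓢(Rn n, ℂ)) s

lemma norm_lpConv_le (ψ₀ : 𝓢(Rn n, ℂ)) (ℓ : ℕ) {h : Rn n → ℂ} {B : ℝ} (hB : ∀ x, ‖h x‖ ≤ B)
    (x : Rn n) : ‖lpConv ψ₀ ℓ h x‖ ≤ B * ∫ s, ‖(𝓕⁻ (lpFreq ψ₀ ℓ) : 𝓢(Rn n, ℂ)) s‖ := by
  rw [← integral_const_mul]
  refine norm_integral_le_of_norm_le
    ((SchwartzMap.integrable (𝓕⁻ (lpFreq ψ₀ ℓ)) (μ := volume)).norm.const_mul B)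
    (Filter.Eventually.of_forall fun s => ?_)
  rw [norm_mul]
  exact mul_le_mul_of_nonneg_right (hB _) (norm_nonneg _)

lemma continuous_lpConv (ψ₀ : 𝓢(Rn n, ℂ)) (ℓ : ℕ) {h : Rn n → ℂ} (hh : Continuous h) {B : ℝ}
    (hB : ∀ x, ‖h x‖ ≤ B) : Continuous (lpConv ψ₀ ℓ h) := by
  have hc := (𝓕⁻ (lpFreq ψ₀ ℓ) : 𝓢(Rn n, ℂ)).continuous
  refine continuous_of_dominated (bound := fun s => B * ‖(𝓕⁻ (lpFreq ψ₀ ℓ) : 𝓢(Rn n, ℂ)) s‖)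
    (fun x => Continuous.aestronglyMeasurable (by fun_prop))
    (fun x => Filter.Eventually.of_forall fun s => ?_)
    ((SchwartzMap.integrable (𝓕⁻ (lpFreq ψ₀ ℓ)) (μ := volume)).norm.const_mul B)
    (Filter.Eventually.of_forall fun s => by fun_prop)
  rw [norm_mul]
  exact mul_le_mul_of_nonneg_right (hB _) (norm_nonneg _)

/-- The trilinear form that controls the interaction of two frequency bands. -/
def bandForm (χ g₁ g₂ : 𝓢(Rn n, ℂ)) (x τ : Rn n) : ℝ≥0∞ :=
  ∫⁻ q : (Rn n × Rn n) × (Rn n × Rn n), decayWeight n (x - q.1.2) * decayWeight n (x - q.2.2) *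
    decayWeight n (τ - q.1.1 - q.2.1) * (‖packet χ g₁ q.1.1 q.1.2‖ₑ * ‖packet χ g₂ q.2.1 q.2.2‖ₑ)

lemma measurable_bandForm_integrand (χ g₁ g₂ : 𝓢(Rn n, ℂ)) (x : Rn n) :
    Measurable fun p : Rn n × ((Rn n × Rn n) × (Rn n × Rn n)) =>
      decayWeight n (x - p.2.1.2) * decayWeight n (x - p.2.2.2) *
    decayWeight n (p.1 - p.2.1.1 - p.2.2.1) *
      (‖packet χ g₁ p.2.1.1 p.2.1.2‖ₑ * ‖packet χ g₂ p.2.2.1 p.2.2.2‖ₑ) := by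
  have h1 := measurable_decayWeight n
  have h2 := (measurable_enorm_packet χ g₁).comp
    (show Measurable fun p : Rn n × ((Rn n × Rn n) × (Rn n × Rn n)) => p.2.1 by fun_prop)
  have h3 := (measurable_enorm_packet χ g₂).comp
    (show Measurable fun p : Rn n × ((Rn n × Rn n) × (Rn n × Rn n)) => p.2.2 by fun_prop)
  refine Measurable.mul ?_ (h2.mul h3)
  fun_prop

lemma measurable_bandForm (χ g₁ g₂ : 𝓢(Rn n, ℂ)) (x : Rn n) :
    Measurable (bandForm χ g₁ g₂ x) :=
  (measurable_bandForm_integrand χ g₁ g₂ x).lintegral_prod_right'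

/-- The window at τ and the ℓ-th Littlewood–Paley kernel merge into one modulated envelope, which
vanishes unless τ is in the ℓ-th band. Splitting the input packets into bands then replaces the
kernel by a single power of 2 for each triple of bands. -/
lemma exists_enorm_windowed_lpConv_le
    (hσ : HasSymbolBounds (fun z => symbolWeight m₁ m₂ z.2.1 z.2.2) σ)
    (hσ' : HasSymbolBounds (fun z => symbolWeight l₁ l₂ z.2.1 z.2.2) σ) {χ ψ₀ : 𝓢(Rn n, ℂ)}
    (hχ : IsWindow χ) (hψ₀ : IsLPGenerator ψ₀) (N : ℕ) :
    ∃ C : ℝ≥0, ∀ (f₁ f₂ : 𝓢(Rn n, ℂ)) (ℓ : ℕ) (x τ : Rn n),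
      ‖∫ t, (Real.fourierChar (inner ℝ t τ) : ℂ) *
        (lpConv ψ₀ ℓ (bilinearOp σ f₁ f₂) (x - t) * 𝓕⁻ χ t)‖ₑ ≤
      ∑' i : ℕ × ℕ, C * 2 ^ kernelExp m₁ m₂ l₁ l₂ N ℓ i.1 i.2 *
        ((band n ℓ).indicator 1 τ * bandForm χ (lpProj ψ₀ i.1 f₁) (lpProj ψ₀ i.2 f₂) x τ) := by
  obtain ⟨C₁, hC₁⟩ := enorm_localized_bilinearOp_le hσ hσ' hχ (unifSchwartz_lpFreq χ ψ₀)
    (N + 3 * (n + 1))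
  obtain ⟨C₂, hC₂⟩ := exists_kernel_le_of_mem_band n m₁ m₂ l₁ l₂ N
  refine ⟨C₁ * C₂, fun f₁ f₂ ℓ x τ => ?_⟩
  obtain ⟨B, hB⟩ := exists_norm_bilinearOp_le hσ f₁ f₂
  have hfour : ∀ ζ, 𝓕 ((𝓕⁻ (lpFreq ψ₀ ℓ) : 𝓢(Rn n, ℂ)) : Rn n → ℂ) ζ = lpFreq ψ₀ ℓ ζ := by
    intro ζ
    rw [← SchwartzMap.fourier_coe, FourierTransform.fourier_fourierInv_eq]
  have hconv := integral_windowed_convolution χ (𝓕⁻ (lpFreq ψ₀ ℓ)) (continuous_bilinearOp hσ f₁ f₂)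
    hB x τ
  unfold lpConv
  rw [hconv]
  by_cases hτ : τ ∈ band n ℓ
  swap
  · have : ∀ v, packet χ (𝓕⁻ (lpFreq ψ₀ ℓ)) τ v = 0 := packet_eq_zero fun ξ => by
      rw [hfour, window_mul_lpFreq_eq_zero hχ hψ₀ hτ]
    simp [this]
  simp_rw [packet_eq_char_mul, hfour]
  refine (hC₁ f₁ f₂ (ℓ, τ) x τ).trans ?_
  simp only [Set.indicator_of_mem hτ, Pi.one_apply, one_mul]
  obtain ⟨Φ, hΦ⟩ : ∃ Φ : ℕ × ℕ → Rn n → Rn n → Rn n → Rn n → ℝ≥0∞, Φ = fun i η₁ η₂ y₁ y₂ =>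
      C₂ * 2 ^ kernelExp m₁ m₂ l₁ l₂ N ℓ i.1 i.2 *
        (decayWeight n (x - y₁) * decayWeight n (x - y₂) * decayWeight n (τ - η₁ - η₂) *
        (‖packet χ (lpProj ψ₀ i.1 f₁) η₁ y₁‖ₑ * ‖packet χ (lpProj ψ₀ i.2 f₂) η₂ y₂‖ₑ)) :=
    ⟨_, rfl⟩
  have hm : ∀ i, Measurable fun q : (Rn n × Rn n) × (Rn n × Rn n) =>
      Φ i q.1.1 q.2.1 q.1.2 q.2.2 := by
    intro i
    simp only [hΦ]
    exact ((measurable_bandForm_integrand χ _ _ x).comp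
      (measurable_prodMk_left (x := τ))).const_mul _
  have hpt : ∀ η y : Rn n × Rn n, ‖packet χ f₁ η.1 y.1‖ₑ * ‖packet χ f₂ η.2 y.2‖ₑ *
      ENNReal.ofReal (min (symbolWeight m₁ m₂ ((2 * Real.pi) • η.1) ((2 * Real.pi) • η.2))
              (symbolWeight l₁ l₂ ((2 * Real.pi) • η.1) ((2 * Real.pi) • η.2)) *
              ((1 + ‖(τ - η.1 - η.2, x - y.1, x - y.2)‖) ^ (N + 3 * (n + 1)))⁻¹) ≤
      ∑' i : ℕ × ℕ, Φ i η.1 η.2 y.1 y.2 := by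
    intro η y
    refine (mul_le_mul_left (mul_le_mul' (enorm_packet_le_tsum hχ hψ₀ f₁ η.1 y.1)
      (enorm_packet_le_tsum hχ hψ₀ f₂ η.2 y.2)) _).trans ?_
    rw [← ENNReal.tsum_mul_right, ENNReal.tsum_prod', ← ENNReal.tsum_mul_right]
    refine ENNReal.tsum_le_tsum fun j => ?_
    rw [← ENNReal.tsum_mul_left, ← ENNReal.tsum_mul_right]
    refine ENNReal.tsum_le_tsum fun k => ?_
    by_cases h1 : η.1 ∈ band n j
    swap
    · simp [packet_lpProj_eq_zero hχ hψ₀ f₁ h1]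
    by_cases h2 : η.2 ∈ band n k
    swap
    · simp [packet_lpProj_eq_zero hχ hψ₀ f₂ h2]
    refine (mul_le_mul_right (hC₂ ℓ j k τ η.1 η.2 (x - y.1) (x - y.2) hτ h1 h2) _).trans
      (le_of_eq ?_)
    simp only [hΦ]
    ring
  calc _ ≤ C₁ * ∫⁻ η : Rn n × Rn n, ∫⁻ y : Rn n × Rn n, ∑' i, Φ i η.1 η.2 y.1 y.2 := by
        gcongr with η y
        exact hpt η y
    _ = C₁ * ∑' i, ∫⁻ q : (Rn n × Rn n) × (Rn n × Rn n), Φ i q.1.1 q.2.1 q.1.2 q.2.2 := by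
        rw [lintegral_four (Φ := fun η₁ η₂ y₁ y₂ => ∑' i, Φ i η₁ η₂ y₁ y₂)
          (Measurable.tsum hm), lintegral_tsum fun i => (hm i).aemeasurable]
    _ = _ := by
        rw [← ENNReal.tsum_mul_left]
        refine tsum_congr fun i => ?_
        simp only [hΦ]
        rw [lintegral_const_mul' _ _ (ENNReal.mul_ne_top ENNReal.coe_ne_top
          (ENNReal.rpow_ne_top_of_ne_zero two_ne_zero ENNReal.ofNat_ne_top)), bandForm]
        push_cast
        ring

/-! ### From wave packets back to local L² averages and L^p norms. -/

/-- The local `L²` mass of a function. -/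
def massWeight (χ : 𝓢(Rn n, ℂ)) (z : Rn n) : ℝ≥0∞ :=
  ∫⁻ y, decayWeight n (z - y) * ‖(𝓕⁻ χ : 𝓢(Rn n, ℂ)) y‖ₑ ^ 2

lemma measurable_massWeight_integrand (χ : 𝓢(Rn n, ℂ)) : Measurable fun p : Rn n × Rn n =>
    decayWeight n (p.1 - p.2) * ‖(𝓕⁻ χ : 𝓢(Rn n, ℂ)) p.2‖ₑ ^ 2 := by
  have h1 := measurable_decayWeight n
  obtain ⟨w, hw⟩ : ∃ w : 𝓢(Rn n, ℂ), w = 𝓕⁻ χ := ⟨_, rfl⟩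
  rw [← hw]
  have h2 : Measurable (w : Rn n → ℂ) := w.continuous.measurable
  fun_prop

lemma measurable_massWeight (χ : 𝓢(Rn n, ℂ)) : Measurable (massWeight χ) :=
  (measurable_massWeight_integrand χ).lintegral_prod_right'

/-- The weight is the convolution of a bounded integrable function with an integrable one. -/
lemma exists_massWeight_le (χ : 𝓢(Rn n, ℂ)) :
    ∃ V : ℝ≥0, (∀ z, massWeight χ z ≤ V) ∧ ∫⁻ z, massWeight χ z ≤ V := by
  have h1 := measurable_decayWeight n
  have hm := measurable_massWeight_integrand χ
  unfold massWeight
  obtain ⟨w, hw⟩ : ∃ w : 𝓢(Rn n, ℂ), w = 𝓕⁻ χ := ⟨_, rfl⟩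
  rw [← hw] at hm ⊢
  have hwc := w.continuous
  have hwt : ∫⁻ y, ‖w y‖ₑ ^ 2 ≠ ⊤ := by
    have h2 := (w.memLp 2 (μ := volume)).2
    have := eLpNorm_nnreal_pow_eq_lintegral (f := w) (μ := volume) (p := 2) (by norm_num)
    simp only [NNReal.coe_ofNat, ENNReal.coe_ofNat, ENNReal.rpow_two] at this
    rw [← this]
    exact ENNReal.pow_ne_top h2.ne
  obtain ⟨I, hI⟩ : ∃ I, I = ∫⁻ y, ‖w y‖ₑ ^ 2 := ⟨_, rfl⟩
  rw [← hI] at hwt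
  have ht : I + (∫⁻ z, decayWeight n z) * I ≠ ⊤ :=
    ENNReal.add_ne_top.2 ⟨hwt, ENNReal.mul_ne_top (lintegral_decayWeight_ne_top n) hwt⟩
  refine ⟨(I + (∫⁻ z, decayWeight n z) * I).toNNReal, fun z => ?_, ?_⟩ <;>
    rw [ENNReal.coe_toNNReal ht]
  · refine le_trans ?_ le_self_add
    rw [hI]
    gcongr with y
    exact mul_le_of_le_one_left zero_le (decayWeight_le_one _)
  · refine le_trans (le_of_eq ?_) le_add_self
    rw [lintegral_lintegral_swap hm.aemeasurable, hI, ← lintegral_const_mul _ (by fun_prop)]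
    refine lintegral_congr fun y => ?_
    rw [lintegral_mul_const _ (by fun_prop), lintegral_sub_right_eq_self (decayWeight n)]

/-- Weighted `L²` norms of wave packets as local `L²` masses. -/
lemma lintegral_decayWeight_packet (χ f : 𝓢(Rn n, ℂ)) (x : Rn n) :
    ∫⁻ q : Rn n × Rn n, decayWeight n (x - q.2) * ‖packet χ f q.1 q.2‖ₑ ^ 2 =
      ∫⁻ s, ‖f s‖ₑ ^ 2 * massWeight χ (x - s) := by
  have h1 := measurable_decayWeight n
  have hp := measurable_enorm_packet χ f
  have hy : ∀ y, ∫⁻ η, decayWeight n (x - y) * ‖packet χ f η y‖ₑ ^ 2 =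
      decayWeight n (x - y) * ∫⁻ t, ‖f (y - t)‖ₑ ^ 2 * ‖(𝓕⁻ χ : 𝓢(Rn n, ℂ)) t‖ₑ ^ 2 := by
    intro y
    have hm : Measurable fun η => ‖packet χ f η y‖ₑ ^ 2 :=
      (hp.comp (measurable_prodMk_right (y := y))).pow_const 2
    rw [lintegral_const_mul _ hm, lintegral_enorm_packet_sq]
  rw [Measure.volume_eq_prod, lintegral_prod_symm _ (by fun_prop)]
  simp only [hy]
  unfold massWeight
  obtain ⟨w, hw⟩ : ∃ w : 𝓢(Rn n, ℂ), w = 𝓕⁻ χ := ⟨_, rfl⟩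
  rw [← hw]
  have hwc := w.continuous
  have hfc := f.continuous
  have hsub : ∀ y, ∫⁻ t, ‖f (y - t)‖ₑ ^ 2 * ‖w t‖ₑ ^ 2 = ∫⁻ s, ‖f s‖ₑ ^ 2 * ‖w (y - s)‖ₑ ^ 2 := by
    intro y
    rw [← lintegral_sub_left_eq_self _ y]
    simp
  simp_rw [hsub]
  have hm : Measurable (Function.uncurry fun y s : Rn n =>
      decayWeight n (x - y) * (‖f s‖ₑ ^ 2 * ‖w (y - s)‖ₑ ^ 2)) := by
    unfold Function.uncurry
    fun_prop
  calc _ = ∫⁻ y, ∫⁻ s, decayWeight n (x - y) * (‖f s‖ₑ ^ 2 * ‖w (y - s)‖ₑ ^ 2) := by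
        refine lintegral_congr fun y => ?_
        rw [lintegral_const_mul _ (by fun_prop)]
    _ = ∫⁻ s, ∫⁻ y, decayWeight n (x - y) * (‖f s‖ₑ ^ 2 * ‖w (y - s)‖ₑ ^ 2) :=
        lintegral_lintegral_swap hm.aemeasurable
    _ = _ := by
        refine lintegral_congr fun s => ?_
        rw [← lintegral_const_mul _ (by fun_prop), ← lintegral_add_right_eq_self _ s]
        refine lintegral_congr fun y => ?_
        rw [add_sub_cancel_right, sub_add_eq_sub_sub_swap]
        ring

/-- The exponent of the bound on a triple of frequency bands. -/
def bandExp (n : ℕ) (m₁ m₂ l₁ l₂ : ℝ) (N ℓ j k : ℕ) : ℝ :=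
  kernelExp m₁ m₂ l₁ l₂ N ℓ j k + (min j (min k ℓ) : ℕ) * ((n : ℝ) / 2)

/-- The trilinear estimate on three bands: the square root of the smallest volume supplies the gain
2^{min(j,k,ℓ) n/2}. -/
lemma exists_lintegral_bandForm_sq_le {χ ψ₀ : 𝓢(Rn n, ℂ)} (hχ : IsWindow χ)
    (hψ₀ : IsLPGenerator ψ₀) : ∃ C : ℝ≥0, ∀ (f₁ f₂ : 𝓢(Rn n, ℂ)) (ℓ j k : ℕ) (x : Rn n),
      (∫⁻ τ, ((band n ℓ).indicator 1 τ *
        bandForm χ (lpProj ψ₀ j f₁) (lpProj ψ₀ k f₂) x τ) ^ (2 : ℝ)) ^ (1 / 2 : ℝ) ≤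
      C * 2 ^ ((min j (min k ℓ) : ℕ) * ((n : ℝ) / 2)) *
        ((∫⁻ s, ‖lpProj ψ₀ j f₁ s‖ₑ ^ 2 * massWeight χ (x - s)) ^ (1 / 2 : ℝ) *
          (∫⁻ s, ‖lpProj ψ₀ k f₂ s‖ₑ ^ 2 * massWeight χ (x - s)) ^ (1 / 2 : ℝ)) := by
  obtain ⟨C, hC⟩ := volume_band_le n
  obtain ⟨G, hG⟩ : ∃ G : ℝ≥0, (G : ℝ≥0∞) = ∫⁻ z, decayWeight n z :=
    ⟨_, ENNReal.coe_toNNReal (lintegral_decayWeight_ne_top n)⟩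
  refine ⟨(G ^ 4 * C) ^ (1 / 2 : ℝ), fun f₁ f₂ ℓ j k x => ?_⟩
  have h := lintegral_sq_trilinear_le (measurable_decayWeight n)
    (measurable_enorm_packet χ (lpProj ψ₀ j f₁)) (measurable_enorm_packet χ (lpProj ψ₀ k f₂))
    (measurableSet_band n j) (measurableSet_band n k) (measurableSet_band n ℓ)
    (fun q hq => by rw [packet_lpProj_eq_zero hχ hψ₀ f₁ hq, enorm_zero])
    (fun q hq => by rw [packet_lpProj_eq_zero hχ hψ₀ f₂ hq, enorm_zero]) x
  rw [lintegral_decayWeight_packet, lintegral_decayWeight_packet, ← hG] at h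
  have hvol : min (volume (band n j)) (min (volume (band n k)) (volume (band n ℓ))) ≤
      C * 2 ^ (min j (min k ℓ) * n) := by
    rcases min_choice j (min k ℓ) with h1 | h1 <;> rw [h1]
    · exact (min_le_left _ _).trans (hC j)
    · rcases min_choice k ℓ with h2 | h2 <;> rw [h2]
      · exact (min_le_right _ _).trans ((min_le_left _ _).trans (hC k))
      · exact (min_le_right _ _).trans ((min_le_right _ _).trans (hC ℓ))
  have hsq : ∀ τ, ((band n ℓ).indicator 1 τ *
      bandForm χ (lpProj ψ₀ j f₁) (lpProj ψ₀ k f₂) x τ) ^ (2 : ℝ) = (band n ℓ).indicator 1 τ *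
      (bandForm χ (lpProj ψ₀ j f₁) (lpProj ψ₀ k f₂) x τ) ^ 2 := by
    intro τ
    by_cases hτ : τ ∈ band n ℓ
    · simp [hτ]
    · simp [hτ]
  simp_rw [hsq]
  refine (ENNReal.rpow_le_rpow (h.trans (mul_le_mul_left (mul_le_mul_right hvol _) _))
    (by norm_num)).trans (le_of_eq ?_)
  have h12 : (0 : ℝ) ≤ 1 / 2 := by norm_num
  rw [ENNReal.mul_rpow_of_nonneg _ _ h12]
  congr 1
  · have hcast : (G : ℝ≥0∞) ^ 4 * C = (G ^ 4 * C : ℝ≥0) := by push_cast; rfl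
    rw [← mul_assoc, ENNReal.mul_rpow_of_nonneg _ _ h12, hcast,
      ENNReal.coe_rpow_of_nonneg _ h12, ← ENNReal.rpow_natCast, ← ENNReal.rpow_mul]
    congr 2
    push_cast
    ring
  · exact ENNReal.mul_rpow_of_nonneg _ _ h12

lemma eLpNorm_schwartz_ne_top (g : 𝓢(Rn n, ℂ)) (r : ℝ≥0∞) : eLpNorm g r volume ≠ ⊤ :=
  (g.memLp r volume).eLpNorm_ne_top

/-- The L^p norm is dominated by that of local L² averages, Plancherel turns these into L² norms in
τ, and Minkowski, once in τ and once in x, brings the sum over bands outside. Each term is then the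
trilinear bound followed by the inequality for products of averages. -/
lemma exists_eLpNorm_lpConv_bilinearOp_le
    (hσ : HasSymbolBounds (fun z => symbolWeight m₁ m₂ z.2.1 z.2.2) σ)
    (hσ' : HasSymbolBounds (fun z => symbolWeight l₁ l₂ z.2.1 z.2.2) σ) {ψ₀ : 𝓢(Rn n, ℂ)}
    (hψ₀ : IsLPGenerator ψ₀) (N : ℕ) {p p₁ p₂ p₁' p₂' : ℝ≥0∞} (hp : 1 ≤ p) (hp2 : p ≤ 2)
    (hp₁ : 2 ≤ p₁) (hp₂ : 2 ≤ p₂) (hp₁' : 2 ≤ p₁') (hp₂' : 2 ≤ p₂')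
    (hpp : p⁻¹ ≤ p₁⁻¹ + p₂⁻¹) (hpp' : p⁻¹ ≤ p₁'⁻¹ + p₂'⁻¹) :
    ∃ C : ℝ≥0, ∀ (f₁ f₂ : 𝓢(Rn n, ℂ)) (ℓ : ℕ),
      eLpNorm (lpConv ψ₀ ℓ (bilinearOp σ f₁ f₂)) p volume ≤
        ∑' i : ℕ × ℕ, C * 2 ^ bandExp n m₁ m₂ l₁ l₂ N ℓ i.1 i.2 *
          (if i.2 ≤ i.1 then eLpNorm (lpProj ψ₀ i.1 f₁) p₁ volume *
            eLpNorm (lpProj ψ₀ i.2 f₂) p₂ volume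
          else eLpNorm (lpProj ψ₀ i.1 f₁) p₁' volume *
            eLpNorm (lpProj ψ₀ i.2 f₂) p₂' volume) := by
  obtain ⟨χ, hχ⟩ := exists_isWindow n
  obtain ⟨C₁, hC₁⟩ := exists_enorm_windowed_lpConv_le hσ hσ' hχ hψ₀ N
  obtain ⟨C₂, hC₂⟩ := exists_lintegral_bandForm_sq_le hχ hψ₀
  obtain ⟨V, hV, hV1⟩ := exists_massWeight_le χ
  have hvm := measurable_massWeight χ
  obtain ⟨C₃, hC₃⟩ := exists_lintegral_averages_le hvm hV hV1 hp hp2 hp₁ hp₂ hpp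
  obtain ⟨C₄, hC₄⟩ := exists_lintegral_averages_le hvm hV hV1 hp hp2 hp₁' hp₂' hpp'
  obtain ⟨C₅, hC₅⟩ : ∃ C : ℝ≥0, ∀ u : Rn n → ℂ, Measurable u → eLpNorm u p volume ≤
      C * (∫⁻ x, ((∫⁻ t, ‖u (x - t)‖ₑ ^ 2 * ‖(𝓕⁻ χ : 𝓢(Rn n, ℂ)) t‖ₑ ^ 2) ^ (1 / 2 : ℝ)) ^
        p.toReal) ^ (1 / p.toReal) := by
    have hw0 : (𝓕⁻ χ : 𝓢(Rn n, ℂ)) 0 ≠ 0 := by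
      rw [SchwartzMap.fourierInv_coe]; exact hχ.fourierInv_zero_ne_zero
    obtain ⟨w, hw⟩ : ∃ w : 𝓢(Rn n, ℂ), w = 𝓕⁻ χ := ⟨_, rfl⟩
    rw [← hw] at hw0 ⊢
    have hwc := w.continuous
    have hpos : (0 : ℝ) < ‖w 0‖ := norm_pos_iff.2 hw0
    have hev : ∀ᶠ t in nhds (0 : Rn n), ‖w 0‖ / 2 < ‖w t‖ :=
      hwc.norm.continuousAt.eventually_const_lt (by linarith)
    obtain ⟨δ, hδ, hball⟩ := Metric.eventually_nhds_iff_ball.1 hev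
    refine exists_lintegral_le_local (w := fun t => ‖w t‖ₑ ^ 2) (by fun_prop)
      (c := (‖w 0‖₊ / 2) ^ 2) (by simpa using hw0) hδ (fun t ht => ?_) hp hp2
    have := hball t ht
    rw [enorm_eq_nnnorm, ← ENNReal.coe_pow]
    refine ENNReal.coe_le_coe.2 (pow_le_pow_left₀ zero_le ?_ 2)
    exact_mod_cast this.le
  have hpt : p ≠ ⊤ := ne_top_of_le_ne_top ENNReal.ofNat_ne_top hp2
  have hr1 : 1 ≤ p.toReal := by
    simpa using (ENNReal.toReal_le_toReal ENNReal.one_ne_top hpt).2 hp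
  have hr0 : 0 < p.toReal := by linarith
  refine ⟨C₅ * C₁ * C₂ * max C₃ C₄, fun f₁ f₂ ℓ => ?_⟩
  obtain ⟨B, hB⟩ := exists_norm_bilinearOp_le hσ f₁ f₂
  have huc := continuous_lpConv ψ₀ ℓ (continuous_bilinearOp hσ f₁ f₂) hB
  obtain ⟨B', hB'⟩ : ∃ B' : ℝ, ∀ x, ‖lpConv ψ₀ ℓ (bilinearOp σ f₁ f₂) x‖ ≤ B' :=
    ⟨_, norm_lpConv_le ψ₀ ℓ hB⟩
  obtain ⟨u, hu⟩ : ∃ u, u = lpConv ψ₀ ℓ (bilinearOp σ f₁ f₂) := ⟨_, rfl⟩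
  obtain ⟨A, hA⟩ : ∃ A : 𝓢(Rn n, ℂ) → Rn n → ℝ≥0∞, A = fun g x =>
      (∫⁻ s, ‖g s‖ₑ ^ 2 * massWeight χ (x - s)) ^ (1 / 2 : ℝ) := ⟨_, rfl⟩
  have hAm : ∀ g, Measurable (A g) := by
    intro g
    have hg : Measurable (g : Rn n → ℂ) := g.continuous.measurable
    have hvm := measurable_massWeight χ
    have : Measurable fun q : Rn n × Rn n => ‖g q.2‖ₑ ^ 2 * massWeight χ (q.1 - q.2) := by
      fun_prop
    rw [hA]
    exact this.lintegral_prod_right'.pow_const _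
  have hmF : ∀ i : ℕ × ℕ, Measurable fun x =>
      C₁ * 2 ^ kernelExp m₁ m₂ l₁ l₂ N ℓ i.1 i.2 *
      (C₂ * 2 ^ ((min i.1 (min i.2 ℓ) : ℕ) * ((n : ℝ) / 2)) *
        (A (lpProj ψ₀ i.1 f₁) x * A (lpProj ψ₀ i.2 f₂) x)) := by
    intro i
    have h1 := hAm (lpProj ψ₀ i.1 f₁)
    have h2 := hAm (lpProj ψ₀ i.2 f₂)
    fun_prop
  have hlocal : ∀ x, (∫⁻ t, ‖u (x - t)‖ₑ ^ 2 * ‖(𝓕⁻ χ : 𝓢(Rn n, ℂ)) t‖ₑ ^ 2) ^ (1 / 2 : ℝ) ≤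
      ∑' i : ℕ × ℕ, C₁ * 2 ^ kernelExp m₁ m₂ l₁ l₂ N ℓ i.1 i.2 *
      (C₂ * 2 ^ ((min i.1 (min i.2 ℓ) : ℕ) * ((n : ℝ) / 2)) *
        (A (lpProj ψ₀ i.1 f₁) x * A (lpProj ψ₀ i.2 f₂) x)) := by
    intro x
    have hmI : ∀ i : ℕ × ℕ, Measurable fun τ => (band n ℓ).indicator 1 τ *
        bandForm χ (lpProj ψ₀ i.1 f₁) (lpProj ψ₀ i.2 f₂) x τ := fun i =>
      (measurable_one.indicator (measurableSet_band n ℓ)).mul (measurable_bandForm χ _ _ x)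
    rw [hu, ← lintegral_enorm_windowed_sq (𝓕⁻ χ) huc hB' x]
    simp_rw [← ENNReal.rpow_two]
    refine (ENNReal.rpow_le_rpow (lintegral_mono fun τ => ENNReal.rpow_le_rpow
      (hC₁ f₁ f₂ ℓ x τ) two_pos.le) (by norm_num)).trans ?_
    refine (lintegral_tsum_rpow_le (fun i => (hmI i).const_mul _) one_le_two).trans ?_
    refine ENNReal.tsum_le_tsum fun i => ?_
    simp_rw [ENNReal.mul_rpow_of_nonneg (_ * _) _ two_pos.le]
    rw [lintegral_const_mul _ ((hmI i).pow_const _), ENNReal.mul_rpow_of_nonneg _ _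
      (by norm_num : (0 : ℝ) ≤ 1 / 2), ← ENNReal.rpow_mul, mul_one_div_cancel two_ne_zero,
      ENNReal.rpow_one, hA]
    exact mul_le_mul_right (hC₂ f₁ f₂ ℓ i.1 i.2 x) _
  rw [← hu]
  refine (hC₅ u (hu ▸ huc.measurable)).trans ?_
  refine (mul_le_mul_right (ENNReal.rpow_le_rpow (lintegral_mono fun x => ENNReal.rpow_le_rpow
      (hlocal x) hr0.le) (by positivity)) _).trans ?_
  refine (mul_le_mul_right (lintegral_tsum_rpow_le hmF hr1) _).trans ?_
  rw [← ENNReal.tsum_mul_left]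
  refine ENNReal.tsum_le_tsum fun i => ?_
  have hprod : (∫⁻ x, (A (lpProj ψ₀ i.1 f₁) x * A (lpProj ψ₀ i.2 f₂) x) ^ p.toReal) ^
      (1 / p.toReal) ≤ (max C₃ C₄ : ℝ≥0) * (if i.2 ≤ i.1 then eLpNorm (lpProj ψ₀ i.1 f₁) p₁ volume *
            eLpNorm (lpProj ψ₀ i.2 f₂) p₂ volume
          else eLpNorm (lpProj ψ₀ i.1 f₁) p₁' volume *
            eLpNorm (lpProj ψ₀ i.2 f₂) p₂' volume) := by
    have hms : ∀ g : 𝓢(Rn n, ℂ), Measurable g := fun g => g.continuous.measurable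
    rw [hA]
    split_ifs
    · refine (hC₃ _ _ (hms _) (hms _) (eLpNorm_schwartz_ne_top _ _)
        (eLpNorm_schwartz_ne_top _ _)).trans (mul_le_mul_left ?_ _)
      exact ENNReal.coe_le_coe.2 (le_max_left _ _)
    · refine (hC₄ _ _ (hms _) (hms _) (eLpNorm_schwartz_ne_top _ _)
        (eLpNorm_schwartz_ne_top _ _)).trans (mul_le_mul_left ?_ _)
      exact ENNReal.coe_le_coe.2 (le_max_right _ _)
  obtain ⟨c, hc⟩ : ∃ c : ℝ≥0∞, c = C₁ * 2 ^ kernelExp m₁ m₂ l₁ l₂ N ℓ i.1 i.2 *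
      (C₂ * 2 ^ ((min i.1 (min i.2 ℓ) : ℕ) * ((n : ℝ) / 2))) := ⟨_, rfl⟩
  have hAA : Measurable fun x => (A (lpProj ψ₀ i.1 f₁) x * A (lpProj ψ₀ i.2 f₂) x) ^ p.toReal :=
    ((hAm (lpProj ψ₀ i.1 f₁)).mul (hAm (lpProj ψ₀ i.2 f₂))).pow_const _
  have hpull : (∫⁻ x, (C₁ * 2 ^ kernelExp m₁ m₂ l₁ l₂ N ℓ i.1 i.2 *
      (C₂ * 2 ^ ((min i.1 (min i.2 ℓ) : ℕ) * ((n : ℝ) / 2)) *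
        (A (lpProj ψ₀ i.1 f₁) x * A (lpProj ψ₀ i.2 f₂) x))) ^ p.toReal) ^ (1 / p.toReal) =
      c * (∫⁻ x, (A (lpProj ψ₀ i.1 f₁) x * A (lpProj ψ₀ i.2 f₂) x) ^ p.toReal) ^
      (1 / p.toReal) := by
    have hx : ∀ x, C₁ * 2 ^ kernelExp m₁ m₂ l₁ l₂ N ℓ i.1 i.2 *
        (C₂ * 2 ^ ((min i.1 (min i.2 ℓ) : ℕ) * ((n : ℝ) / 2)) *
          (A (lpProj ψ₀ i.1 f₁) x * A (lpProj ψ₀ i.2 f₂) x)) =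
        c * (A (lpProj ψ₀ i.1 f₁) x * A (lpProj ψ₀ i.2 f₂) x) := fun x => by
      rw [hc, ← mul_assoc _ _ (A (lpProj ψ₀ i.1 f₁) x * A (lpProj ψ₀ i.2 f₂) x)]
    simp_rw [hx, ENNReal.mul_rpow_of_nonneg c _ hr0.le]
    rw [lintegral_const_mul _ hAA, ENNReal.mul_rpow_of_nonneg _ _
      (by positivity : (0 : ℝ) ≤ 1 / p.toReal), ← ENNReal.rpow_mul,
      mul_one_div_cancel hr0.ne', ENNReal.rpow_one]
  rw [hpull]
  refine (mul_le_mul_right (mul_le_mul_right hprod _) _).trans (le_of_eq ?_)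
  rw [hc, bandExp, ENNReal.rpow_add _ _ two_ne_zero ENNReal.ofNat_ne_top]
  push_cast
  ring

end BandBound

/-! ### Sequence spaces -/

section Sequences

/-- The `ℓ^q` (quasi-)norm of a sequence. -/
def lqNorm (q : ℝ≥0∞) (a : ℕ → ℝ≥0∞) : ℝ≥0∞ :=
  if q = ⊤ then ⨆ ℓ, a ℓ else (∑' ℓ, a ℓ ^ q.toReal) ^ (1 / q.toReal)

lemma lqNorm_mono (q : ℝ≥0∞) {a b : ℕ → ℝ≥0∞} (h : ∀ ℓ, a ℓ ≤ b ℓ) : lqNorm q a ≤ lqNorm q b := by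
  unfold lqNorm
  split_ifs
  · exact iSup_mono h
  · gcongr with ℓ
    exact h ℓ

lemma lqNorm_const_mul {q : ℝ≥0∞} (hq : 0 < q) (c : ℝ≥0∞) (a : ℕ → ℝ≥0∞) :
    lqNorm q (fun ℓ => c * a ℓ) = c * lqNorm q a := by
  unfold lqNorm
  split_ifs with h
  · rw [ENNReal.mul_iSup]
  · have hr : 0 < q.toReal := ENNReal.toReal_pos hq.ne' h
    simp_rw [ENNReal.mul_rpow_of_nonneg _ _ hr.le]
    rw [ENNReal.tsum_mul_left, ENNReal.mul_rpow_of_nonneg _ _ (by positivity),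
      ← ENNReal.rpow_mul, mul_one_div_cancel hr.ne', ENNReal.rpow_one]

lemma rpow_add_le {r : ℝ} (hr : 0 ≤ r) (a b : ℝ≥0∞) : (a + b) ^ r ≤ 2 ^ r * (a ^ r + b ^ r) := by
  rcases le_total a b with h | h
  · calc (a + b) ^ r ≤ (2 * b) ^ r := by
          rw [two_mul]; gcongr
      _ = 2 ^ r * b ^ r := ENNReal.mul_rpow_of_nonneg _ _ hr
      _ ≤ _ := by gcongr; exact le_add_self
  · calc (a + b) ^ r ≤ (2 * a) ^ r := by
          rw [two_mul]; gcongr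
      _ = 2 ^ r * a ^ r := ENNReal.mul_rpow_of_nonneg _ _ hr
      _ ≤ _ := by gcongr; exact le_self_add

lemma exists_lqNorm_add_le {q : ℝ≥0∞} (hq : 0 < q) : ∃ C : ℝ≥0, ∀ a b : ℕ → ℝ≥0∞,
    lqNorm q (fun ℓ => a ℓ + b ℓ) ≤ C * (lqNorm q a + lqNorm q b) := by
  unfold lqNorm
  split_ifs with h
  · refine ⟨1, fun a b => ?_⟩
    rw [ENNReal.coe_one, one_mul]
    exact iSup_le fun ℓ => add_le_add (le_iSup a ℓ) (le_iSup b ℓ)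
  · have hr : 0 < q.toReal := ENNReal.toReal_pos hq.ne' h
    have ht : (2 : ℝ≥0∞) * 2 ^ (1 / q.toReal) ≠ ⊤ := ENNReal.mul_ne_top ENNReal.ofNat_ne_top
      (ENNReal.rpow_ne_top_of_nonneg (by positivity) ENNReal.ofNat_ne_top)
    refine ⟨((2 : ℝ≥0∞) * 2 ^ (1 / q.toReal)).toNNReal, fun a b => ?_⟩
    rw [ENNReal.coe_toNNReal ht]
    calc (∑' ℓ, (a ℓ + b ℓ) ^ q.toReal) ^ (1 / q.toReal)
        ≤ (2 ^ q.toReal * (∑' ℓ, a ℓ ^ q.toReal + ∑' ℓ, b ℓ ^ q.toReal)) ^ (1 / q.toReal) := by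
          gcongr
          rw [← ENNReal.tsum_add, ← ENNReal.tsum_mul_left]
          exact ENNReal.tsum_le_tsum fun ℓ => rpow_add_le hr.le _ _
      _ = 2 * (∑' ℓ, a ℓ ^ q.toReal + ∑' ℓ, b ℓ ^ q.toReal) ^ (1 / q.toReal) := by
          rw [ENNReal.mul_rpow_of_nonneg _ _ (by positivity), ← ENNReal.rpow_mul,
            mul_one_div_cancel hr.ne', ENNReal.rpow_one]
      _ ≤ _ := by
          rw [mul_assoc]
          gcongr
          exact rpow_add_le (by positivity) _ _

/-- At infinite exponents one factor is bounded by its supremum. Otherwise this is Hölder for the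
counting measure, which permits exponents below 1. -/
lemma lqNorm_mul_le {q q₁ q₂ : ℝ≥0∞} (hq : 0 < q) (hq₁ : 0 < q₁) (hq₂ : 0 < q₂)
    (hqq : q⁻¹ = q₁⁻¹ + q₂⁻¹) (a b : ℕ → ℝ≥0∞) :
    lqNorm q (fun ℓ => a ℓ * b ℓ) ≤ lqNorm q₁ a * lqNorm q₂ b := by
  by_cases h₁ : q₁ = ⊤
  · rw [h₁, ENNReal.inv_top, zero_add, inv_inj] at hqq
    rw [hqq, h₁, ← lqNorm_const_mul hq₂]
    refine lqNorm_mono _ fun ℓ => ?_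
    gcongr
    rw [lqNorm, if_pos rfl]
    exact le_iSup a ℓ
  by_cases h₂ : q₂ = ⊤
  · rw [h₂, ENNReal.inv_top, add_zero, inv_inj] at hqq
    rw [hqq, h₂, mul_comm, ← lqNorm_const_mul hq₁]
    refine lqNorm_mono _ fun ℓ => ?_
    rw [mul_comm]
    gcongr
    rw [lqNorm, if_pos rfl]
    exact le_iSup b ℓ
  have h : q ≠ ⊤ := by
    rintro rfl
    rw [ENNReal.inv_top] at hqq
    have := (add_eq_zero.1 hqq.symm).1
    exact h₁ (ENNReal.inv_eq_zero.1 this)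
  have hr : 0 < q.toReal := ENNReal.toReal_pos hq.ne' h
  have hr₁ : 0 < q₁.toReal := ENNReal.toReal_pos hq₁.ne' h₁
  have hr₂ : 0 < q₂.toReal := ENNReal.toReal_pos hq₂.ne' h₂
  have hsum : 1 / q.toReal = 1 / q₁.toReal + 1 / q₂.toReal := by
    have := congrArg ENNReal.toReal hqq
    rw [ENNReal.toReal_add (ENNReal.inv_ne_top.2 hq₁.ne') (ENNReal.inv_ne_top.2 hq₂.ne')] at this
    simpa [one_div] using this
  have hlt : q.toReal < q₁.toReal := by
    have : 1 / q₁.toReal < 1 / q.toReal := by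
      rw [hsum]; linarith [one_div_pos.2 hr₂]
    exact (one_div_lt_one_div hr₁ hr).1 this
  have := ENNReal.lintegral_Lp_mul_le_Lq_mul_Lr hr hlt hsum Measure.count
    (measurable_of_countable a).aemeasurable (measurable_of_countable b).aemeasurable
  simp only [lintegral_count, Pi.mul_apply] at this
  rw [lqNorm, lqNorm, lqNorm, if_neg h, if_neg h₁, if_neg h₂]
  exact this

/-! ### Exponential kernels on sequences. -/

/-- The kernel `2^{-ε|i-j|}`. -/
def expKernel (ε : ℝ) (i j : ℕ) : ℝ≥0∞ := 2 ^ (-(ε * |(i : ℝ) - j|))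

lemma expKernel_comm (ε : ℝ) (i j : ℕ) : expKernel ε i j = expKernel ε j i := by
  unfold expKernel; rw [abs_sub_comm]

lemma expKernel_rpow (ε r : ℝ) (i j : ℕ) : expKernel ε i j ^ r = expKernel (ε * r) i j := by
  unfold expKernel; rw [← ENNReal.rpow_mul]; congr 1; ring

lemma expKernel_add (ε δ : ℝ) (i j : ℕ) :
    expKernel (ε + δ) i j = expKernel ε i j * expKernel δ i j := by
  unfold expKernel
  rw [← ENNReal.rpow_add _ _ two_ne_zero ENNReal.ofNat_ne_top]; congr 1; ring

lemma expKernel_eq_pow (ε : ℝ) (i j d : ℕ) (h : j + d = i ∨ i + d = j) :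
    expKernel ε i j = ((2 : ℝ≥0∞) ^ (-ε)) ^ d := by
  unfold expKernel
  rw [← ENNReal.rpow_natCast, ← ENNReal.rpow_mul]
  congr 1
  have hd : |(i : ℝ) - j| = d := by
    rcases h with h | h
    · rw [← h]; push_cast; rw [add_sub_cancel_left, Nat.abs_cast]
    · rw [← h]; push_cast; rw [sub_add_cancel_left, abs_neg, Nat.abs_cast]
  rw [hd]; ring

lemma tsum_expKernel_le {ε : ℝ} (hε : 0 < ε) (i : ℕ) : ∑' j, expKernel ε i j ≤ 
  ∑' d : ℕ, ((2 : ℝ≥0∞) ^ (-ε)) ^ d + ∑' d : ℕ, ((2 : ℝ≥0∞) ^ (-ε)) ^ d := by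
  have hlt : (2 : ℝ≥0∞) ^ (-ε) < 1 :=
    ENNReal.rpow_lt_one_of_one_lt_of_neg (by norm_num) (by linarith)
  rw [← Summable.sum_add_tsum_nat_add' (f := fun j => expKernel ε i j) (k := i) ENNReal.summable]
  refine add_le_add ?_ (le_of_eq (tsum_congr fun d =>
    expKernel_eq_pow ε i (d + i) d (Or.inr (add_comm _ _))))
  calc ∑ j ∈ Finset.range i, expKernel ε i j
      = ∑ d ∈ Finset.range i, expKernel ε i (i - 1 - d) :=
        (Finset.sum_range_reflect (fun j => expKernel ε i j) i).symm
    _ ≤ ∑ d ∈ Finset.range i, ((2 : ℝ≥0∞) ^ (-ε)) ^ d := by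
        refine Finset.sum_le_sum fun d hd => ?_
        rw [Finset.mem_range] at hd
        rw [expKernel_eq_pow ε i (i - 1 - d) (d + 1) (Or.inl (by omega))]
        exact pow_le_pow_of_le_one zero_le hlt.le (Nat.le_succ d)
    _ ≤ _ := ENNReal.sum_le_tsum (Finset.range i)

lemma exists_tsum_expKernel_le {ε : ℝ} (hε : 0 < ε) :
    ∃ C : ℝ≥0, ∀ i, ∑' j, expKernel ε i j ≤ C := by
  have hlt : (2 : ℝ≥0∞) ^ (-ε) < 1 :=
    ENNReal.rpow_lt_one_of_one_lt_of_neg (by norm_num) (by linarith)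
  have hgeom : ∑' d : ℕ, ((2 : ℝ≥0∞) ^ (-ε)) ^ d ≠ ⊤ := by
    rw [ENNReal.tsum_geometric]
    exact ENNReal.inv_ne_top.2 (tsub_pos_of_lt hlt).ne'
  refine ⟨_, fun i => (tsum_expKernel_le hε i).trans
    (ENNReal.coe_toNNReal (ENNReal.add_ne_top.2 ⟨hgeom, hgeom⟩)).ge⟩

/-- Discrete convolution with an exponentially decaying kernel. -/
def expConv (ε : ℝ) (a : ℕ → ℝ≥0∞) (i : ℕ) : ℝ≥0∞ := ∑' j, expKernel ε i j * a j

lemma exists_lqNorm_expConv_le {ε : ℝ} (hε : 0 < ε) {q : ℝ≥0∞} (hq : 0 < q) :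
    ∃ C : ℝ≥0, ∀ a : ℕ → ℝ≥0∞, lqNorm q (expConv ε a) ≤ C * lqNorm q a := by
  unfold lqNorm
  split_ifs with h
  · obtain ⟨C, hC⟩ := exists_tsum_expKernel_le hε
    refine ⟨C, fun a => iSup_le fun i => ?_⟩
    calc expConv ε a i ≤ ∑' j, expKernel ε i j * ⨆ ℓ, a ℓ := by
          unfold expConv
          gcongr with j
          exact le_iSup a j
      _ ≤ _ := by rw [ENNReal.tsum_mul_right]; gcongr; exact hC i
  · have hr : 0 < q.toReal := ENNReal.toReal_pos hq.ne' h
    obtain ⟨C, hC⟩ := exists_tsum_expKernel_le (half_pos hε)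
    obtain ⟨D, hD⟩ := exists_tsum_expKernel_le (mul_pos (half_pos hε) hr)
    refine ⟨C * D ^ (1 / q.toReal), fun a => ?_⟩
    -- A form of Young's inequality that also works for q < 1. Half of the decay makes the sum
    -- converge against a supremum; the q-th power of the supremum is at most the sum of q-th
    -- powers, and the other half makes that summable.
    have h1 : ∀ i, expConv ε a i ^ q.toReal ≤
        C ^ q.toReal * ∑' j, expKernel (ε / 2 * q.toReal) i j * a j ^ q.toReal := by
      intro i
      have hsup : expConv ε a i ≤ C * ⨆ j, expKernel (ε / 2) i j * a j := by
        calc expConv ε a i ≤ ∑' j, expKernel (ε / 2) i j * ⨆ j, expKernel (ε / 2) i j * a j := by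
              unfold expConv
              refine ENNReal.tsum_le_tsum fun j => ?_
              rw [← add_halves ε, expKernel_add, add_halves, mul_assoc]
              gcongr
              exact le_iSup (fun j => expKernel (ε / 2) i j * a j) j
          _ ≤ _ := by rw [ENNReal.tsum_mul_right]; gcongr; exact hC i
      calc expConv ε a i ^ q.toReal ≤ (C * ⨆ j, expKernel (ε / 2) i j * a j) ^ q.toReal := by
            gcongr
        _ = C ^ q.toReal * ⨆ j, (expKernel (ε / 2) i j * a j) ^ q.toReal := by
            rw [ENNReal.mul_rpow_of_nonneg _ _ hr.le]
            congr 1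
            exact (ENNReal.orderIsoRpow _ hr).map_iSup _
        _ ≤ _ := by
            gcongr
            refine iSup_le fun j => ?_
            rw [ENNReal.mul_rpow_of_nonneg _ _ hr.le, expKernel_rpow]
            exact ENNReal.le_tsum (f := fun j =>
              expKernel (ε / 2 * q.toReal) i j * a j ^ q.toReal) j
    calc (∑' i, expConv ε a i ^ q.toReal) ^ (1 / q.toReal)
        ≤ (C ^ q.toReal * (D * ∑' j, a j ^ q.toReal)) ^ (1 / q.toReal) := by
          gcongr
          refine (ENNReal.tsum_le_tsum h1).trans ?_
          rw [ENNReal.tsum_mul_left, ENNReal.tsum_comm, ← ENNReal.tsum_mul_left (a := (D : ℝ≥0∞))]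
          refine mul_le_mul_right (ENNReal.tsum_le_tsum fun j => ?_) _
          simp_rw [expKernel_comm _ _ j]
          rw [ENNReal.tsum_mul_right]
          exact mul_le_mul_left (hD j) _
      _ = _ := by
          have h2 : 0 ≤ 1 / q.toReal := by positivity
          rw [ENNReal.mul_rpow_of_nonneg _ _ h2, ENNReal.mul_rpow_of_nonneg _ _ h2,
            ← ENNReal.rpow_mul, mul_one_div_cancel hr.ne', ENNReal.rpow_one, ENNReal.coe_mul,
            ENNReal.coe_rpow_of_nonneg _ h2, mul_assoc]

/-- The inner convolution sums over the lower input frequency and the outer one spreads the product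
over the output frequencies. -/
lemma exists_lqNorm_paraproduct_le {ε : ℝ} (hε : 0 < ε) {q q₁ q₂ : ℝ≥0∞} (hq : 0 < q)
    (hq₁ : 0 < q₁) (hq₂ : 0 < q₂) (hqq : q⁻¹ = q₁⁻¹ + q₂⁻¹) :
    ∃ C : ℝ≥0, ∀ a b : ℕ → ℝ≥0∞,
      lqNorm q (expConv ε fun j => a j * expConv ε b j) ≤ C * (lqNorm q₁ a * lqNorm q₂ b) := by
  obtain ⟨C, hC⟩ := exists_lqNorm_expConv_le hε hq
  obtain ⟨D, hD⟩ := exists_lqNorm_expConv_le hε hq₂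
  refine ⟨C * D, fun a b => (hC _).trans ?_⟩
  calc _ ≤ C * (lqNorm q₁ a * (D * lqNorm q₂ b)) := by
        gcongr
        refine (lqNorm_mul_le hq hq₁ hq₂ hqq _ _).trans ?_
        gcongr
        exact hD b
    _ = _ := by push_cast; ring

/-! ### Exponents on triples of bands. -/

lemma gap_comm (ℓ j k : ℕ) : gap ℓ j k = gap ℓ k j := by
  unfold gap; rw [max_comm j k, max_comm (j - max ℓ k)]

/-- Here `k ≤ j`, and the smallest index is `k` or `ℓ`. If it is `k`, the slack in the condition on
s₂ gives decay in j - k. If it is `ℓ`, the slack in s > -n/2 gives decay in k - ℓ. The distance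
between the two largest indices is paid for by `N`; the three conditions on `N` belong to j ≤ ℓ, k ≤
ℓ < j and ℓ < k. -/
lemma bandExp_le {n N : ℕ} {s s₁ s₂ a₁ a₂ ε : ℝ} (hs : s = s₁ + s₂) (ha : a₁ + a₂ = -(n : ℝ) / 2)
    (h₁ : ε ≤ a₂ + (n : ℝ) / 2 - s₂) (h₂ : ε ≤ s + (n : ℝ) / 2) (hN₁ : s + ε ≤ N)
    (hN₂ : ε - s ≤ N) (hN₃ : a₁ - s₁ + 2 * ε ≤ N) {ℓ j k : ℕ} (hkj : k ≤ j) :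
    ℓ * s + (j * a₁ + k * a₂ - N * gap ℓ j k + (min j (min k ℓ) : ℕ) * ((n : ℝ) / 2)) ≤
      j * s₁ + k * s₂ - ε * |(ℓ : ℝ) - j| - ε * |(j : ℝ) - k| := by
  have hs₁ : s₁ = s - s₂ := by linarith
  have ha₁ : a₁ = -(n : ℝ) / 2 - a₂ := by linarith
  rcases le_or_gt j ℓ with h | h
  · obtain ⟨u, rfl⟩ := Nat.exists_eq_add_of_le hkj
    obtain ⟨v, rfl⟩ := Nat.exists_eq_add_of_le h
    have hg : gap (k + u + v) (k + u) k = v := by unfold gap; omega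
    have hm : min (k + u) (min k (k + u + v)) = k := by omega
    have e1 : |((k + u + v : ℕ) : ℝ) - (k + u : ℕ)| = v := by
      push_cast; rw [add_sub_cancel_left, Nat.abs_cast]
    have e2 : |((k + u : ℕ) : ℝ) - k| = u := by push_cast; rw [add_sub_cancel_left, Nat.abs_cast]
    rw [hg, hm, e1, e2, hs₁, ha₁]
    push_cast
    have i1 := mul_le_mul_of_nonneg_left h₁ (Nat.cast_nonneg (α := ℝ) u)
    have i2 := mul_le_mul_of_nonneg_left hN₁ (Nat.cast_nonneg (α := ℝ) v)
    linarith
  · rcases le_or_gt k ℓ with h' | h'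
    · obtain ⟨u, rfl⟩ := Nat.exists_eq_add_of_le h'
      obtain ⟨v, rfl⟩ := Nat.exists_eq_add_of_le h.le
      have hg : gap (k + u) (k + u + v) k = v := by unfold gap; omega
      have hm : min (k + u + v) (min k (k + u)) = k := by omega
      have e1 : |((k + u : ℕ) : ℝ) - (k + u + v : ℕ)| = v := by
        push_cast; rw [sub_add_cancel_left, abs_neg, Nat.abs_cast]
      have e2 : |((k + u + v : ℕ) : ℝ) - k| = u + v := by
        push_cast
        rw [add_assoc, add_sub_cancel_left, abs_of_nonneg (by positivity)]
      rw [hg, hm, e1, e2, hs₁, ha₁]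
      push_cast
      have i1 := mul_le_mul_of_nonneg_left h₁ (Nat.cast_nonneg (α := ℝ) u)
      have i1' := mul_le_mul_of_nonneg_left h₁ (Nat.cast_nonneg (α := ℝ) v)
      have i2 := mul_le_mul_of_nonneg_left hN₂ (Nat.cast_nonneg (α := ℝ) v)
      linarith
    · obtain ⟨u, rfl⟩ := Nat.exists_eq_add_of_le h'.le
      obtain ⟨v, rfl⟩ := Nat.exists_eq_add_of_le hkj
      have hg : gap ℓ (ℓ + u + v) (ℓ + u) = v := by unfold gap; omega
      have hm : min (ℓ + u + v) (min (ℓ + u) ℓ) = ℓ := by omega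
      have e1 : |(ℓ : ℝ) - (ℓ + u + v : ℕ)| = u + v := by
        push_cast
        rw [add_assoc, sub_add_cancel_left, abs_neg, abs_of_nonneg (by positivity)]
      have e2 : |((ℓ + u + v : ℕ) : ℝ) - (ℓ + u : ℕ)| = v := by
        push_cast; rw [add_sub_cancel_left, Nat.abs_cast]
      rw [hg, hm, e1, e2]
      have hs₂ : s₂ = s - s₁ := by linarith
      have ha₂ : a₂ = -(n : ℝ) / 2 - a₁ := by linarith
      rw [hs₂, ha₂]
      push_cast
      have i1 := mul_le_mul_of_nonneg_left h₂ (Nat.cast_nonneg (α := ℝ) u)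
      have i2 := mul_le_mul_of_nonneg_left hN₃ (Nat.cast_nonneg (α := ℝ) v)
      linarith

/-- Summation of the bounds on all triples of frequency bands. -/
lemma exists_lqNorm_bands_le {n : ℕ} {s s₁ s₂ s₁' s₂' m₁ m₂ l₁ l₂ : ℝ} (hs : s = s₁ + s₂)
    (hs' : s = s₁' + s₂') (hm : m₁ + m₂ = -(n : ℝ) / 2) (hl : l₁ + l₂ = -(n : ℝ) / 2)
    (h₂ : s₂ < m₂ + (n : ℝ) / 2) (h₁' : s₁' < l₁ + (n : ℝ) / 2) (hn : -(n : ℝ) / 2 < s)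
    {q q₁ q₂ q₁' q₂' : ℝ≥0∞} (hq : 0 < q) (hq₁ : 0 < q₁) (hq₂ : 0 < q₂) (hq₁' : 0 < q₁')
    (hq₂' : 0 < q₂') (hqq : q⁻¹ = q₁⁻¹ + q₂⁻¹) (hqq' : q⁻¹ = q₁'⁻¹ + q₂'⁻¹) :
    ∃ (N : ℕ) (C : ℝ≥0), ∀ a b a' b' : ℕ → ℝ≥0∞,
      lqNorm q (fun ℓ => 2 ^ (ℓ * s) * ∑' i : ℕ × ℕ, 2 ^ bandExp n m₁ m₂ l₁ l₂ N ℓ i.1 i.2 *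
        (if i.2 ≤ i.1 then a i.1 * b i.2 else a' i.1 * b' i.2)) ≤
      C * (lqNorm q₁ (fun j => 2 ^ (j * s₁) * a j) * lqNorm q₂ (fun j => 2 ^ (j * s₂) * b j) +
        lqNorm q₁' (fun j => 2 ^ (j * s₁') * a' j) *
          lqNorm q₂' (fun j => 2 ^ (j * s₂') * b' j)) := by
  -- The smallest slack in the three strict inequalities. `N` is chosen afterwards, which is allowed
  -- because the kernel decays to any order.
  obtain ⟨ε, hε, hε1, hε2, hε3⟩ : ∃ ε : ℝ, 0 < ε ∧ ε ≤ m₂ + (n : ℝ) / 2 - s₂ ∧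
      ε ≤ l₁ + (n : ℝ) / 2 - s₁' ∧ ε ≤ s + (n : ℝ) / 2 :=
    ⟨min (m₂ + (n : ℝ) / 2 - s₂) (min (l₁ + (n : ℝ) / 2 - s₁') (s + (n : ℝ) / 2)),
      lt_min (by linarith) (lt_min (by linarith) (by linarith)), min_le_left _ _,
      (min_le_right _ _).trans (min_le_left _ _), (min_le_right _ _).trans (min_le_right _ _)⟩
  obtain ⟨N, hN⟩ := exists_nat_ge (max (max (s + ε) (ε - s)) (max (m₁ - s₁ + 2 * ε)
    (l₂ - s₂' + 2 * ε)))
  simp only [max_le_iff] at hN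
  obtain ⟨⟨hN1, hN2⟩, hN3, hN4⟩ := hN
  obtain ⟨C₁, hC₁⟩ := exists_lqNorm_paraproduct_le hε hq hq₁ hq₂ hqq
  -- For j < k the second input carries the higher frequency, so the two inputs exchange roles.
  obtain ⟨C₂, hC₂⟩ := exists_lqNorm_paraproduct_le hε hq hq₂' hq₁' (hqq'.trans (add_comm _ _))
  obtain ⟨C₃, hC₃⟩ := exists_lqNorm_add_le hq
  refine ⟨N, C₃ * max C₁ C₂, fun a b a' b' => ?_⟩
  have hadd : ∀ x y : ℝ, (2 : ℝ≥0∞) ^ (x + y) = 2 ^ x * 2 ^ y := fun x y =>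
    ENNReal.rpow_add _ _ two_ne_zero ENNReal.ofNat_ne_top
  have hpt : ∀ ℓ : ℕ, (2 : ℝ≥0∞) ^ (ℓ * s) *
      ∑' i : ℕ × ℕ, 2 ^ bandExp n m₁ m₂ l₁ l₂ N ℓ i.1 i.2 *
        (if i.2 ≤ i.1 then a i.1 * b i.2 else a' i.1 * b' i.2) ≤
      expConv ε (fun j => 2 ^ (j * s₁) * a j * expConv ε (fun k => 2 ^ (k * s₂) * b k) j) ℓ +
      expConv ε (fun k => 2 ^ (k * s₂') * b' k *
        expConv ε (fun j => 2 ^ (j * s₁') * a' j) k) ℓ := by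
    intro ℓ
    have e1 : expConv ε (fun j => 2 ^ (j * s₁) * a j *
        expConv ε (fun k => 2 ^ (k * s₂) * b k) j) ℓ = ∑' i : ℕ × ℕ, expKernel ε ℓ i.1 *
        (2 ^ (i.1 * s₁) * a i.1 * (expKernel ε i.1 i.2 * (2 ^ (i.2 * s₂) * b i.2))) := by
      rw [ENNReal.tsum_prod']
      simp only [expConv, ENNReal.tsum_mul_left]
    have e2 : expConv ε (fun k => 2 ^ (k * s₂') * b' k *
        expConv ε (fun j => 2 ^ (j * s₁') * a' j) k) ℓ = ∑' i : ℕ × ℕ, expKernel ε ℓ i.2 *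
        (2 ^ (i.2 * s₂') * b' i.2 * (expKernel ε i.2 i.1 * (2 ^ (i.1 * s₁') * a' i.1))) := by
      rw [ENNReal.tsum_prod', ENNReal.tsum_comm]
      simp only [expConv, ENNReal.tsum_mul_left]
    rw [e1, e2, ← ENNReal.tsum_add, ← ENNReal.tsum_mul_left]
    refine ENNReal.tsum_le_tsum fun i => ?_
    obtain ⟨j, k⟩ := i
    by_cases hkj : k ≤ j
    · simp only [if_pos hkj]
      refine le_trans ?_ le_self_add
      have := bandExp_le hs hm hε1 hε3 hN1 hN2 hN3 (ℓ := ℓ) hkj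
      calc _ = 2 ^ (ℓ * s + bandExp n m₁ m₂ l₁ l₂ N ℓ j k) * (a j * b k) := by
            rw [hadd]; ring
        _ ≤ 2 ^ (j * s₁ + k * s₂ - ε * |(ℓ : ℝ) - j| - ε * |(j : ℝ) - k|) * (a j * b k) := by
            gcongr
            · exact one_le_two
            · rw [bandExp, kernelExp, if_pos hkj]; exact this
        _ = _ := by
            rw [sub_eq_add_neg, sub_eq_add_neg, hadd, hadd, hadd]
            unfold expKernel
            ring
    · simp only [if_neg hkj]
      refine le_trans ?_ le_add_self
      have := bandExp_le ((hs'.trans (add_comm _ _))) ((add_comm _ _).trans hl) hε2 hε3 hN1 hN2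
        hN4 (ℓ := ℓ) (not_le.1 hkj).le
      rw [gap_comm, min_left_comm] at this
      calc _ = 2 ^ (ℓ * s + bandExp n m₁ m₂ l₁ l₂ N ℓ j k) * (a' j * b' k) := by
            rw [hadd]; ring
        _ ≤ 2 ^ (k * s₂' + j * s₁' - ε * |(ℓ : ℝ) - k| - ε * |(k : ℝ) - j|) * (a' j * b' k) := by
            gcongr
            · exact one_le_two
            · rw [bandExp, kernelExp, if_neg hkj, add_comm (j * l₁)]; exact this
        _ = _ := by
            rw [sub_eq_add_neg, sub_eq_add_neg, hadd, hadd, hadd]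
            unfold expKernel
            ring
  refine (lqNorm_mono q hpt).trans ((hC₃ _ _).trans ?_)
  rw [ENNReal.coe_mul, mul_assoc, mul_add ((max C₁ C₂ : ℝ≥0) : ℝ≥0∞)]
  gcongr
  · refine (hC₁ _ _).trans ?_
    gcongr
    exact le_max_left _ _
  · refine (hC₂ _ _).trans ?_
    rw [mul_comm (lqNorm q₂' _)]
    gcongr
    exact le_max_right _ _

end Sequences

/-! ### Distributions given by functions -/

section Distributions

variable {n : ℕ}

lemma integrable_schwartz_mul (φ : 𝓢(Rn n, ℂ)) {h : Rn n → ℂ} (hh : Continuous h) {B : ℝ}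
    (hB : ∀ x, ‖h x‖ ≤ B) : Integrable fun x => φ x * h x :=
  (φ.integrable (μ := volume)).mul_bdd (c := B) hh.aestronglyMeasurable
    (Filter.Eventually.of_forall hB)

lemma exists_isRepresentedBy {h : Rn n → ℂ} (hh : Continuous h) {B : ℝ} (hB : ∀ x, ‖h x‖ ≤ B) :
    ∃ T : 𝓢'(Rn n, ℂ), IsRepresentedBy T h := by
  have hm : MemLp h ⊤ (volume : Measure (Rn n)) :=
    memLp_top_of_bound hh.aestronglyMeasurable B (Filter.Eventually.of_forall hB)
  refine ⟨Lp.toTemperedDistribution (hm.toLp h), fun φ => ⟨integrable_schwartz_mul φ hh hB, ?_⟩⟩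
  rw [Lp.toTemperedDistribution_apply]
  refine integral_congr_ae ?_
  filter_upwards [hm.coeFn_toLp] with x hx
  rw [hx, smul_eq_mul]

/-- A distributional multiplier acts on the test function. This turns that action into an integral
against the Littlewood–Paley kernel, from which Fubini recovers the convolution with the represented
function. -/
lemma fourier_smul_fourierInv_apply (g φ : 𝓢(Rn n, ℂ)) (z : Rn n) :
    𝓕 (SchwartzMap.smulLeftCLM ℂ g (𝓕⁻ φ)) z =
      ∫ x, φ x * (𝓕⁻ g : 𝓢(Rn n, ℂ)) (x - z) := by
  have hG : Integrable fun ξ => (Real.fourierChar (-inner ℝ ξ z) : ℂ) * g ξ := by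
    refine (g.integrable (μ := volume)).bdd_mul (c := 1)
      (continuous_fourierChar_comp (by fun_prop)).aestronglyMeasurable
      (Filter.Eventually.of_forall fun ξ => by simp)
  have hflip := VectorFourier.integral_fourierIntegral_smul_eq_flip (L := -innerₗ (Rn n))
    (μ := volume) (ν := volume) Real.continuous_fourierChar
    (continuous_inner.neg) (φ.integrable (μ := volume)) hG
  have hfl : (-innerₗ (Rn n)).flip = -innerₗ (Rn n) := by
    ext x y; simp [real_inner_comm]
  rw [hfl] at hflip
  rw [SchwartzMap.fourier_coe, Real.fourier_eq]
  have h1 : ∀ ξ, Real.fourierChar (-inner ℝ ξ z) • SchwartzMap.smulLeftCLM ℂ g (𝓕⁻ φ) ξ =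
      VectorFourier.fourierIntegral Real.fourierChar volume (-innerₗ (Rn n)) φ ξ •
        ((Real.fourierChar (-inner ℝ ξ z) : ℂ) * g ξ) := by
    intro ξ
    rw [SchwartzMap.smulLeftCLM_apply_apply g.hasTemperateGrowth, SchwartzMap.fourierInv_coe]
    simp only [Circle.smul_def, smul_eq_mul]
    rw [← mul_assoc, mul_comm]
    rfl
  simp_rw [h1]
  rw [hflip]
  refine integral_congr_ae (Filter.Eventually.of_forall fun x => ?_)
  simp only [smul_eq_mul]
  congr 1
  rw [SchwartzMap.fourierInv_coe, Real.fourierInv_eq]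
  refine integral_congr_ae (Filter.Eventually.of_forall fun ξ => ?_)
  simp only [Circle.smul_def, smul_eq_mul, LinearMap.neg_apply, innerₗ_apply_apply, neg_neg]
  rw [← mul_assoc, ← Circle.coe_mul, ← AddChar.map_add_eq_mul, inner_sub_right, sub_eq_add_neg]

lemma IsRepresentedBy.multiplier {T : 𝓢'(Rn n, ℂ)} {h : Rn n → ℂ} (hT : IsRepresentedBy T h)
    (hh : Continuous h) {B : ℝ} (hB : ∀ x, ‖h x‖ ≤ B) (ψ₀ : 𝓢(Rn n, ℂ)) (ℓ : ℕ) :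
    IsRepresentedBy (multiplier (lpPiece ψ₀ ℓ) T) (lpConv ψ₀ ℓ h) := by
  intro φ
  refine ⟨integrable_schwartz_mul φ (continuous_lpConv ψ₀ ℓ hh hB) (norm_lpConv_le ψ₀ ℓ hB), ?_⟩
  rw [KatoPonce.multiplier, ← lpFreq_coe, TemperedDistribution.fourierMultiplierCLM_apply_apply,
    (hT _).2]
  simp_rw [fourier_smul_fourierInv_apply]
  unfold lpConv
  obtain ⟨Ψ, hΨ⟩ : ∃ Ψ : 𝓢(Rn n, ℂ), Ψ = 𝓕⁻ (lpFreq ψ₀ ℓ) := ⟨_, rfl⟩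
  rw [← hΨ]
  have hint : Integrable (Function.uncurry fun x z : Rn n => φ x * (h z * Ψ (x - z)))
      (volume.prod volume) := by
    have h0 := integrable_convolution_integrand (dilate (-1) (by norm_num) Ψ) φ
    have h1 := h0.bdd_mul (c := B) (f := fun p : Rn n × Rn n => h p.2)
      (hh.comp continuous_snd).aestronglyMeasurable (Filter.Eventually.of_forall fun p => hB _)
    refine h1.congr (Filter.Eventually.of_forall fun p => ?_)
    simp only [Function.uncurry, dilate_apply, neg_smul, one_smul, neg_sub]
    ring
  calc ∫ z, (∫ x, φ x * Ψ (x - z)) * h z = ∫ z, ∫ x, φ x * (h z * Ψ (x - z)) := by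
        refine integral_congr_ae (Filter.Eventually.of_forall fun z => ?_)
        simp only
        rw [← integral_mul_const]
        refine integral_congr_ae (Filter.Eventually.of_forall fun x => ?_)
        simp only
        ring
    _ = ∫ x, ∫ z, φ x * (h z * Ψ (x - z)) := (integral_integral_swap hint).symm
    _ = _ := by
        refine integral_congr_ae (Filter.Eventually.of_forall fun x => ?_)
        simp only
        rw [integral_const_mul, ← integral_sub_left_eq_self _ volume x]
        simp

lemma distLpNorm_multiplier_le {T : 𝓢'(Rn n, ℂ)} {h : Rn n → ℂ} (hT : IsRepresentedBy T h)
    (hh : Continuous h) {B : ℝ} (hB : ∀ x, ‖h x‖ ≤ B) (ψ₀ : 𝓢(Rn n, ℂ)) (ℓ : ℕ) (p : ℝ≥0∞) :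
    distLpNorm p (multiplier (lpPiece ψ₀ ℓ) T) ≤ eLpNorm (lpConv ψ₀ ℓ h) p volume :=
  iInf₂_le _ (hT.multiplier hh hB ψ₀ ℓ)

/-- Test against a bump function equal to 1 on the compact set. -/
lemma IsRepresentedBy.locallyIntegrable {T : 𝓢'(Rn n, ℂ)} {g : Rn n → ℂ}
    (hT : IsRepresentedBy T g) : LocallyIntegrable g := by
  rw [locallyIntegrable_iff]
  intro K hK
  obtain ⟨R, hR⟩ := hK.isBounded.subset_closedBall 0
  have hR' : K ⊆ Metric.closedBall 0 (max R 1) :=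
    hR.trans (Metric.closedBall_subset_closedBall (le_max_left _ _))
  have hpos : (0 : ℝ) < max R 1 := lt_max_of_lt_right one_pos
  let b : ContDiffBump (0 : Rn n) := ⟨max R 1, max R 1 + 1, hpos, by linarith⟩
  have hs : ContDiff ℝ ∞ (fun ξ => (b ξ : ℂ)) := Complex.ofRealCLM.contDiff.comp b.contDiff
  have hc : HasCompactSupport (fun ξ => (b ξ : ℂ)) :=
    b.hasCompactSupport.comp_left (g := fun x : ℝ => (x : ℂ)) (by simp)
  refine ((hT (hc.toSchwartzMap hs)).1.integrableOn (s := K)).congr_fun (fun x hx => ?_)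
    hK.measurableSet
  have : b x = 1 := b.one_of_mem_closedBall (hR' hx)
  simp [this]

/-- `distLpNorm` is an infimum, so bounding the output needs just one representative, whereas this
bound for the inputs needs all representatives to agree almost everywhere. -/
lemma le_distLpNorm_coe (f : 𝓢(Rn n, ℂ)) (p : ℝ≥0∞) :
    eLpNorm f p volume ≤ distLpNorm p (f : 𝓢'(Rn n, ℂ)) := by
  refine le_iInf₂ fun g hg => le_of_eq (eLpNorm_congr_ae ?_)
  refine ae_eq_of_forall_integral_schwartz_eq f.continuous.locallyIntegrable hg.locallyIntegrable
    fun φ => ?_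
  rw [← (hg φ).2]
  exact (SchwartzMap.toTemperedDistributionCLM_apply_apply volume f φ).symm

lemma multiplier_coe (ψ₀ f : 𝓢(Rn n, ℂ)) (ℓ : ℕ) :
    multiplier (lpPiece ψ₀ ℓ) (f : 𝓢'(Rn n, ℂ)) = (lpProj ψ₀ ℓ f : 𝓢'(Rn n, ℂ)) := by
  rw [multiplier, ← lpFreq_coe, lpProj]
  exact TemperedDistribution.fourierMultiplierCLM_toTemperedDistributionCLM_eq
    (lpFreq ψ₀ ℓ).hasTemperateGrowth f

lemma besovNorm_eq_lqNorm {ψ₀ : 𝓢(Rn n, ℂ)} {s : ℝ} {p q : ℝ≥0∞} (u : 𝓢'(Rn n, ℂ)) :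
    besovNorm ψ₀ s p q u = lqNorm q fun ℓ : ℕ => 2 ^ ((ℓ : ℝ) * s) *
      distLpNorm p (multiplier (lpPiece ψ₀ ℓ) u) := by
  unfold besovNorm lqNorm
  split_ifs
  · rfl
  · simp_rw [ENNReal.mul_rpow_of_nonneg _ _ ENNReal.toReal_nonneg, ← ENNReal.rpow_mul]

lemma lqNorm_lpProj_le (ψ₀ f : 𝓢(Rn n, ℂ)) (s : ℝ) (p q : ℝ≥0∞) :
    lqNorm q (fun ℓ : ℕ => 2 ^ ((ℓ : ℝ) * s) * eLpNorm (lpProj ψ₀ ℓ f) p volume) ≤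
      besovNorm ψ₀ s p q (f : 𝓢'(Rn n, ℂ)) := by
  rw [besovNorm_eq_lqNorm]
  refine lqNorm_mono q fun ℓ => ?_
  rw [multiplier_coe]
  gcongr
  exact le_distLpNorm_coe _ p

end Distributions

/-! ### The Kato–Ponce estimate -/

section Main

variable {n : ℕ}

lemma IsBS₂.hasSymbolBounds {m₁ m₂ : ℝ} {σ : Rn n × Rn n × Rn n → ℂ} (h : IsBS₂ m₁ m₂ σ) :
    HasSymbolBounds (fun z => symbolWeight m₁ m₂ z.2.1 z.2.2) σ :=
  ⟨h.1, fun α β₁ β₂ => (h.2 α β₁ β₂).imp fun _ hC z => hC z.1 z.2.1 z.2.2⟩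

/-- For nonpositive exponents, powers of 1+|ξ₁|+|ξ₂| are bounded by the same powers of 1+|ξ₁| and of
1+|ξ₂|. -/
lemma IsBS.isBS₂ {m m₁ m₂ : ℝ} (hm₁ : m₁ ≤ 0) (hm₂ : m₂ ≤ 0) (hm : m₁ + m₂ = m)
    {σ : Rn n × Rn n × Rn n → ℂ} (h : IsBS m σ) : IsBS₂ m₁ m₂ σ := by
  refine ⟨h.1, fun α β₁ β₂ => ?_⟩
  obtain ⟨C, hC⟩ := h.2 α β₁ β₂
  refine ⟨|C|, fun x ξ₁ ξ₂ => (hC x ξ₁ ξ₂).trans ?_⟩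
  have h1 := norm_nonneg ξ₁
  have h2 := norm_nonneg ξ₂
  have hpos : 0 < 1 + ‖ξ₁‖ + ‖ξ₂‖ := by positivity
  rw [← hm, Real.rpow_add hpos]
  refine mul_le_mul (le_abs_self C) (mul_le_mul ?_ ?_ (by positivity) (by positivity))
    (by positivity) (abs_nonneg C)
  · exact Real.rpow_le_rpow_of_nonpos (by positivity) (by linarith) hm₁
  · exact Real.rpow_le_rpow_of_nonpos (by positivity) (by linarith) hm₂

/-- The estimate for a symbol in two product classes `BS^{(m₁,m₂)}_{0,0}` and
`BS^{(l₁,l₂)}_{0,0}`. -/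
theorem katoPonceEstimate_of_isBS₂ {ψ₀ : 𝓢(Rn n, ℂ)} (hψ₀ : IsLPGenerator ψ₀)
    {p p₁ p₂ p₁' p₂' : ℝ≥0∞} (hp : 1 ≤ p) (hp2 : p ≤ 2) (hp₁ : 2 ≤ p₁) (hp₂ : 2 ≤ p₂)
    (hp₁' : 2 ≤ p₁') (hp₂' : 2 ≤ p₂') {q q₁ q₂ q₁' q₂' : ℝ≥0∞}
    (hq : 0 < q) (hq₁ : 0 < q₁) (hq₂ : 0 < q₂) (hq₁' : 0 < q₁') (hq₂' : 0 < q₂')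
    {s s₁ s₂ s₁' s₂' : ℝ} (hpp : p⁻¹ ≤ p₁⁻¹ + p₂⁻¹) (hpp' : p⁻¹ ≤ p₁'⁻¹ + p₂'⁻¹)
    (hqq : q⁻¹ = q₁⁻¹ + q₂⁻¹) (hqq' : q⁻¹ = q₁'⁻¹ + q₂'⁻¹) (hs : s = s₁ + s₂)
    (hs' : s = s₁' + s₂') {m₁ m₂ l₁ l₂ : ℝ} (hm : m₁ + m₂ = -(n : ℝ) / 2)
    (hl : l₁ + l₂ = -(n : ℝ) / 2) (h₂ : s₂ < m₂ + (n : ℝ) / 2) (h₁' : s₁' < l₁ + (n : ℝ) / 2)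
    (hn : -(n : ℝ) / 2 < s) {σ : Rn n × Rn n × Rn n → ℂ} (hσ : IsBS₂ m₁ m₂ σ)
    (hσ' : IsBS₂ l₁ l₂ σ) :
    KatoPonceEstimate ψ₀ σ s p q s₁ p₁ q₁ s₂ p₂ q₂ s₁' p₁' q₁' s₂' p₂' q₂' := by
  obtain ⟨N, C₁, hC₁⟩ := exists_lqNorm_bands_le hs hs' hm hl h₂ h₁' hn hq hq₁ hq₂ hq₁' hq₂' hqq hqq'
  obtain ⟨C₂, hC₂⟩ := exists_eLpNorm_lpConv_bilinearOp_le hσ.hasSymbolBounds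
    hσ'.hasSymbolBounds hψ₀ N hp hp2 hp₁ hp₂ hp₁' hp₂' hpp hpp'
  refine ⟨C₂ * C₁, fun f₁ f₂ => ?_⟩
  have hh := continuous_bilinearOp hσ.hasSymbolBounds f₁ f₂
  obtain ⟨B, hB⟩ := exists_norm_bilinearOp_le hσ.hasSymbolBounds f₁ f₂
  obtain ⟨T, hT⟩ := exists_isRepresentedBy hh hB
  refine ⟨T, hT, ?_⟩
  have hbands := hC₁ (fun j => eLpNorm (lpProj ψ₀ j f₁) p₁ volume)
    (fun k => eLpNorm (lpProj ψ₀ k f₂) p₂ volume) (fun j => eLpNorm (lpProj ψ₀ j f₁) p₁' volume)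
    (fun k => eLpNorm (lpProj ψ₀ k f₂) p₂' volume)
  have hpiece := hC₂ f₁ f₂
  obtain ⟨X, hX⟩ : ∃ X : ℕ × ℕ → ℝ≥0∞, X = fun i =>
      if i.2 ≤ i.1 then eLpNorm (lpProj ψ₀ i.1 f₁) p₁ volume * eLpNorm (lpProj ψ₀ i.2 f₂) p₂ volume
      else eLpNorm (lpProj ψ₀ i.1 f₁) p₁' volume * eLpNorm (lpProj ψ₀ i.2 f₂) p₂' volume := ⟨_, rfl⟩
  have hXi : ∀ i : ℕ × ℕ, (if i.2 ≤ i.1 then eLpNorm (lpProj ψ₀ i.1 f₁) p₁ volume *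
      eLpNorm (lpProj ψ₀ i.2 f₂) p₂ volume else eLpNorm (lpProj ψ₀ i.1 f₁) p₁' volume *
      eLpNorm (lpProj ψ₀ i.2 f₂) p₂' volume) = X i := fun i => by rw [hX]
  simp only [hXi] at hbands hpiece
  rw [besovNorm_eq_lqNorm]
  have hle : ∀ ℓ : ℕ, 2 ^ ((ℓ : ℝ) * s) * distLpNorm p (multiplier (lpPiece ψ₀ ℓ) T) ≤
      C₂ * (2 ^ ((ℓ : ℝ) * s) * ∑' i : ℕ × ℕ, 2 ^ bandExp n m₁ m₂ l₁ l₂ N ℓ i.1 i.2 * X i) := by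
    intro ℓ
    rw [mul_left_comm, ← ENNReal.tsum_mul_left]
    refine mul_le_mul_right ((distLpNorm_multiplier_le hT hh hB ψ₀ ℓ p).trans
      ((hpiece ℓ).trans (le_of_eq (tsum_congr fun i => mul_assoc _ _ _)))) _
  refine (lqNorm_mono q hle).trans ?_
  rw [lqNorm_const_mul hq, ENNReal.coe_mul, mul_assoc]
  refine mul_le_mul_right (hbands.trans (mul_le_mul_right
    (add_le_add (mul_le_mul' ?_ ?_) (mul_le_mul' ?_ ?_)) _)) _ <;>
    exact lqNorm_lpProj_le ψ₀ _ _ _ _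

end Main

end KatoPonce

end

/-! ### Choice of the product classes. -/

theorem theorem1p1 (n : ℕ) (hn : 0 < n)
    (ψ₀ : 𝓢(KatoPonce.Rn n, ℂ)) (hψ₀ : KatoPonce.IsLPGenerator ψ₀)
    (p p₁ p₂ p₁' p₂' : ℝ≥0∞)
    (hp : 1 ≤ p) (hp2 : p ≤ 2) (hp₁ : 2 ≤ p₁) (hp₂ : 2 ≤ p₂) (hp₁' : 2 ≤ p₁') (hp₂' : 2 ≤ p₂')
    (q q₁ q₂ q₁' q₂' : ℝ≥0∞)
    (hq : 0 < q) (hq₁ : 0 < q₁) (hq₂ : 0 < q₂) (hq₁' : 0 < q₁') (hq₂' : 0 < q₂')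
    (s s₁ s₂ s₁' s₂' : ℝ)
    (hpp : p⁻¹ ≤ p₁⁻¹ + p₂⁻¹) (hpp' : p⁻¹ ≤ p₁'⁻¹ + p₂'⁻¹)
    (hqq : q⁻¹ = q₁⁻¹ + q₂⁻¹) (hqq' : q⁻¹ = q₁'⁻¹ + q₂'⁻¹)
    (hss : s = s₁ + s₂) (hss' : s = s₁' + s₂') :
    (∀ σ : KatoPonce.Rn n × KatoPonce.Rn n × KatoPonce.Rn n → ℂ,
      KatoPonce.IsBS (-(n : ℝ) / 2) σ →
      s₁' < (n : ℝ) / 2 → s₂ < (n : ℝ) / 2 → -(n : ℝ) / 2 < s →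
      KatoPonce.KatoPonceEstimate ψ₀ σ s p q s₁ p₁ q₁ s₂ p₂ q₂ s₁' p₁' q₁' s₂' p₂' q₂') ∧
    (∀ (m₁ m₂ : ℝ), m₁ + m₂ = -(n : ℝ) / 2 →
      ∀ σ : KatoPonce.Rn n × KatoPonce.Rn n × KatoPonce.Rn n → ℂ,
      KatoPonce.IsBS₂ m₁ m₂ σ →
      s₁' < m₁ + (n : ℝ) / 2 → s₂ < m₂ + (n : ℝ) / 2 → -(n : ℝ) / 2 < s →
      KatoPonce.KatoPonceEstimate ψ₀ σ s p q s₁ p₁ q₁ s₂ p₂ q₂ s₁' p₁' q₁' s₂' p₂' q₂') := by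
  have hn0 : (0 : ℝ) ≤ n := Nat.cast_nonneg n
  refine ⟨fun σ hσ h₁ h₂ hs => ?_, fun m₁ m₂ hm σ hσ h₁ h₂ hs => ?_⟩
  -- The classes are (-n/2, 0) and (0, -n/2): the decay of the symbol is assigned to the input of
  -- higher frequency, which turns both index conditions into < n/2.
  · exact KatoPonce.katoPonceEstimate_of_isBS₂ hψ₀ hp hp2 hp₁ hp₂ hp₁' hp₂' hq hq₁ hq₂ hq₁' hq₂'
      hpp hpp' hqq hqq' hss hss' (add_zero _) (zero_add _) (by linarith) (by linarith) hs
      (hσ.isBS₂ (by linarith) le_rfl (add_zero _)) (hσ.isBS₂ le_rfl (by linarith) (zero_add _))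
  · exact KatoPonce.katoPonceEstimate_of_isBS₂ hψ₀ hp hp2 hp₁ hp₂ hp₁' hp₂' hq hq₁ hq₂ hq₁' hq₂'
      hpp hpp' hqq hqq' hss hss' hm hm h₂ h₁ hs hσ hσ
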